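/- **Setting.** Let $(k_N)_{N\in\mathbb N}$ be positive integers and $(G_N)_{N\in\mathbb N}$ finite Abelian groups. Write $n_N=|G_N|$ and let $d(G)$ be the minimal size of a generating set of $G$. Suppose that $n_N\to\infty$, that $k_N-d(G_N)\to\infty$, and that for all sufficiently large $N$ $$\frac{k_N-d(G_N)-1}{k_N}\ \ge\ 5\,\frac{k_N}{\log n_N}+2\,\frac{d(G_N)\log\log k_N}{\log n_N}.$$ For $z=(z_1,\dots,z_k)\in G^k$, consider the rate-1 continuous-time random walk $S$ on $G$ started from $0$. At each step it picks $i\in\{1,\dots,k\}$ uniformly; in the *directed* case it adds $z_i$, and in the *undirected* case it adds $z_i$ or $-z_i$ with probability $\tfrac12$ each. Let $d_{G(z)}(t)=\max_{A\subseteq G}\big|\mathbb P(S(t)\in A)-|A|/|G|\big|$ and $t_{\rm mix}(\varepsilon)=\inf\{t\ge0: d_{G(z)}(t)\le\varepsilon\}$. Write $d_{G_k}$ when $z=Z=(Z_1,\dots,Z_k)$ with $Z_1,\dots,Z_k$ i.i.d. uniform on $G$. "In probability" and "whp" (with probability tending to $1$ as $N\to\infty$) refer to $Z$. Let $W$ be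 the rate-1 walk on $\mathbb Z^k$ from $0$ of the same kind, with the standard basis as generators. Let $W_1$ be its first coordinate and $Q_1(t)=-\log\nu(W_1(t))$, where $\nu$ is the law of $W_1(t)$. The *cutoff times* $t_\alpha=t_\alpha(k,n)\ge0$, $\alpha\in\mathbb R$, are defined by $$\mathbb E\,Q_1(t_\alpha)=\frac{\log n+\alpha\sqrt{vk}}{k},\qquad v=\operatorname{Var}Q_1(t_0),$$ whenever $\log n+\alpha\sqrt{vk}\ge0$. Let $\Psi(\alpha)=\mathbb P(N(0,1)>\alpha)$. Abbreviate $t_{\alpha}=t_{\alpha}(k_N,n_N)$. **Theorem.** In both the directed and the undirected case, the following hold as $N\to\infty$. 1. The cutoff times are well defined: for each $N$, $t\mapsto\mathbb E\,Q_1(t)$ is a bijection of $[0,\infty)$, and for each $\alpha\in\mathbb R$, $\log n_N+\alpha\sqrt{vk_N}\ge0$ for all large $N$. 2. For every $\alpha\in\mathbb R$, $t_\alpha/t_0\to1$. 3. For every $\alpha\in\mathbb R$, $d_{G_k}(t_\alpha)\to\Psi(\alpha)$ in probability. 4. The lower bound holds for every choice of generators: for all $\alpha\in\mathbb R$ and $\delta>0$,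 for all large $N$ and all $z\in G_N^{k_N}$, $d_{G_N(z)}(t_\alpha)\ge\Psi(\alpha)-\delta$. 5. There is cutoff at $t_0$ whp: for every $\varepsilon\in(0,1)$, $d_{G_k}((1-\varepsilon)t_0)\to1$ and $d_{G_k}((1+\varepsilon)t_0)\to0$ in probability. 6. For every $\varepsilon\in(0,1)$, with $a=\Psi^{-1}(\varepsilon)$ and every $\delta>0$, whp both mixing times are finite and $$\big|\big(t_{\rm mix}(\varepsilon)-t_{\rm mix}(\tfrac12)\big)-(t_a-t_0)\big|\le\delta\,|t_a-t_0|.$$ 7. If moreover $k_N/\log n_N\to0$, then, with $w_N=\dfrac{\sqrt{k_N}\,n_N^{2/k_N}}{\sqrt2\,\pi e}$, $$\frac{t_0}{k_N n_N^{2/k_N}/(2\pi e)}\to1,\qquad \frac{t_\alpha-t_0}{w_N}\to\alpha\ \ (\alpha\in\mathbb R),\qquad \frac{t_{\rm mix}(\varepsilon)-t_0}{w_N}\to\Psi^{-1}(\varepsilon)\ \text{ in probability }\ (\varepsilon\in(0,1)).$$ -/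

import Mathlib

open Filter Topology MeasureTheory ProbabilityTheory
open scoped ENNReal NNReal

noncomputable section

namespace RandomCayley

/-- The two kinds of Cayley graph: directed (a step adds a generator) and undirected
(a step adds a generator or its inverse, each with probability one half). -/
inductive CayleyKind
  | directed
  | undirected

/-- One step of the walk with generators `z 0, …, z (k - 1)`: choose an index uniformly and add
`z i` (directed), respectively `z i` or `-z i` according to a fair coin (undirected). -/
def stepLaw {A : Type*} [AddCommGroup A] {k : ℕ} [NeZero k] (o : CayleyKind) (z : Fin k → A) :
    PMF A :=
  match o with
  | .directed => (PMF.uniformOfFintype (Fin k)).map z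
  | .undirected =>
      (PMF.uniformOfFintype (Fin k × Bool)).map fun p => if p.2 then z p.1 else -z p.1

/-- The law after `m` independent steps of law `p`, started from `0`. -/
def discreteWalk {A : Type*} [AddCommGroup A] (p : PMF A) : ℕ → PMF A
  | 0 => PMF.pure 0
  | m + 1 => (discreteWalk p m).bind fun x => p.map fun y => x + y

/-- The law at time `t ≥ 0` of the rate-1 continuous-time walk with generators `z`, started
from `0`: the number of steps made by time `t` is Poisson of mean `t`. -/
def walkLaw {A : Type*} [AddCommGroup A] {k : ℕ} [NeZero k] (o : CayleyKind) (z : Fin k → A)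
    (t : ℝ) : PMF A :=
  (poissonMeasure t.toNNReal).toPMF.bind (discreteWalk (stepLaw o z))

/-- Total variation distance between a law on a finite set and the uniform distribution. -/
def tvToUniform {G : Type*} [Fintype G] (p : PMF G) : ℝ :=
  ⨆ A : Finset G, |(∑ x ∈ A, (p x).toReal) - (A.card : ℝ) / (Fintype.card G : ℝ)|

/-- `d_{G(z)}(t)`: the distance from uniform at time `t` of the rate-1 walk on the Cayley graph
of `G` with generators `z`. -/
def tvDist {G : Type*} [AddCommGroup G] [Fintype G] {k : ℕ} [NeZero k] (o : CayleyKind)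
    (z : Fin k → G) (t : ℝ) : ℝ :=
  tvToUniform (walkLaw o z t)

/-- The law of `W(t)`, the rate-1 simple (undirected) or directed walk on `ℤ^k`. -/
def auxLaw (o : CayleyKind) (k : ℕ) [NeZero k] (t : ℝ) : PMF (Fin k → ℤ) :=
  walkLaw o (fun i : Fin k => (Pi.single i 1 : Fin k → ℤ)) t

/-- The law of the first coordinate `W₁(t)`. -/
def coordLaw (o : CayleyKind) (k : ℕ) [NeZero k] (t : ℝ) : PMF ℤ :=
  (auxLaw o k t).map fun w => w 0

/-- `Q₁(t)` as a function of the value of `W₁(t)`: minus the log of its own probability. -/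
def surprisal (o : CayleyKind) (k : ℕ) [NeZero k] (t : ℝ) (x : ℤ) : ℝ :=
  -Real.log (coordLaw o k t x).toReal

/-- `E[Q₁(t)]`, the entropy of `W₁(t)`. -/
def entropy (o : CayleyKind) (k : ℕ) [NeZero k] (t : ℝ) : ℝ :=
  ∫ x, surprisal o k t x ∂(coordLaw o k t).toMeasure

/-- `Var[Q₁(t)]`. -/
def varentropy (o : CayleyKind) (k : ℕ) [NeZero k] (t : ℝ) : ℝ :=
  variance (surprisal o k t) (coordLaw o k t).toMeasure

/-- The time `t ≥ 0` with `E[Q₁(t)] = h`. (For `h ≥ 0` there is exactly one.) -/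
def timeOfEntropy (o : CayleyKind) (k : ℕ) [NeZero k] (h : ℝ) : ℝ :=
  sInf {t : ℝ | 0 ≤ t ∧ entropy o k t = h}

/-- The entropic time `t₀(k, n)`: `E[Q₁(t₀)] = log n / k`. -/
def entropicTime (o : CayleyKind) (k : ℕ) [NeZero k] (n : ℕ) : ℝ :=
  timeOfEntropy o k (Real.log n / k)

/-- The target `log n + α √(v k)`, with `v = Var[Q₁(t₀)]`. -/
def entropyTarget (o : CayleyKind) (k : ℕ) [NeZero k] (n : ℕ) (α : ℝ) : ℝ :=
  Real.log n + α * Real.sqrt (varentropy o k (entropicTime o k n) * k)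

/-- The cutoff time `t_α(k, n)`: `E[Q₁(t_α)] = (log n + α √(v k)) / k`. -/
def cutoffTime (o : CayleyKind) (k : ℕ) [NeZero k] (n : ℕ) (α : ℝ) : ℝ :=
  timeOfEntropy o k (entropyTarget o k n α / k)

/-- The standard Gaussian tail. -/
def Psi (α : ℝ) : ℝ := (gaussianReal 0 1).real (Set.Ioi α)

/-- `τ` is the mixing time `inf {t ≥ 0 : d_{G(z)}(t) ≤ ε}`. If the infimum is over the empty set
(the mixing time is infinite), no real `τ` qualifies. -/
def IsMixingTime {G : Type*} [AddCommGroup G] [Fintype G] {k : ℕ} [NeZero k] (o : CayleyKind)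
    (z : Fin k → G) (ε τ : ℝ) : Prop :=
  IsGLB {t : ℝ | 0 ≤ t ∧ tvDist o z t ≤ ε} τ

/-- The law of `k` independent uniform elements of `G`. -/
def generatorLaw (k : ℕ) (G : Type*) [AddCommGroup G] [Fintype G] :
    @Measure (Fin k → G) (@MeasurableSpace.pi _ _ fun _ => ⊤) :=
  letI : MeasurableSpace G := ⊤
  Measure.pi fun _ : Fin k => (PMF.uniformOfFintype G).toMeasure

section Sequences

variable (k : ℕ → ℕ) (G : ℕ → Type*) [∀ N, AddCommGroup (G N)] [∀ N, Fintype (G N)]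

/-- With high probability over the generators: the probability of `E N` tends to `1`. -/
def Whp (E : ∀ N, Set (Fin (k N) → G N)) : Prop :=
  Tendsto (fun N => generatorLaw (k N) (G N) (E N)) atTop (𝓝 1)

/-- Convergence in probability to a constant of functions of the generators. -/
def TendstoInProb (X : ∀ N, (Fin (k N) → G N) → ℝ) (c : ℝ) : Prop :=
  ∀ δ : ℝ, 0 < δ →
    Tendsto (fun N => generatorLaw (k N) (G N) {z | δ < |X N z - c|}) atTop (𝓝 0)

/-- The standing conditions on `(k, G)`, with `d(G) = AddGroup.rank G` the minimal size of a
generating set. As everything is asymptotic, the inequality is asked for all large `N` only. -/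
structure Condition : Prop where
  card_tendsto : Tendsto (fun N => (Fintype.card (G N) : ℝ)) atTop atTop
  sub_rank_tendsto : Tendsto (fun N => (k N : ℝ) - (AddGroup.rank (G N) : ℝ)) atTop atTop
  ineq : ∀ᶠ N in atTop,
    ((k N : ℝ) - (AddGroup.rank (G N) : ℝ) - 1) / (k N : ℝ) ≥
      5 * ((k N : ℝ) / Real.log (Fintype.card (G N))) +
      2 * ((AddGroup.rank (G N) : ℝ) * Real.log (Real.log (k N)) /
        Real.log (Fintype.card (G N)))

end Sequences

end RandomCayley

end

open RandomCayley

/-! The walk on `G` is the image of the lattice walk `W` under `w ↦ ∑ w i • z i` (`walkLaw_eq_map`),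
and by Poisson thinning the coordinates of `W(t)` are independent walks on ℤ at time `s = t / k`
(`auxLaw_toMeasure`). Hence `-log` of the mass of `W(t)` at its own position is a sum of `k` i.i.d.
surprisals. At `t_α` its mean is `log n + α √(v k)` and its variance is asymptotic to `v k`, so by
the central limit theorem `W(t_α)` sits, with probability tending to `Ψ(α)`, at a point of mass much
larger than `1 / n`, and otherwise at a point of mass much smaller (`tendsto_prob_le`,
`tendsto_prob_lt`). "Much" means a factor `exp ω` with `ω = k^{1/4}`, negligible on the logarithmic
scale `√(v k)`.

Lower bound (`prob_sum_surp_le_sub_le_tvDist`): at most `n exp (-ω)` points can have mass at least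
`exp ω / n`. For any `z`, their images fill at most a proportion `exp (-ω)` of `G` and yet carry
probability about `Ψ(α)`.

Upper bound (`card_bad_generators_le`, `generatorLaw_tvDist_le`): keep only the points of mass at
most `exp (-ω) / n` whose coordinates are within `r` standard deviations of the mean. By
Cauchy–Schwarz the distance is at most the discarded mass, about `Ψ(α)`, plus an `L²` deviation
whose square is averaged over `Z`. The average involves the probability that two independent copies
`w`, `w'` have the same image. The diagonal costs at most `exp (-ω)`. If the differences `w i - w'
i` have greatest common divisor `γ > 0`, then `∑ (w i - w' i) • Z i` is uniform on a subgroup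
containing `γ G`, so it vanishes with probability at most `γ^d / n` (`card_mul_card_relation_le`).
The value `γ = 1` gives the main term, which cancels. For `γ ≥ 2`, divisibility of all `k`
independent differences has probability at most `(1 / γ + 0.45 / √s)^k`, and the standing condition
makes the sum of `γ^d (1 / γ + 0.45 / √s)^k` tend to zero (`gcd_sum_le`).

For one coordinate, Fourier inversion gives a uniform bound on the mass and a local limit theorem;
with exponential moments these yield entropy `½ log (2 π e s) + o(1)` and varentropy tending to `1 /
2`. Submodularity of the entropy of independent sums makes the entropy concave in time
(`concaveOn_lineEntropy`). Being also continuous and unbounded, it is a bijection of `[0, ∞)`, and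
its increments are comparable to relative increments of time (`lineEntropy_sub_ge`,
`lineEntropy_sub_le`). This converts entropy into time: `t_α / t_0 → 1`, and differences of cutoff
times have a definite order. Since the distance decreases in time and `Ψ` is strictly decreasing,
the profile locates the mixing times. If `k = o(log n)`, then `s → ∞` and the Gaussian asymptotics
make everything explicit. -/

namespace RandomCayley

/-! ### Transforms of laws on countable groups -/

section Transform

variable {A B : Type*}

/-- The expectation of a complex function under a law. -/
noncomputable def charSum (p : PMF A) (χ : A → ℂ) : ℂ := ∑' x, ((p x).toReal : ℂ) * χ x

lemma summable_toReal (p : PMF A) : Summable fun x => (p x).toReal :=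
  ENNReal.summable_toReal p.tsum_coe_ne_top

lemma tsum_toReal (p : PMF A) : ∑' x, (p x).toReal = 1 := by
  rw [← ENNReal.tsum_toReal_eq p.apply_ne_top, p.tsum_coe, ENNReal.toReal_one]

lemma summable_charSum (p : PMF A) {χ : A → ℂ} (h : ∀ x, ‖χ x‖ ≤ 1) :
    Summable fun x => ((p x).toReal : ℂ) * χ x := by
  refine Summable.of_norm_bounded (summable_toReal p) fun x => ?_
  rw [norm_mul, Complex.norm_real, Real.norm_of_nonneg ENNReal.toReal_nonneg]
  exact mul_le_of_le_one_right ENNReal.toReal_nonneg (h x)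

lemma bind_apply_toReal (p : PMF A) (f : A → PMF B) (b : B) :
    (p.bind f b).toReal = ∑' a, (p a).toReal * (f a b).toReal := by
  rw [PMF.bind_apply, ENNReal.tsum_toReal_eq
    (fun a => ENNReal.mul_ne_top (p.apply_ne_top a) ((f a).apply_ne_top b))]
  simp

/-- The double series is dominated by the joint law, which is summable with total one; this permits
the exchange of sums. -/
lemma charSum_bind (p : PMF A) (f : A → PMF B) {χ : B → ℂ} (h : ∀ x, ‖χ x‖ ≤ 1) :
    charSum (p.bind f) χ = ∑' a, ((p a).toReal : ℂ) * charSum (f a) χ := by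
  have hs : Summable fun q : A × B => (p q.1).toReal * (f q.1 q.2).toReal := by
    have : Summable fun q : A × B => (p q.1 * f q.1 q.2).toReal := by
      apply ENNReal.summable_toReal
      rw [ENNReal.tsum_prod']
      simp_rw [ENNReal.tsum_mul_left, PMF.tsum_coe, mul_one]
      rw [PMF.tsum_coe]
      exact ENNReal.one_ne_top
    simpa using this
  have hs' : Summable (Function.uncurry fun (a : A) (b : B) =>
      ((p a).toReal : ℂ) * (((f a b).toReal : ℂ) * χ b)) := by
    refine Summable.of_norm_bounded hs fun q => ?_
    simp only [Function.uncurry, norm_mul, Complex.norm_real,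
      Real.norm_of_nonneg ENNReal.toReal_nonneg]
    rw [← mul_assoc]
    exact mul_le_of_le_one_right (mul_nonneg ENNReal.toReal_nonneg ENNReal.toReal_nonneg) (h _)
  simp only [charSum]
  simp_rw [← tsum_mul_left]
  rw [← hs'.tsum_comm]
  refine tsum_congr fun b => ?_
  rw [bind_apply_toReal, Complex.ofReal_tsum, ← tsum_mul_right]
  refine tsum_congr fun a => ?_
  push_cast
  ring

lemma charSum_pure (a : A) (χ : A → ℂ) : charSum (PMF.pure a) χ = χ a := by
  rw [charSum, tsum_eq_single a]
  · simp
  · intro b hb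
    simp [PMF.pure_apply, hb]

lemma charSum_map (p : PMF A) (g : A → B) {χ : B → ℂ} (h : ∀ x, ‖χ x‖ ≤ 1) :
    charSum (p.map g) χ = charSum p (χ ∘ g) := by
  rw [← PMF.bind_pure_comp, charSum_bind _ _ h]
  simp only [Function.comp, charSum_pure]
  rfl

lemma charSum_mul_right (p : PMF A) (χ : A → ℂ) (c : ℂ) :
    charSum p (fun x => c * χ x) = c * charSum p χ := by
  simp only [charSum, ← tsum_mul_left]
  exact tsum_congr fun x => by ring

lemma charSum_uniform [Fintype A] [Nonempty A] (χ : A → ℂ) :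
    charSum (PMF.uniformOfFintype A) χ = (∑ x, χ x) / Fintype.card A := by
  rw [charSum, tsum_fintype, Finset.sum_div]
  refine Finset.sum_congr rfl fun x _ => ?_
  simp [PMF.uniformOfFintype_apply, div_eq_inv_mul]

variable [AddCommGroup A]

lemma charSum_discreteWalk (p : PMF A) {χ : A → ℂ} (h : ∀ x, ‖χ x‖ ≤ 1)
    (hadd : ∀ x y, χ (x + y) = χ x * χ y) (h0 : χ 0 = 1) (m : ℕ) :
    charSum (discreteWalk p m) χ = charSum p χ ^ m := by
  induction m with
  | zero => simp [discreteWalk, charSum_pure, h0]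
  | succ m ih =>
    rw [discreteWalk, charSum_bind _ _ h, pow_succ, ← ih]
    simp_rw [charSum_map _ _ h, Function.comp_def, hadd, charSum_mul_right]
    conv_rhs => rw [charSum, ← tsum_mul_right]
    exact tsum_congr fun x => by ring

/-- A character turns `m` independent steps into an `m`-th power, and averaging powers over the
Poisson number of steps gives an exponential series. -/
lemma charSum_walkLaw {k : ℕ} [NeZero k] (o : CayleyKind) (z : Fin k → A) {t : ℝ} (ht : 0 ≤ t)
    {χ : A → ℂ} (h : ∀ x, ‖χ x‖ ≤ 1) (hadd : ∀ x y, χ (x + y) = χ x * χ y) (h0 : χ 0 = 1) :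
    charSum (walkLaw o z t) χ = Complex.exp (t * (charSum (stepLaw o z) χ - 1)) := by
  rw [walkLaw, charSum_bind _ _ h]
  simp_rw [charSum_discreteWalk _ h hadd h0]
  set w := charSum (stepLaw o z) χ
  have : ∀ m : ℕ, (((poissonMeasure t.toNNReal).toPMF m).toReal : ℂ) * w ^ m =
      Complex.exp (-t) * ((t * w) ^ m / (m.factorial : ℂ)) := by
    intro m
    rw [Measure.toPMF_apply, ← Measure.real, poissonMeasure_real_singleton,
      Real.coe_toNNReal _ ht]
    push_cast
    rw [mul_pow]
    ring
  simp_rw [this]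
  rw [tsum_mul_left, (NormedSpace.expSeries_div_hasSum_exp (t * w)).tsum_eq,
    ← Complex.exp_eq_exp_ℂ, ← Complex.exp_add]
  congr 1
  ring

end Transform

/-! ### Transforms of nonnegative functions -/

section LSum

variable {A B : Type*}

/-- The expectation of a nonnegative function under a law. -/
noncomputable def lsum (p : PMF A) (χ : A → ℝ≥0∞) : ℝ≥0∞ := ∑' x, p x * χ x

lemma lsum_bind (p : PMF A) (f : A → PMF B) (χ : B → ℝ≥0∞) :
    lsum (p.bind f) χ = ∑' a, p a * lsum (f a) χ := by
  simp only [lsum, PMF.bind_apply, ← ENNReal.tsum_mul_left, ← ENNReal.tsum_mul_right]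
  rw [ENNReal.tsum_comm]
  simp_rw [mul_assoc]

lemma lsum_pure (a : A) (χ : A → ℝ≥0∞) : lsum (PMF.pure a) χ = χ a := by
  rw [lsum, tsum_eq_single a]
  · simp
  · intro b hb
    simp [PMF.pure_apply, hb]

lemma lsum_map (p : PMF A) (g : A → B) (χ : B → ℝ≥0∞) :
    lsum (p.map g) χ = lsum p (χ ∘ g) := by
  rw [← PMF.bind_pure_comp, lsum_bind]
  simp only [Function.comp, lsum_pure]
  rfl

lemma lsum_uniform [Fintype A] [Nonempty A] (χ : A → ℝ≥0∞) :
    lsum (PMF.uniformOfFintype A) χ = (∑ x, χ x) / Fintype.card A := by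
  rw [lsum, tsum_fintype, ENNReal.div_eq_inv_mul, Finset.mul_sum]
  simp [PMF.uniformOfFintype_apply]

lemma lsum_eq_lintegral [Countable A] [MeasurableSpace A] [MeasurableSingletonClass A]
    (p : PMF A) (χ : A → ℝ≥0∞) : lsum p χ = ∫⁻ x, χ x ∂p.toMeasure := by
  rw [lintegral_countable', lsum]
  refine tsum_congr fun x => ?_
  rw [PMF.toMeasure_apply_singleton _ _ (measurableSet_singleton x), mul_comm]

variable [AddCommGroup A]

lemma lsum_discreteWalk (p : PMF A) {χ : A → ℝ≥0∞}
    (hadd : ∀ x y, χ (x + y) = χ x * χ y) (h0 : χ 0 = 1) (m : ℕ) :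
    lsum (discreteWalk p m) χ = lsum p χ ^ m := by
  induction m with
  | zero => simp [discreteWalk, lsum_pure, h0]
  | succ m ih =>
    have hmul : ∀ x, lsum p (fun y => χ x * χ y) = χ x * lsum p χ := fun x => by
      simp only [lsum, ← ENNReal.tsum_mul_left]
      exact tsum_congr fun x => by ring
    rw [discreteWalk, lsum_bind, pow_succ, ← ih]
    simp_rw [lsum_map, Function.comp_def, hadd, hmul]
    conv_rhs => rw [lsum, ← ENNReal.tsum_mul_right]
    exact tsum_congr fun x => by ring

/-- The Poisson computation again, for unbounded positive characters such as `x ↦ exp (l x)`. In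
`ℝ≥0∞` no summability is needed beforehand; integrability is read off from the finite value. -/
lemma lsum_walkLaw {k : ℕ} [NeZero k] (o : CayleyKind) (z : Fin k → A) {t : ℝ} (ht : 0 ≤ t)
    {χ : A → ℝ≥0∞} (hadd : ∀ x y, χ (x + y) = χ x * χ y) (h0 : χ 0 = 1) {c : ℝ} (hc : 0 ≤ c)
    (hstep : lsum (stepLaw o z) χ = ENNReal.ofReal c) :
    lsum (walkLaw o z t) χ = ENNReal.ofReal (Real.exp (t * (c - 1))) := by
  rw [walkLaw, lsum_bind]
  simp_rw [lsum_discreteWalk _ hadd h0, hstep]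
  have : ∀ m : ℕ, (poissonMeasure t.toNNReal).toPMF m * ENNReal.ofReal c ^ m =
      ENNReal.ofReal (Real.exp (-t) * ((t * c) ^ m / (m.factorial : ℝ))) := by
    intro m
    rw [Measure.toPMF_apply, poissonMeasure_singleton, Real.coe_toNNReal _ ht,
      ← ENNReal.ofReal_pow hc, ← ENNReal.ofReal_mul (by positivity)]
    congr 1
    rw [mul_pow]
    ring
  simp_rw [this]
  have hs := (NormedSpace.expSeries_div_hasSum_exp (t * c)).mul_left (Real.exp (-t))
  rw [← ENNReal.ofReal_tsum_of_nonneg (fun m => by positivity) hs.summable, hs.tsum_eq,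
    ← Real.exp_eq_exp_ℝ, ← Real.exp_add]
  congr 2
  ring

end LSum

/-! ### Naturality in the generators -/

section Naturality

variable {A B : Type*} [AddCommGroup A] [AddCommGroup B]

lemma stepLaw_map {k : ℕ} [NeZero k] (o : CayleyKind) (z : Fin k → A) (f : A →+ B) :
    (stepLaw o z).map f = stepLaw o (fun i => f (z i)) := by
  cases o
  · simp only [stepLaw, PMF.map_comp]
    rfl
  · simp only [stepLaw, PMF.map_comp]
    congr 1
    ext p
    by_cases hp : p.2 <;> simp [hp]

lemma discreteWalk_map (p : PMF A) (f : A →+ B) (m : ℕ) :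
    (discreteWalk p m).map f = discreteWalk (p.map f) m := by
  induction m with
  | zero => simp [discreteWalk, PMF.pure_map]
  | succ m ih =>
    simp only [discreteWalk, PMF.map_bind, ← ih, PMF.bind_map, PMF.map_comp]
    congr 1
    ext1 x
    simp only [Function.comp_def, map_add]

lemma walkLaw_map {k : ℕ} [NeZero k] (o : CayleyKind) (z : Fin k → A) (t : ℝ) (f : A →+ B) :
    (walkLaw o z t).map f = walkLaw o (fun i => f (z i)) t := by
  simp only [walkLaw, PMF.map_bind, discreteWalk_map, stepLaw_map]

/-- The homomorphism `w ↦ ∑ w i • z i`. -/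
def combHom {k : ℕ} (z : Fin k → A) : (Fin k → ℤ) →+ A where
  toFun w := ∑ i, w i • z i
  map_zero' := by simp
  map_add' w w' := by simp [add_smul, Finset.sum_add_distrib]

lemma combHom_apply {k : ℕ} (z : Fin k → A) (w : Fin k → ℤ) : combHom z w = ∑ i, w i • z i := rfl

/-- The standard basis of ℤ^k is the universal choice of generators: `combHom z` sends it to `z`,
and the walk is natural under homomorphisms. -/
lemma walkLaw_eq_map {k : ℕ} [NeZero k] (o : CayleyKind) (z : Fin k → A) (t : ℝ) :
    walkLaw o z t = (auxLaw o k t).map (combHom z) := by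
  rw [auxLaw, walkLaw_map]
  congr 1
  ext i
  rw [combHom_apply, Finset.sum_eq_single i]
  · simp
  · intro j _ hj
    simp [hj]
  · simp

end Naturality

/-! ### Product structure of the walk on the lattice -/

/-- The rate-1 walk on `ℤ`. -/
noncomputable def lineLaw (o : CayleyKind) (s : ℝ) : PMF ℤ := walkLaw o (fun _ : Fin 1 => (1 : ℤ)) s

/-- The law of the rate-1 walk on `ℤ` as a measure. -/
noncomputable def lineMeasure (o : CayleyKind) (s : ℝ) : Measure ℤ := (lineLaw o s).toMeasure

instance (o : CayleyKind) (s : ℝ) : IsProbabilityMeasure (lineMeasure o s) :=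
  inferInstanceAs (IsProbabilityMeasure (lineLaw o s).toMeasure)

/-- The characteristic function of one step on `ℤ`. -/
noncomputable def stepChar (o : CayleyKind) (θ : ℝ) : ℂ :=
  match o with
  | .directed => Complex.exp (θ * Complex.I)
  | .undirected => (Complex.exp (θ * Complex.I) + Complex.exp (-(θ * Complex.I))) / 2

/-- The character of `ℤ ^ k` of frequency `θ`. -/
noncomputable def latticeChar {k : ℕ} (θ : Fin k → ℝ) (w : Fin k → ℤ) : ℂ :=
  ∏ i, Complex.exp (θ i * w i * Complex.I)

lemma norm_exp_int_mul (θ : ℝ) (x : ℤ) : ‖Complex.exp (θ * x * Complex.I)‖ = 1 := by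
  have : ((θ : ℂ) * x * Complex.I) = ((θ * x : ℝ) : ℂ) * Complex.I := by push_cast; ring
  rw [this, Complex.norm_exp_ofReal_mul_I]

lemma norm_latticeChar {k : ℕ} (θ : Fin k → ℝ) (w : Fin k → ℤ) : ‖latticeChar θ w‖ = 1 := by
  simp [latticeChar, norm_prod, norm_exp_int_mul]

lemma latticeChar_add {k : ℕ} (θ : Fin k → ℝ) (w w' : Fin k → ℤ) :
    latticeChar θ (w + w') = latticeChar θ w * latticeChar θ w' := by
  simp only [latticeChar, ← Finset.prod_mul_distrib, ← Complex.exp_add]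
  refine Finset.prod_congr rfl fun i _ => ?_
  congr 1
  push_cast [Pi.add_apply]
  ring

lemma latticeChar_zero {k : ℕ} (θ : Fin k → ℝ) : latticeChar θ 0 = 1 := by
  simp [latticeChar]

lemma latticeChar_single {k : ℕ} (θ : Fin k → ℝ) (i : Fin k) :
    latticeChar θ (Pi.single i 1) = Complex.exp (θ i * Complex.I) := by
  rw [latticeChar, Finset.prod_eq_single i]
  · simp
  · intro j _ hj
    simp [hj]
  · simp

lemma latticeChar_neg_single {k : ℕ} (θ : Fin k → ℝ) (i : Fin k) :
    latticeChar θ (-Pi.single i 1) = Complex.exp (-(θ i * Complex.I)) := by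
  rw [latticeChar, Finset.prod_eq_single i]
  · simp
  · intro j _ hj
    simp [hj]
  · simp

lemma charSum_stepLaw {A : Type*} [AddCommGroup A] {k : ℕ} [NeZero k] (o : CayleyKind)
    (z : Fin k → A) (θ : Fin k → ℝ) {χ : A → ℂ} (h : ∀ x, ‖χ x‖ ≤ 1)
    (hz : ∀ i, χ (z i) = Complex.exp (θ i * Complex.I))
    (hz' : ∀ i, χ (-z i) = Complex.exp (-(θ i * Complex.I))) :
    charSum (stepLaw o z) χ = (∑ i, stepChar o (θ i)) / k := by
  cases o
  · rw [stepLaw, charSum_map _ _ h, charSum_uniform]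
    simp [stepChar, hz]
  · rw [stepLaw, charSum_map _ _ h, charSum_uniform, Fintype.sum_prod_type]
    simp only [Fintype.sum_bool, Function.comp, if_true, Bool.false_eq_true, if_false, hz, hz',
      stepChar, Fintype.card_prod, Fintype.card_fin, Fintype.card_bool, ← Finset.sum_div]
    push_cast
    rw [div_div, mul_comm (k : ℂ)]

lemma charSum_auxLaw (o : CayleyKind) (k : ℕ) [NeZero k] {t : ℝ} (ht : 0 ≤ t) (θ : Fin k → ℝ) :
    charSum (auxLaw o k t) (latticeChar θ) =
      ∏ i, Complex.exp (t / k * (stepChar o (θ i) - 1)) := by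
  have hk : (k : ℂ) ≠ 0 := Nat.cast_ne_zero.2 (NeZero.ne k)
  rw [auxLaw, charSum_walkLaw o _ ht (fun x => (norm_latticeChar θ x).le) (latticeChar_add θ)
    (latticeChar_zero θ), charSum_stepLaw o _ θ (fun x => (norm_latticeChar θ x).le)
    (latticeChar_single θ) (latticeChar_neg_single θ), ← Complex.exp_sum, ← Finset.mul_sum,
    Finset.sum_sub_distrib]
  congr 1
  simp
  field_simp

lemma charSum_lineLaw (o : CayleyKind) {s : ℝ} (hs : 0 ≤ s) (θ : ℝ) :
    charSum (lineLaw o s) (fun x => Complex.exp (θ * x * Complex.I)) =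
      Complex.exp (s * (stepChar o θ - 1)) := by
  have h : ∀ x : ℤ, ‖Complex.exp (θ * x * Complex.I)‖ ≤ 1 := fun x => (norm_exp_int_mul θ x).le
  rw [lineLaw, charSum_walkLaw o _ hs h, charSum_stepLaw o _ (fun _ => θ) h]
  · simp
  · simp
  · simp
  · intro x y
    rw [← Complex.exp_add]
    congr 1
    push_cast
    ring
  · simp

/-- Embedding ℤ^k in Euclidean space turns these sums into the characteristic function of the image
measure, which determines it; injectivity of the embedding brings the equality back. -/
lemma pmf_ext_of_charSum {k : ℕ} {p q : PMF (Fin k → ℤ)}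
    (h : ∀ θ : Fin k → ℝ, charSum p (latticeChar θ) = charSum q (latticeChar θ)) : p = q := by
  let e : (Fin k → ℤ) → EuclideanSpace ℝ (Fin k) := fun w => WithLp.toLp 2 fun i => (w i : ℝ)
  have he : Function.Injective e := by
    intro w w' hw
    ext i
    have := congrArg (fun v : EuclideanSpace ℝ (Fin k) => v i) hw
    simpa [e] using this
  have hem : Measurable e := measurable_of_countable e
  have key : ∀ (p : PMF (Fin k → ℤ)) (θ : EuclideanSpace ℝ (Fin k)),
      charFun (p.toMeasure.map e) θ = charSum p (latticeChar θ) := by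
    intro p θ
    rw [charFun_apply, integral_map hem.aemeasurable (by fun_prop), PMF.integral_eq_tsum]
    · refine tsum_congr fun w => ?_
      rw [Complex.real_smul, latticeChar, ← Complex.exp_sum, ← Finset.sum_mul]
      congr 3
      simp [e, PiLp.inner_apply, mul_comm]
    · refine Integrable.of_bound (C := 1) (by fun_prop) (ae_of_all _ fun w => ?_)
      rw [Complex.norm_exp_ofReal_mul_I]
  have hm : p.toMeasure.map e = q.toMeasure.map e := by
    have := Measure.isProbabilityMeasure_map (μ := p.toMeasure) hem.aemeasurable
    have := Measure.isProbabilityMeasure_map (μ := q.toMeasure) hem.aemeasurable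
    refine Measure.ext_of_charFun (funext fun θ => ?_)
    rw [key, key, h]
  ext w
  have hw := congrArg (fun μ => μ {e w}) hm
  rw [Measure.map_apply hem (measurableSet_singleton _),
    Measure.map_apply hem (measurableSet_singleton _), ← Set.image_singleton,
    Set.preimage_image_eq _ he, PMF.toMeasure_apply_singleton _ _ (measurableSet_singleton _),
    PMF.toMeasure_apply_singleton _ _ (measurableSet_singleton _)] at hw
  exact hw

lemma charSum_eq_integral {A : Type*} [Countable A] [MeasurableSpace A]
    [MeasurableSingletonClass A] (p : PMF A) {χ : A → ℂ} (h : ∀ x, ‖χ x‖ ≤ 1) :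
    charSum p χ = ∫ x, χ x ∂p.toMeasure := by
  rw [PMF.integral_eq_tsum _ _ (Integrable.of_bound (C := 1)
    (measurable_of_countable χ).aestronglyMeasurable (ae_of_all _ h))]
  rfl

/-- Poisson thinning: the characteristic function of `W(t)` factorises over the coordinates, and
each factor is that of the walk on ℤ at time `t / k`. All later uses of independence rest on this.
-/
lemma auxLaw_toMeasure (o : CayleyKind) (k : ℕ) [NeZero k] {t : ℝ} (ht : 0 ≤ t) :
    (auxLaw o k t).toMeasure = Measure.pi fun _ : Fin k => lineMeasure o (t / k) := by
  have hk : (0 : ℝ) < k := Nat.cast_pos.2 (NeZero.pos k)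
  have hpi : auxLaw o k t = (Measure.pi fun _ : Fin k => lineMeasure o (t / k)).toPMF := by
    refine pmf_ext_of_charSum fun θ => ?_
    rw [charSum_auxLaw o k ht, charSum_eq_integral _ fun x => (norm_latticeChar θ x).le,
      Measure.toPMF_toMeasure]
    simp only [latticeChar]
    rw [integral_fintype_prod_eq_prod (fun i (x : ℤ) => Complex.exp (θ i * x * Complex.I))]
    refine Finset.prod_congr rfl fun i _ => ?_
    have h1 := charSum_lineLaw o (div_nonneg ht hk.le) (θ i)
    rw [charSum_eq_integral _ fun x => (norm_exp_int_mul (θ i) x).le] at h1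
    rw [lineMeasure, h1]
    push_cast
    rfl
  rw [hpi, Measure.toPMF_toMeasure]

lemma coordLaw_eq (o : CayleyKind) (k : ℕ) [NeZero k] {t : ℝ} (ht : 0 ≤ t) :
    coordLaw o k t = lineLaw o (t / k) := by
  apply PMF.toMeasure_injective
  rw [coordLaw, ← PMF.toMeasure_map _ _ (measurable_of_countable _), auxLaw_toMeasure o k ht]
  exact (measurePreserving_eval (fun _ : Fin k => lineMeasure o (t / k)) 0).map_eq

/-- Semigroup property, checked on characteristic functions. It yields the monotonicity of the
distance in time and the convolutions behind the concavity of the entropy. -/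
lemma auxLaw_add (o : CayleyKind) (k : ℕ) [NeZero k] {t u : ℝ} (ht : 0 ≤ t) (hu : 0 ≤ u) :
    auxLaw o k (t + u) = (auxLaw o k t).bind fun w => (auxLaw o k u).map (w + ·) := by
  refine pmf_ext_of_charSum fun θ => ?_
  have h := fun x => (norm_latticeChar θ x).le
  rw [charSum_auxLaw o k (add_nonneg ht hu), charSum_bind _ _ h]
  simp_rw [charSum_map _ _ h, Function.comp_def, latticeChar_add, charSum_mul_right]
  have : ∀ w, (((auxLaw o k t) w).toReal : ℂ) *
      (latticeChar θ w * charSum (auxLaw o k u) fun x => latticeChar θ x) =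
      (((auxLaw o k t) w).toReal * latticeChar θ w) * charSum (auxLaw o k u) (latticeChar θ) :=
    fun w => by ring_nf
  simp_rw [this]
  rw [tsum_mul_right]
  change _ = charSum (auxLaw o k t) (latticeChar θ) * _
  rw [charSum_auxLaw o k ht, charSum_auxLaw o k hu, ← Finset.prod_mul_distrib]
  refine Finset.prod_congr rfl fun i _ => ?_
  rw [← Complex.exp_add]
  congr 1
  push_cast
  ring

lemma lineLaw_add (o : CayleyKind) {s u : ℝ} (hs : 0 ≤ s) (hu : 0 ≤ u) :
    lineLaw o (s + u) = (lineLaw o s).bind fun x => (lineLaw o u).map (x + ·) := by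
  have h1 : ∀ {r : ℝ}, 0 ≤ r → lineLaw o r = (auxLaw o 1 r).map fun w => w 0 := fun {r} hr => by
    have := coordLaw_eq o 1 hr
    simp only [Nat.cast_one, div_one] at this
    rw [← this, coordLaw]
  rw [h1 (add_nonneg hs hu), auxLaw_add o 1 hs hu, h1 hs, h1 hu, PMF.map_bind, PMF.bind_map]
  congr 1
  ext1 w
  simp only [Function.comp_def, PMF.map_comp, Pi.add_apply]

/-! ### Fourier analysis of the walk on `ℤ` -/

/-- The mass function of the walk on `ℤ`. -/
noncomputable def mass (o : CayleyKind) (s : ℝ) (x : ℤ) : ℝ := (lineLaw o s x).toReal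

/-- The mean of the walk on `ℤ`. -/
noncomputable def lineMean (o : CayleyKind) (s : ℝ) : ℝ :=
  match o with
  | .directed => s
  | .undirected => 0

/-- The characteristic function of the walk on `ℤ`. -/
noncomputable def lineChar (o : CayleyKind) (s θ : ℝ) : ℂ :=
  Complex.exp (s * (stepChar o θ - 1))

lemma mass_nonneg (o : CayleyKind) (s : ℝ) (x : ℤ) : 0 ≤ mass o s x := ENNReal.toReal_nonneg

lemma mass_le_one (o : CayleyKind) (s : ℝ) (x : ℤ) : mass o s x ≤ 1 :=
  ENNReal.toReal_mono ENNReal.one_ne_top ((lineLaw o s).coe_le_one x)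

lemma summable_mass (o : CayleyKind) (s : ℝ) : Summable (mass o s) := summable_toReal _

lemma lineMeasure_singleton (o : CayleyKind) (s : ℝ) (x : ℤ) :
    lineMeasure o s {x} = ENNReal.ofReal (mass o s x) := by
  rw [lineMeasure, PMF.toMeasure_apply_singleton _ _ (measurableSet_singleton x), mass,
    ENNReal.ofReal_toReal (PMF.apply_ne_top _ _)]

lemma lineMeasure_real_singleton (o : CayleyKind) (s : ℝ) (x : ℤ) :
    (lineMeasure o s).real {x} = mass o s x := by
  rw [Measure.real, lineMeasure_singleton, ENNReal.toReal_ofReal (mass_nonneg o s x)]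

lemma stepChar_re (o : CayleyKind) (θ : ℝ) : (stepChar o θ).re = Real.cos θ := by
  have h : ∀ y : ℝ, (Complex.exp (y * Complex.I)).re = Real.cos y := Complex.exp_ofReal_mul_I_re
  cases o
  · exact h θ
  · have h2 : -((θ : ℂ) * Complex.I) = ((-θ : ℝ) : ℂ) * Complex.I := by push_cast; ring
    simp only [stepChar]
    rw [h2, Complex.div_ofNat_re, Complex.add_re, h, h, Real.cos_neg]
    ring

lemma continuous_stepChar (o : CayleyKind) : Continuous (stepChar o) := by
  cases o <;> unfold stepChar <;> fun_prop

lemma stepChar_neg (o : CayleyKind) (θ : ℝ) :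
    stepChar o (-θ) = starRingEnd ℂ (stepChar o θ) := by
  cases o
  · simp only [stepChar]
    rw [← Complex.exp_conj]
    simp
  · simp only [stepChar]
    rw [map_div₀, map_add, ← Complex.exp_conj, ← Complex.exp_conj, Complex.conj_ofNat]
    simp

lemma continuous_lineChar (o : CayleyKind) (s : ℝ) : Continuous (lineChar o s) := by
  have := continuous_stepChar o
  unfold lineChar
  fun_prop

lemma norm_lineChar (o : CayleyKind) (s θ : ℝ) :
    ‖lineChar o s θ‖ = Real.exp (s * (Real.cos θ - 1)) := by
  rw [lineChar, Complex.norm_exp, Complex.re_ofReal_mul, Complex.sub_re, stepChar_re,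
    Complex.one_re]

lemma norm_lineChar_le (o : CayleyKind) {s θ : ℝ} (hs : 0 ≤ s) (hθ : |θ| ≤ Real.pi) :
    ‖lineChar o s θ‖ ≤ Real.exp (-(2 * s / Real.pi ^ 2) * θ ^ 2) := by
  rw [norm_lineChar]
  refine Real.exp_le_exp.2 ?_
  have h := Real.cos_le_one_sub_mul_cos_sq hθ
  calc s * (Real.cos θ - 1) ≤ s * (-(2 / Real.pi ^ 2 * θ ^ 2)) := by
        refine mul_le_mul_of_nonneg_left ?_ hs
        linarith
    _ = _ := by ring

lemma integral_lineMeasure_char (o : CayleyKind) {s : ℝ} (hs : 0 ≤ s) (θ : ℝ) :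
    ∫ x, Complex.exp (θ * (x : ℤ) * Complex.I) ∂(lineMeasure o s) = lineChar o s θ := by
  rw [lineMeasure, ← charSum_eq_integral _ fun x => (norm_exp_int_mul θ x).le,
    charSum_lineLaw o hs, lineChar]

lemma integral_exp_int (n : ℤ) :
    ∫ θ in -Real.pi..Real.pi, Complex.exp (θ * n * Complex.I) =
      if n = 0 then (2 * Real.pi : ℂ) else 0 := by
  split_ifs with h
  · subst h
    simp
    ring
  · have hc : (n : ℂ) * Complex.I ≠ 0 := mul_ne_zero (Int.cast_ne_zero.2 h) Complex.I_ne_zero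
    have : ∀ θ : ℝ, Complex.exp (θ * n * Complex.I) = Complex.exp ((n * Complex.I) * θ) :=
      fun θ => by congr 1; ring
    simp_rw [this]
    rw [integral_exp_mul_complex hc, div_eq_zero_iff]
    left
    rw [sub_eq_zero, Complex.exp_eq_exp_iff_exists_int]
    refine ⟨n, ?_⟩
    push_cast
    ring

/-- Fourier inversion: over a full period, integration against `exp (-i θ x)` kills every term of
the characteristic series but one. Continuity in time, the uniform bound on the mass and the local
limit theorem all start here. -/
lemma mass_eq_integral (o : CayleyKind) {s : ℝ} (hs : 0 ≤ s) (x : ℤ) :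
    (mass o s x : ℂ) = (2 * Real.pi : ℂ)⁻¹ *
      ∫ θ in -Real.pi..Real.pi, Complex.exp (-(θ * x * Complex.I)) * lineChar o s θ := by
  have hsum : HasSum (fun y : ℤ => ∫ θ in -Real.pi..Real.pi,
      Complex.exp (-(θ * x * Complex.I)) * (mass o s y * Complex.exp (θ * y * Complex.I)))
      (∫ θ in -Real.pi..Real.pi, Complex.exp (-(θ * x * Complex.I)) * lineChar o s θ) := by
    refine intervalIntegral.hasSum_integral_of_dominated_convergence
      (fun y _ => mass o s y) (fun y => ?_) (fun y => ?_) ?_ ?_ ?_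
    · exact Continuous.aestronglyMeasurable (by fun_prop)
    · refine ae_of_all _ fun θ _ => ?_
      have h1 : Complex.exp (-(θ * x * Complex.I)) = Complex.exp (θ * ((-x : ℤ) : ℂ) * Complex.I) := by
        congr 1
        push_cast
        ring
      rw [norm_mul, norm_mul, h1, norm_exp_int_mul, norm_exp_int_mul, Complex.norm_real,
        Real.norm_of_nonneg (mass_nonneg _ _ _)]
      simp
    · exact ae_of_all _ fun _ _ => summable_mass o s
    · exact (continuous_const).intervalIntegrable _ _
    · refine ae_of_all _ fun θ _ => HasSum.mul_left _ ?_
      have h1 := charSum_lineLaw o hs θ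
      rw [charSum] at h1
      rw [lineChar, ← h1]
      exact (summable_charSum _ fun x => (norm_exp_int_mul θ x).le).hasSum
  have hval : ∀ y : ℤ, ∫ θ in -Real.pi..Real.pi,
      Complex.exp (-(θ * x * Complex.I)) * (mass o s y * Complex.exp (θ * y * Complex.I)) =
      if y = x then (mass o s x : ℂ) * (2 * Real.pi) else 0 := by
    intro y
    have : ∀ θ : ℝ, Complex.exp (-(θ * x * Complex.I)) *
        (mass o s y * Complex.exp (θ * y * Complex.I)) =
        mass o s y * Complex.exp (θ * ((y - x : ℤ) : ℂ) * Complex.I) := by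
      intro θ
      rw [mul_left_comm, ← Complex.exp_add]
      congr 2
      push_cast
      ring
    simp_rw [this]
    rw [intervalIntegral.integral_const_mul, integral_exp_int]
    by_cases h : y = x
    · simp [h]
    · simp [h, sub_eq_zero]
  simp_rw [hval] at hsum
  rw [← hsum.tsum_eq, tsum_ite_eq, mul_comm (mass o s x : ℂ), inv_mul_cancel_left₀]
  simp [Real.pi_ne_zero]

lemma continuousOn_mass (o : CayleyKind) (x : ℤ) :
    ContinuousOn (fun s => mass o s x) (Set.Ici 0) := by
  have hc : Continuous fun s : ℝ => ((2 * Real.pi : ℂ)⁻¹ *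
      ∫ θ in -Real.pi..Real.pi, Complex.exp (-(θ * x * Complex.I)) * lineChar o s θ).re := by
    refine Complex.continuous_re.comp (continuous_const.mul ?_)
    refine intervalIntegral.continuous_parametric_intervalIntegral_of_continuous' ?_ _ _
    have := continuous_stepChar o
    unfold lineChar Function.uncurry
    fun_prop
  refine hc.continuousOn.congr fun s hs => ?_
  simp only
  rw [← mass_eq_integral o hs, Complex.ofReal_re]

/-- The bound `exp (-2 s θ² / π²)` on the characteristic function, integrated over the whole line,
gives the constant `√(π / 2) / 2 < 0.64`. Uniformity in `x` makes this a lower bound for the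
surprisal. -/
lemma mass_le (o : CayleyKind) {s : ℝ} (hs : 0 < s) (x : ℤ) :
    mass o s x ≤ 0.64 / √s := by
  have hpi := Real.pi_pos
  have hb : 0 < 2 * s / Real.pi ^ 2 := by positivity
  have h1 : ‖(mass o s x : ℂ)‖ ≤ (2 * Real.pi)⁻¹ *
      ∫ θ : ℝ, Real.exp (-(2 * s / Real.pi ^ 2) * θ ^ 2) := by
    rw [mass_eq_integral o hs.le, norm_mul]
    refine mul_le_mul (by simp [abs_of_pos hpi]) ?_ (norm_nonneg _) (by positivity)
    refine (intervalIntegral.norm_integral_le_of_norm_le (by linarith)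
      (g := fun θ => Real.exp (-(2 * s / Real.pi ^ 2) * θ ^ 2)) (ae_of_all _ fun θ hθ => ?_)
      (Continuous.intervalIntegrable (by fun_prop) _ _)).trans ?_
    · have h2 : Complex.exp (-(θ * x * Complex.I)) =
          Complex.exp (θ * ((-x : ℤ) : ℂ) * Complex.I) := by
        congr 1
        push_cast
        ring
      rw [norm_mul, h2, norm_exp_int_mul, one_mul]
      exact norm_lineChar_le o hs.le (abs_le.2 ⟨hθ.1.le, hθ.2⟩)
    · rw [intervalIntegral.integral_of_le (by linarith)]
      exact setIntegral_le_integral (integrable_exp_neg_mul_sq hb)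
        (ae_of_all _ fun _ => (Real.exp_pos _).le)
  rw [Complex.norm_real, Real.norm_of_nonneg (mass_nonneg o s x), integral_gaussian] at h1
  refine h1.trans ?_
  have h2 : Real.pi / (2 * s / Real.pi ^ 2) = Real.pi ^ 2 * (Real.pi / 2) / s := by
    field_simp
  rw [h2, Real.sqrt_div (by positivity), Real.sqrt_mul (by positivity), Real.sqrt_sq hpi.le,
    ← mul_div_assoc]
  refine div_le_div_of_nonneg_right ?_ (Real.sqrt_nonneg s)
  have h3 : √(Real.pi / 2) ≤ 1.28 := by
    rw [Real.sqrt_le_left (by norm_num)]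
    linarith [Real.pi_lt_d2]
  calc (2 * Real.pi)⁻¹ * (Real.pi * √(Real.pi / 2)) = √(Real.pi / 2) / 2 := by field_simp
    _ ≤ 0.64 := by linarith

/-! ### Residues of a difference of two independent walks -/

lemma sum_exp_residue {g : ℕ} (hg : 0 < g) (n : ℤ) :
    (∑ j ∈ Finset.range g, Complex.exp (((2 * Real.pi * j / g : ℝ) : ℂ) * n * Complex.I)) =
      if (g : ℤ) ∣ n then (g : ℂ) else 0 := by
  have hg0 : (g : ℂ) ≠ 0 := Nat.cast_ne_zero.2 hg.ne'
  set ζ := Complex.exp (2 * Real.pi * Complex.I * (n / g)) with hζ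
  have hterm : ∀ j : ℕ, Complex.exp (((2 * Real.pi * j / g : ℝ) : ℂ) * n * Complex.I) = ζ ^ j := by
    intro j
    rw [hζ, ← Complex.exp_nat_mul]
    congr 1
    push_cast
    ring
  simp_rw [hterm]
  have hiff : ζ = 1 ↔ (g : ℤ) ∣ n := by
    rw [hζ, Complex.exp_eq_one_iff]
    constructor
    · rintro ⟨m, hm⟩
      refine ⟨m, ?_⟩
      have h2 : (2 * Real.pi * Complex.I : ℂ) ≠ 0 := by simp [Real.pi_ne_zero]
      have h3 : (n : ℂ) / g = m := by
        apply mul_left_cancel₀ h2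
        rw [hm]
        ring
      rw [div_eq_iff hg0] at h3
      have : ((n : ℤ) : ℂ) = ((g * m : ℤ) : ℂ) := by rw [h3]; push_cast; ring
      exact_mod_cast this
    · rintro ⟨m, rfl⟩
      refine ⟨m, ?_⟩
      push_cast
      field_simp
  split_ifs with h
  · rw [hiff.2 h]
    simp
  · have hne : ζ ≠ 1 := fun h' => h (hiff.1 h')
    rw [geom_sum_eq hne, div_eq_zero_iff]
    left
    rw [sub_eq_zero, hζ, ← Complex.exp_nat_mul, Complex.exp_eq_one_iff]
    refine ⟨n, ?_⟩
    field_simp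

/-- Divisibility by `g` is detected by the `g`-th roots of unity. What remains is the characteristic
function of a difference of two independent copies, which is real and involves only the cosine, for
both kinds of walk. -/
lemma prob_dvd_sub_eq (o : CayleyKind) {s : ℝ} (hs : 0 ≤ s) {g : ℕ} (hg : 0 < g) :
    ((lineMeasure o s).prod (lineMeasure o s)).real {p : ℤ × ℤ | (g : ℤ) ∣ p.1 - p.2} =
      (∑ j ∈ Finset.range g, Real.exp (2 * s * (Real.cos (2 * Real.pi * j / g) - 1))) / g := by
  set M := lineMeasure o s
  have hg0 : (g : ℂ) ≠ 0 := Nat.cast_ne_zero.2 hg.ne'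
  have h1 : (((M.prod M).real {p : ℤ × ℤ | (g : ℤ) ∣ p.1 - p.2} : ℝ) : ℂ) =
      ∫ p : ℤ × ℤ, (∑ j ∈ Finset.range g,
        Complex.exp (((2 * Real.pi * j / g : ℝ) : ℂ) * p.1 * Complex.I) *
        Complex.exp (((-(2 * Real.pi * j / g) : ℝ) : ℂ) * p.2 * Complex.I)) / g ∂(M.prod M) := by
    rw [← integral_indicator_one (MeasurableSet.of_discrete), ← integral_complex_ofReal]
    refine integral_congr_ae (ae_of_all _ fun p => ?_)
    have h2 := sum_exp_residue hg (p.1 - p.2)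
    have h3 : ∀ j : ℕ, Complex.exp (((2 * Real.pi * j / g : ℝ) : ℂ) * p.1 * Complex.I) *
        Complex.exp (((-(2 * Real.pi * j / g) : ℝ) : ℂ) * p.2 * Complex.I) =
        Complex.exp (((2 * Real.pi * j / g : ℝ) : ℂ) * ((p.1 - p.2 : ℤ) : ℂ) * Complex.I) := by
      intro j
      rw [← Complex.exp_add]
      congr 1
      push_cast
      ring
    simp only [h3, h2, Set.indicator_apply, Set.mem_ofPred_eq]
    split_ifs <;> simp [hg0]
  have h4 : ∀ j : ℕ, ∫ p : ℤ × ℤ, Complex.exp (((2 * Real.pi * j / g : ℝ) : ℂ) * p.1 * Complex.I) *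
        Complex.exp (((-(2 * Real.pi * j / g) : ℝ) : ℂ) * p.2 * Complex.I) ∂(M.prod M) =
      ((Real.exp (2 * s * (Real.cos (2 * Real.pi * j / g) - 1)) : ℝ) : ℂ) := by
    intro j
    rw [integral_prod_mul (fun x : ℤ => Complex.exp (((2 * Real.pi * j / g : ℝ) : ℂ) * x * Complex.I))
      (fun x : ℤ => Complex.exp (((-(2 * Real.pi * j / g) : ℝ) : ℂ) * x * Complex.I)),
      integral_lineMeasure_char o hs, integral_lineMeasure_char o hs, lineChar, lineChar,
      ← Complex.exp_add, Complex.ofReal_exp, stepChar_neg]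
    congr 1
    rw [← mul_add, sub_add_sub_comm, Complex.add_conj, stepChar_re]
    push_cast
    ring
  apply Complex.ofReal_injective
  rw [h1, integral_div, integral_finsetSum]
  · simp_rw [h4]
    push_cast
    rfl
  · intro j _
    refine Integrable.of_bound (C := 1) (measurable_of_countable _).aestronglyMeasurable
      (ae_of_all _ fun p => ?_)
    rw [norm_mul, norm_exp_int_mul, norm_exp_int_mul, one_mul]

lemma sum_exp_neg_sq_le {a : ℝ} (ha : 0 < a) (n : ℕ) :
    ∑ j ∈ Finset.range n, Real.exp (-a * ((j + 1 : ℕ) : ℝ) ^ 2) ≤ √(Real.pi / a) / 2 := by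
  have hanti : AntitoneOn (fun x : ℝ => Real.exp (-a * x ^ 2)) (Set.Icc ((0 : ℕ) : ℝ) (n : ℕ)) := by
    intro x hx y _ hxy
    refine Real.exp_le_exp.2 ?_
    have hx0 : (0 : ℝ) ≤ x := by simpa using hx.1
    have : x ^ 2 ≤ y ^ 2 := pow_le_pow_left₀ hx0 hxy 2
    nlinarith
  have h := AntitoneOn.sum_le_integral_Ico (Nat.zero_le n) hanti
  rw [Nat.Ico_zero_eq_range] at h
  refine h.trans ?_
  rw [← integral_gaussian_Ioi a, intervalIntegral.integral_of_le (by simp)]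
  refine setIntegral_mono_set ((integrable_exp_neg_mul_sq ha).integrableOn)
    (ae_of_all _ fun _ => (Real.exp_pos _).le) (ae_of_all _ fun x hx => ?_)
  exact (by simpa using hx.1 : (0 : ℝ) < x)

/-- The frequency `j = 0` contributes `1 / g`. The others are folded by `cos (2π - x) = cos x` into
`[0, π]`, where each term is at most a Gaussian; after division by `g` the two half sums give `√π /
(4 √s) ≤ 0.45 / √s`. -/
lemma prob_dvd_sub_le (o : CayleyKind) {s : ℝ} (hs : 0 < s) {g : ℕ} (hg : 0 < g) :
    ((lineMeasure o s).prod (lineMeasure o s)).real {p : ℤ × ℤ | (g : ℤ) ∣ p.1 - p.2} ≤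
      1 / g + 0.45 / √s := by
  have hg0 : (0 : ℝ) < g := Nat.cast_pos.2 hg
  have hpi := Real.pi_pos
  rw [prob_dvd_sub_eq o hs.le hg]
  -- The exponent is `2 s` times the bound `8 j² / g²` for `1 - cos x`, which is `1 - cos x ≥ 2 x² /
  -- π²` at `x = 2 π j / g`.
  set a : ℝ := 16 * s / g ^ 2 with ha
  have hapos : 0 < a := by positivity
  obtain ⟨n, rfl⟩ : ∃ n, g = n + 1 := ⟨g - 1, by omega⟩
  have hterm : ∀ j ∈ Finset.range n,
      Real.exp (2 * s * (Real.cos (2 * Real.pi * ((j + 1 : ℕ) : ℝ) / ((n + 1 : ℕ) : ℝ)) - 1)) ≤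
      Real.exp (-a * ((j + 1 : ℕ) : ℝ) ^ 2) + Real.exp (-a * ((n - 1 - j + 1 : ℕ) : ℝ) ^ 2) := by
    intro j hj
    have hjn : j < n := Finset.mem_range.1 hj
    have hb : ∀ y : ℝ, 0 ≤ y → y ≤ ((n + 1 : ℕ) : ℝ) / 2 →
        Real.exp (2 * s * (Real.cos (2 * Real.pi * y / ((n + 1 : ℕ) : ℝ)) - 1)) ≤
        Real.exp (-a * y ^ 2) := by
      intro y hy0 hy
      refine Real.exp_le_exp.2 ?_
      have habs : |2 * Real.pi * y / ((n + 1 : ℕ) : ℝ)| ≤ Real.pi := by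
        rw [abs_of_nonneg (by positivity), div_le_iff₀ hg0]
        nlinarith
      have hc := Real.cos_le_one_sub_mul_cos_sq habs
      have h2 : 2 / Real.pi ^ 2 * (2 * Real.pi * y / ((n + 1 : ℕ) : ℝ)) ^ 2 =
          8 * y ^ 2 / ((n + 1 : ℕ) : ℝ) ^ 2 := by
        field_simp
        ring
      rw [h2] at hc
      calc 2 * s * (Real.cos (2 * Real.pi * y / ((n + 1 : ℕ) : ℝ)) - 1)
          ≤ 2 * s * (-(8 * y ^ 2 / ((n + 1 : ℕ) : ℝ) ^ 2)) := by
            refine mul_le_mul_of_nonneg_left ?_ (by positivity)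
            linarith
        _ = -a * y ^ 2 := by rw [ha]; ring
    by_cases hcase : ((j + 1 : ℕ) : ℝ) ≤ ((n + 1 : ℕ) : ℝ) / 2
    · refine (hb _ (by positivity) hcase).trans ?_
      linarith [Real.exp_pos (-a * ((n - 1 - j + 1 : ℕ) : ℝ) ^ 2)]
    · have hsub : ((n - 1 - j + 1 : ℕ) : ℝ) = ((n + 1 : ℕ) : ℝ) - ((j + 1 : ℕ) : ℝ) := by
        have : n - 1 - j + 1 = (n + 1) - (j + 1) := by omega
        rw [this, Nat.cast_sub (by omega)]
      have hcos : Real.cos (2 * Real.pi * ((j + 1 : ℕ) : ℝ) / ((n + 1 : ℕ) : ℝ)) =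
          Real.cos (2 * Real.pi * ((n - 1 - j + 1 : ℕ) : ℝ) / ((n + 1 : ℕ) : ℝ)) := by
        rw [hsub, ← Real.cos_two_pi_sub]
        congr 1
        field_simp
      rw [hcos]
      refine (hb _ (by positivity) ?_).trans ?_
      · rw [hsub]
        push Not at hcase
        linarith
      · linarith [Real.exp_pos (-a * ((j + 1 : ℕ) : ℝ) ^ 2)]
  rw [Finset.sum_range_succ']
  have hsum := Finset.sum_le_sum hterm
  rw [Finset.sum_add_distrib,
    Finset.sum_range_reflect (fun j => Real.exp (-a * ((j + 1 : ℕ) : ℝ) ^ 2)) n] at hsum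
  have hgauss := sum_exp_neg_sq_le hapos n
  have hsq : √(Real.pi / a) = ((n + 1 : ℕ) : ℝ) * (√Real.pi / (4 * √s)) := by
    have : Real.pi / a = (((n + 1 : ℕ) : ℝ) / 4) ^ 2 * (Real.pi / s) := by
      rw [ha]
      field_simp
      norm_num
    rw [this, Real.sqrt_mul (by positivity), Real.sqrt_sq (by positivity), Real.sqrt_div hpi.le]
    ring
  have hpi2 : √Real.pi ≤ 1.8 := by
    rw [Real.sqrt_le_left (by norm_num)]
    linarith [Real.pi_lt_d2]
  have hss : 0 < √s := Real.sqrt_pos.2 hs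
  have h3 : √Real.pi / (4 * √s) ≤ 0.45 / √s := by
    rw [div_le_div_iff₀ (by positivity) hss]
    nlinarith
  rw [div_le_iff₀ hg0]
  have h4 : (1 / ((n + 1 : ℕ) : ℝ) + 0.45 / √s) * ((n + 1 : ℕ) : ℝ) =
      1 + ((n + 1 : ℕ) : ℝ) * (0.45 / √s) := by
    field_simp
  have h5 := mul_le_mul_of_nonneg_left h3 hg0.le
  rw [h4]
  simp only [Nat.cast_zero, mul_zero, zero_div, Real.cos_zero, sub_self, Real.exp_zero]
  linarith

/-! ### Local limit theorem -/

lemma norm_exp_I_sub_taylor_two (y : ℝ) :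
    ‖Complex.exp (y * Complex.I) - 1 - y * Complex.I + (y : ℂ) ^ 2 / 2‖ ≤ 4 * |y| ^ 3 := by
  by_cases hy : |y| ≤ 1
  · have hn : ‖(y : ℂ) * Complex.I‖ ≤ 1 := by simpa using hy
    have h := Complex.exp_bound hn (n := 3) (by norm_num)
    have h2 : ∑ m ∈ Finset.range 3, ((y : ℂ) * Complex.I) ^ m / (m.factorial : ℂ) =
        1 + y * Complex.I - (y : ℂ) ^ 2 / 2 := by
      simp [Finset.sum_range_succ, mul_pow, Nat.factorial]
      ring
    rw [h2] at h
    have h3 : Complex.exp (y * Complex.I) - 1 - y * Complex.I + (y : ℂ) ^ 2 / 2 =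
        Complex.exp (y * Complex.I) - (1 + y * Complex.I - (y : ℂ) ^ 2 / 2) := by ring
    rw [h3]
    refine h.trans ?_
    simp only [norm_mul, Complex.norm_real, Complex.norm_I, mul_one, Real.norm_eq_abs]
    have : (0 : ℝ) ≤ |y| ^ 3 := by positivity
    norm_num [Nat.factorial]
    linarith
  · push Not at hy
    have h1 : ‖Complex.exp (y * Complex.I) - 1 - y * Complex.I + (y : ℂ) ^ 2 / 2‖ ≤
        1 + 1 + |y| + |y| ^ 2 / 2 := by
      refine (norm_add_le _ _).trans (add_le_add ((norm_sub_le _ _).trans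
        (add_le_add ((norm_sub_le _ _).trans (add_le_add ?_ ?_)) ?_)) ?_)
      · rw [Complex.norm_exp_ofReal_mul_I]
      · simp
      · simp
      · simp
    refine h1.trans ?_
    have h2 : 1 ≤ |y| ^ 2 := one_le_pow₀ hy.le
    have h3 : |y| ^ 2 ≤ |y| ^ 3 := pow_le_pow_right₀ hy.le (by norm_num)
    have h4 : |y| ≤ |y| ^ 3 := by simpa using pow_le_pow_right₀ hy.le (by norm_num : 1 ≤ 3)
    linarith

/-- The slope of the mean in time. -/
noncomputable def drift (o : CayleyKind) : ℝ :=
  match o with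
  | .directed => 1
  | .undirected => 0

lemma lineMean_eq (o : CayleyKind) (s : ℝ) : lineMean o s = s * drift o := by
  cases o <;> simp [lineMean, drift]

lemma norm_stepChar_sub_taylor (o : CayleyKind) (y : ℝ) :
    ‖stepChar o y - 1 - drift o * y * Complex.I + (y : ℂ) ^ 2 / 2‖ ≤ 4 * |y| ^ 3 := by
  cases o
  · simpa [stepChar, drift] using norm_exp_I_sub_taylor_two y
  · have h1 := norm_exp_I_sub_taylor_two y
    have h2 := norm_exp_I_sub_taylor_two (-y)
    rw [abs_neg] at h2
    have h3 : stepChar .undirected y - 1 - drift .undirected * y * Complex.I + (y : ℂ) ^ 2 / 2 =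
        ((Complex.exp (y * Complex.I) - 1 - y * Complex.I + (y : ℂ) ^ 2 / 2) +
        (Complex.exp ((-y : ℝ) * Complex.I) - 1 - (-y : ℝ) * Complex.I +
          ((-y : ℝ) : ℂ) ^ 2 / 2)) / 2 := by
      simp only [stepChar, drift]
      push_cast
      ring_nf
    rw [h3, norm_div, Complex.norm_ofNat]
    have := norm_add_le (Complex.exp (y * Complex.I) - 1 - y * Complex.I + (y : ℂ) ^ 2 / 2)
      (Complex.exp ((-y : ℝ) * Complex.I) - 1 - (-y : ℝ) * Complex.I + ((-y : ℝ) : ℂ) ^ 2 / 2)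
    linarith

/-- The characteristic function of the centred and rescaled walk, cut off outside one period. -/
noncomputable def scaledChar (o : CayleyKind) (s u : ℝ) : ℂ :=
  (Set.Ioc (-Real.pi * √s) (Real.pi * √s)).indicator
    (fun u => Complex.exp (-(lineMean o s * (u / √s) * Complex.I)) * lineChar o s (u / √s)) u

/-- The distance in `L¹` between the rescaled characteristic function and the Gaussian one. -/
noncomputable def charError (o : CayleyKind) (s : ℝ) : ℝ :=
  ∫ u : ℝ, ‖scaledChar o s u - Complex.exp (-(1 / 2 : ℂ) * (u : ℂ) ^ 2)‖

lemma measurable_scaledChar (o : CayleyKind) (s : ℝ) : Measurable (scaledChar o s) := by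
  refine Measurable.indicator ?_ measurableSet_Ioc
  have := continuous_lineChar o s
  exact Continuous.measurable (by fun_prop)

lemma norm_scaledChar_le (o : CayleyKind) {s : ℝ} (hs : 0 < s) (u : ℝ) :
    ‖scaledChar o s u‖ ≤ Real.exp (-(2 / Real.pi ^ 2) * u ^ 2) := by
  have hss : 0 < √s := Real.sqrt_pos.2 hs
  rw [scaledChar, Set.indicator_apply]
  split_ifs with h
  · have h1 : -(lineMean o s * (u / √s) * Complex.I : ℂ) =
        ((-(lineMean o s * (u / √s)) : ℝ) : ℂ) * Complex.I := by push_cast; ring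
    rw [norm_mul, h1, Complex.norm_exp_ofReal_mul_I, one_mul]
    refine (norm_lineChar_le o hs.le ?_).trans (le_of_eq ?_)
    · rw [abs_le, le_div_iff₀ hss, div_le_iff₀ hss]
      exact ⟨h.1.le, h.2⟩
    · congr 1
      rw [div_pow, Real.sq_sqrt hs.le]
      field_simp
  · simpa using (Real.exp_pos _).le

lemma norm_exp_half_sq (u : ℝ) :
    ‖Complex.exp (-(1 / 2 : ℂ) * (u : ℂ) ^ 2)‖ = Real.exp (-(1 / 2) * u ^ 2) := by
  rw [Complex.norm_exp]
  congr 1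
  have : (-(1 / 2 : ℂ) * (u : ℂ) ^ 2) = ((-(1 / 2) * u ^ 2 : ℝ) : ℂ) := by push_cast; ring
  rw [this, Complex.ofReal_re]

lemma integrable_scaledChar (o : CayleyKind) {s : ℝ} (hs : 0 < s) :
    Integrable (scaledChar o s) := by
  refine Integrable.mono' (integrable_exp_neg_mul_sq (b := 2 / Real.pi ^ 2)
    (by have := Real.pi_pos; positivity)) (measurable_scaledChar o s).aestronglyMeasurable
    (ae_of_all _ fun u => ?_)
  exact norm_scaledChar_le o hs u

lemma integrable_gauss : Integrable fun u : ℝ => Complex.exp (-(1 / 2 : ℂ) * (u : ℂ) ^ 2) := by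
  refine Integrable.mono' (integrable_exp_neg_mul_sq (b := 1 / 2) (by norm_num))
    (Continuous.aestronglyMeasurable (by fun_prop)) (ae_of_all _ fun u => ?_)
  exact (norm_exp_half_sq u).le

/-- Dominated convergence. Pointwise, the second order expansion of `stepChar` at `u / √s` leaves an
error of order `s (|u| / √s)³`, and the cut-off disappears for each fixed `u`. The majorant is the
Gaussian bound `norm_scaledChar_le`, available on the whole line thanks to the cut-off. -/
lemma tendsto_charError (o : CayleyKind) : Tendsto (charError o) atTop (𝓝 0) := by
  have hpi := Real.pi_pos
  have h0 : (0 : ℝ) = ∫ _ : ℝ, (0 : ℝ) := by simp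
  rw [h0]
  refine tendsto_integral_filter_of_dominated_convergence
    (fun u => Real.exp (-(2 / Real.pi ^ 2) * u ^ 2) + Real.exp (-(1 / 2) * u ^ 2)) ?_ ?_ ?_ ?_
  · refine Eventually.of_forall fun s => ?_
    exact (((measurable_scaledChar o s).sub (by fun_prop)).norm).aestronglyMeasurable
  · filter_upwards [eventually_gt_atTop 0] with s hs
    refine ae_of_all _ fun u => ?_
    rw [norm_norm, ← norm_exp_half_sq u]
    exact (norm_sub_le _ _).trans (add_le_add (norm_scaledChar_le o hs u) le_rfl)
  · exact (integrable_exp_neg_mul_sq (by positivity)).add (integrable_exp_neg_mul_sq (by norm_num))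
  · refine ae_of_all _ fun u => ?_
    have hlim : Tendsto (fun s : ℝ => ‖(s * (stepChar o (u / √s) - 1 -
        drift o * ((u / √s : ℝ) : ℂ) * Complex.I)) - (-(1 / 2 : ℂ) * (u : ℂ) ^ 2)‖) atTop (𝓝 0) := by
      have hb : Tendsto (fun s : ℝ => 4 * |u| ^ 3 / √s) atTop (𝓝 0) :=
        tendsto_const_nhds.div_atTop Real.tendsto_sqrt_atTop
      refine tendsto_of_tendsto_of_tendsto_of_le_of_le' tendsto_const_nhds hb
        (Eventually.of_forall fun _ => norm_nonneg _) ?_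
      filter_upwards [eventually_gt_atTop 0] with s hs
      have hss : 0 < √s := Real.sqrt_pos.2 hs
      have h := norm_stepChar_sub_taylor o (u / √s)
      have hsq : (s : ℂ) * ((u / √s : ℝ) : ℂ) ^ 2 = (u : ℂ) ^ 2 := by
        rw [← Complex.ofReal_pow, ← Complex.ofReal_mul, div_pow, Real.sq_sqrt hs.le,
          mul_div_cancel₀ _ hs.ne', Complex.ofReal_pow]
      have h2 : (s * (stepChar o (u / √s) - 1 - drift o * ((u / √s : ℝ) : ℂ) * Complex.I)) -
          (-(1 / 2 : ℂ) * (u : ℂ) ^ 2) = s * (stepChar o (u / √s) - 1 -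
          drift o * ((u / √s : ℝ) : ℂ) * Complex.I + ((u / √s : ℝ) : ℂ) ^ 2 / 2) := by
        rw [← hsq]
        ring
      rw [h2, norm_mul, Complex.norm_real, Real.norm_of_nonneg hs.le]
      refine (mul_le_mul_of_nonneg_left h hs.le).trans (le_of_eq ?_)
      rw [abs_div, abs_of_pos hss, div_pow]
      have : √s ^ 3 = s * √s := by rw [pow_succ, Real.sq_sqrt hs.le]
      rw [this]
      field_simp
    have hlim2 : Tendsto (fun s : ℝ => Complex.exp (s * (stepChar o (u / √s) - 1 -
        drift o * ((u / √s : ℝ) : ℂ) * Complex.I))) atTop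
        (𝓝 (Complex.exp (-(1 / 2 : ℂ) * (u : ℂ) ^ 2))) :=
      (Complex.continuous_exp.tendsto _).comp (tendsto_iff_norm_sub_tendsto_zero.2 hlim)
    have hlim3 := tendsto_iff_norm_sub_tendsto_zero.1 hlim2
    refine hlim3.congr' ?_
    have hev : ∀ᶠ s : ℝ in atTop, |u| < Real.pi * √s :=
      (Real.tendsto_sqrt_atTop.const_mul_atTop hpi).eventually_gt_atTop _
    filter_upwards [hev] with s hs
    rw [scaledChar, Set.indicator_of_mem, lineChar, lineMean_eq, ← Complex.exp_add]
    · congr 3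
      push_cast
      ring
    · rw [abs_lt] at hs
      exact ⟨by linarith [hs.1], hs.2.le⟩

/-- The standard Gaussian density. -/
noncomputable def gaussDensity (y : ℝ) : ℝ := (√(2 * Real.pi))⁻¹ * Real.exp (-(y ^ 2) / 2)

lemma gaussDensity_eq_integral (y : ℝ) :
    (gaussDensity y : ℂ) = (2 * Real.pi : ℂ)⁻¹ *
      ∫ u : ℝ, Complex.exp (Complex.I * (-y) * u) * Complex.exp (-(1 / 2 : ℂ) * (u : ℂ) ^ 2) := by
  rw [fourierIntegral_gaussian (by norm_num : 0 < (1 / 2 : ℂ).re)]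
  have hpi := Real.pi_pos
  have h1 : (Real.pi / (1 / 2) : ℂ) ^ (1 / 2 : ℂ) = ((√(2 * Real.pi) : ℝ) : ℂ) := by
    rw [Real.sqrt_eq_rpow, Complex.ofReal_cpow (by positivity)]
    push_cast
    congr 1
    ring
  have h2 : Complex.exp (-(-(y : ℂ)) ^ 2 / (4 * (1 / 2))) = ((Real.exp (-(y ^ 2) / 2) : ℝ) : ℂ) := by
    push_cast
    congr 1
    ring
  rw [h1, h2, gaussDensity, ← mul_assoc]
  push_cast
  congr 1
  have h3 : ((√(2 * Real.pi) : ℝ) : ℂ) ≠ 0 := by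
    rw [Complex.ofReal_ne_zero]
    positivity
  have h4 : ((√(2 * Real.pi) : ℝ) : ℂ) * ((√(2 * Real.pi) : ℝ) : ℂ) = 2 * Real.pi := by
    rw [← Complex.ofReal_mul, Real.mul_self_sqrt (by positivity)]
    push_cast
    rfl
  rw [← h4]
  field_simp

/-- Fourier inversion after the substitution `θ = u / √s`; the phase of the mean is moved from the
exponential into `scaledChar`. -/
lemma sqrt_mul_mass_eq_integral (o : CayleyKind) {s : ℝ} (hs : 0 < s) (x : ℤ) :
    ((√s * mass o s x : ℝ) : ℂ) = (2 * Real.pi : ℂ)⁻¹ *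
      ∫ u : ℝ, Complex.exp (Complex.I * (-(((x - lineMean o s) / √s : ℝ) : ℂ)) * u) *
        scaledChar o s u := by
  have hss : 0 < √s := Real.sqrt_pos.2 hs
  have hpi := Real.pi_pos
  have hss' : (√s : ℂ) ≠ 0 := by simpa using hss.ne'
  push_cast
  rw [mass_eq_integral o hs.le, mul_left_comm]
  congr 1
  have h1 := intervalIntegral.integral_comp_div (a := -Real.pi * √s) (b := Real.pi * √s)
    (fun θ : ℝ => Complex.exp (-(θ * x * Complex.I)) * lineChar o s θ) hss.ne'
  rw [mul_div_cancel_right₀ _ hss.ne', mul_div_cancel_right₀ _ hss.ne', Complex.real_smul] at h1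
  rw [← h1, intervalIntegral.integral_of_le (by nlinarith), ← integral_indicator measurableSet_Ioc]
  congr 1
  ext u
  rw [scaledChar, Set.indicator_apply, Set.indicator_apply]
  split_ifs
  · rw [← mul_assoc, ← Complex.exp_add]
    congr 2
    push_cast
    field_simp
    ring
  · simp

/-- **Local limit theorem**, uniformly in the position. -/
lemma abs_sqrt_mul_mass_sub_le (o : CayleyKind) {s : ℝ} (hs : 0 < s) (x : ℤ) :
    |√s * mass o s x - gaussDensity ((x - lineMean o s) / √s)| ≤ charError o s := by
  have hpi := Real.pi_gt_three
  set y : ℝ := (x - lineMean o s) / √s with hy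
  have hnorm : ∀ u : ℝ, ‖Complex.exp (Complex.I * (-(y : ℂ)) * u)‖ = 1 := by
    intro u
    have : Complex.I * (-(y : ℂ)) * u = ((-(y * u) : ℝ) : ℂ) * Complex.I := by push_cast; ring
    rw [this, Complex.norm_exp_ofReal_mul_I]
  have hint : ∀ {f : ℝ → ℂ}, Integrable f →
      Integrable fun u : ℝ => Complex.exp (Complex.I * (-(y : ℂ)) * u) * f u := by
    intro f hf
    refine hf.bdd_mul (c := 1) (Continuous.aestronglyMeasurable (by fun_prop))
      (ae_of_all _ fun u => (hnorm u).le)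
  rw [← Real.norm_eq_abs, ← Complex.norm_real, Complex.ofReal_sub, sqrt_mul_mass_eq_integral o hs,
    gaussDensity_eq_integral, ← mul_sub, ← hy,
    ← integral_sub (hint (integrable_scaledChar o hs)) (hint integrable_gauss), norm_mul]
  have h1 : ‖(2 * Real.pi : ℂ)⁻¹‖ ≤ 1 := by
    simp only [norm_inv, norm_mul, Complex.norm_ofNat, Complex.norm_real, Real.norm_eq_abs]
    rw [abs_of_pos (by linarith)]
    exact inv_le_one_of_one_le₀ (by linarith)
  refine (mul_le_of_le_one_left (norm_nonneg _) h1).trans ((norm_integral_le_integral_norm _).trans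
    (le_of_eq ?_))
  rw [charError]
  congr 1
  ext u
  rw [← mul_sub, norm_mul, hnorm, one_mul]

/-! ### Moments of the walk on `ℤ` -/

/-- The moment generating function of one step on `ℤ`. -/
noncomputable def stepMgf (o : CayleyKind) (l : ℝ) : ℝ :=
  match o with
  | .directed => Real.exp l
  | .undirected => (Real.exp l + Real.exp (-l)) / 2

lemma stepMgf_nonneg (o : CayleyKind) (l : ℝ) : 0 ≤ stepMgf o l := by
  cases o <;> simp only [stepMgf] <;> positivity

lemma stepMgf_le (o : CayleyKind) (l : ℝ) : stepMgf o l ≤ Real.exp |l| := by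
  have h1 : Real.exp l ≤ Real.exp |l| := Real.exp_le_exp.2 (le_abs_self l)
  have h2 : Real.exp (-l) ≤ Real.exp |l| := Real.exp_le_exp.2 (neg_le_abs l)
  cases o
  · exact h1
  · simp only [stepMgf]
    linarith

lemma lsum_stepLaw (o : CayleyKind) (l : ℝ) :
    lsum (stepLaw o fun _ : Fin 1 => (1 : ℤ)) (fun x => ENNReal.ofReal (Real.exp (l * x))) =
      ENNReal.ofReal (stepMgf o l) := by
  cases o
  · rw [stepLaw, lsum_map, lsum_uniform]
    simp [stepMgf]
  · rw [stepLaw, lsum_map, lsum_uniform, Fintype.sum_prod_type]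
    simp only [Fintype.sum_bool, Function.comp, if_true, Bool.false_eq_true, if_false, stepMgf,
      Fintype.card_prod, Fintype.card_fin, Fintype.card_bool, Finset.univ_unique,
      Finset.sum_const, Finset.card_singleton, one_smul]
    rw [← ENNReal.ofReal_add (Real.exp_pos _).le (Real.exp_pos _).le,
      ENNReal.ofReal_div_of_pos two_pos]
    simp

lemma lintegral_exp_mul (o : CayleyKind) {s : ℝ} (hs : 0 ≤ s) (l : ℝ) :
    ∫⁻ x : ℤ, ENNReal.ofReal (Real.exp (l * x)) ∂(lineMeasure o s) =
      ENNReal.ofReal (Real.exp (s * (stepMgf o l - 1))) := by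
  rw [lineMeasure, ← lsum_eq_lintegral, lineLaw]
  refine lsum_walkLaw o _ hs (fun x y => ?_) (by simp) (stepMgf_nonneg o l) (lsum_stepLaw o l)
  rw [← ENNReal.ofReal_mul (Real.exp_pos _).le, ← Real.exp_add]
  congr 2
  push_cast
  ring

lemma integrable_exp_mul (o : CayleyKind) {s : ℝ} (hs : 0 ≤ s) (l : ℝ) :
    Integrable (fun x : ℤ => Real.exp (l * x)) (lineMeasure o s) := by
  refine ⟨(measurable_of_countable _).aestronglyMeasurable, ?_⟩
  rw [hasFiniteIntegral_iff_ofReal (ae_of_all _ fun x => (Real.exp_pos _).le),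
    lintegral_exp_mul o hs]
  exact ENNReal.ofReal_lt_top

lemma integral_exp_mul (o : CayleyKind) {s : ℝ} (hs : 0 ≤ s) (l : ℝ) :
    ∫ x : ℤ, Real.exp (l * x) ∂(lineMeasure o s) = Real.exp (s * (stepMgf o l - 1)) := by
  rw [integral_eq_lintegral_of_nonneg_ae (ae_of_all _ fun x => (Real.exp_pos _).le)
    (measurable_of_countable _).aestronglyMeasurable, lintegral_exp_mul o hs,
    ENNReal.toReal_ofReal (Real.exp_pos _).le]

/-- The centred cumulant generating function of one step on `ℤ`. -/
noncomputable def stepCgf (o : CayleyKind) (l : ℝ) : ℝ := stepMgf o l - 1 - drift o * l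

lemma mgf_centered (o : CayleyKind) {s : ℝ} (hs : 0 ≤ s) (l : ℝ) :
    mgf (fun x : ℤ => (x : ℝ) - lineMean o s) (lineMeasure o s) l =
      Real.exp (s * stepCgf o l) := by
  have : ∀ x : ℤ, Real.exp (l * ((x : ℝ) - lineMean o s)) =
      Real.exp (-(l * lineMean o s)) * Real.exp (l * x) := by
    intro x
    rw [← Real.exp_add]
    congr 1
    ring
  simp only [mgf, this]
  rw [integral_const_mul, integral_exp_mul o hs, ← Real.exp_add, lineMean_eq, stepCgf]
  congr 1
  ring

lemma integrable_exp_mul_centered (o : CayleyKind) {s : ℝ} (hs : 0 ≤ s) (l : ℝ) :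
    Integrable (fun x : ℤ => Real.exp (l * ((x : ℝ) - lineMean o s))) (lineMeasure o s) := by
  have : ∀ x : ℤ, Real.exp (l * ((x : ℝ) - lineMean o s)) =
      Real.exp (-(l * lineMean o s)) * Real.exp (l * x) := by
    intro x
    rw [← Real.exp_add]
    congr 1
    ring
  simp only [this]
  exact (integrable_exp_mul o hs l).const_mul _

lemma stepCgf_le (o : CayleyKind) {l : ℝ} (hl : |l| ≤ 1) : stepCgf o l ≤ l ^ 2 := by
  have h1 := (abs_le.1 (Real.abs_exp_sub_one_sub_id_le hl)).2
  have h2 := (abs_le.1 (Real.abs_exp_sub_one_sub_id_le (x := -l) (by rwa [abs_neg]))).2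
  cases o
  · simp only [stepCgf, stepMgf, drift]
    linarith
  · simp only [stepCgf, stepMgf, drift]
    nlinarith

/-- The standardized position. -/
noncomputable def stdPos (o : CayleyKind) (s : ℝ) (x : ℤ) : ℝ := (x - lineMean o s) / √s

lemma integrable_exp_abs_stdPos (o : CayleyKind) {s : ℝ} (hs : 0 ≤ s) :
    Integrable (fun x : ℤ => Real.exp |stdPos o s x|) (lineMeasure o s) := by
  refine Integrable.mono' ((integrable_exp_mul_centered o hs (1 / √s)).add
    (integrable_exp_mul_centered o hs (-(1 / √s))))
    (measurable_of_countable _).aestronglyMeasurable (ae_of_all _ fun x => ?_)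
  rw [Real.norm_of_nonneg (Real.exp_pos _).le, Pi.add_apply]
  have h1 : (1 / √s) * ((x : ℝ) - lineMean o s) = stdPos o s x := by
    rw [stdPos]
    ring
  rw [neg_mul, h1]
  exact Real.exp_abs_le _

/-- By `exp |y| ≤ exp y + exp (-y)` it suffices to take `l = ± 1 / √s`, where the centred generating
function is at most `exp (s l²) = e`; and `2 e < 6`. -/
lemma integral_exp_abs_stdPos_le (o : CayleyKind) {s : ℝ} (hs : 1 ≤ s) :
    ∫ x : ℤ, Real.exp |stdPos o s x| ∂(lineMeasure o s) ≤ 6 := by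
  have hs0 : 0 < s := by linarith
  have hss : 0 < √s := Real.sqrt_pos.2 hs0
  have hb : ∀ l : ℝ, |l| ≤ 1 → l ^ 2 = 1 / s →
      ∫ x : ℤ, Real.exp (l * ((x : ℝ) - lineMean o s)) ∂(lineMeasure o s) ≤ Real.exp 1 := by
    intro l hl hl2
    have := mgf_centered o hs0.le l
    simp only [mgf] at this
    rw [this]
    refine Real.exp_le_exp.2 ?_
    calc s * stepCgf o l ≤ s * l ^ 2 := mul_le_mul_of_nonneg_left (stepCgf_le o hl) hs0.le
      _ = 1 := by rw [hl2]; field_simp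
  have hsq : (1 / √s) ^ 2 = 1 / s := by rw [div_pow, Real.sq_sqrt hs0.le, one_pow]
  have hle : |1 / √s| ≤ 1 := by
    rw [abs_of_pos (by positivity), div_le_one hss]
    exact Real.one_le_sqrt.2 hs
  have h1 := hb (1 / √s) hle hsq
  have h2 := hb (-(1 / √s)) (by rwa [abs_neg]) (by rw [neg_sq, hsq])
  have h3 : ∫ x : ℤ, Real.exp |stdPos o s x| ∂(lineMeasure o s) ≤
      ∫ x : ℤ, (Real.exp ((1 / √s) * ((x : ℝ) - lineMean o s)) +
        Real.exp (-(1 / √s) * ((x : ℝ) - lineMean o s))) ∂(lineMeasure o s) := by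
    refine integral_mono (integrable_exp_abs_stdPos o hs0.le)
      ((integrable_exp_mul_centered o hs0.le _).add (integrable_exp_mul_centered o hs0.le _))
      fun x => ?_
    have h1 : (1 / √s) * ((x : ℝ) - lineMean o s) = stdPos o s x := by
      rw [stdPos]
      ring
    simp only [neg_mul, h1]
    exact Real.exp_abs_le _
  rw [integral_add (integrable_exp_mul_centered o hs0.le _)
    (integrable_exp_mul_centered o hs0.le _)] at h3
  have := Real.exp_one_lt_d9
  linarith

lemma integrable_abs_stdPos_pow (o : CayleyKind) {s : ℝ} (hs : 0 ≤ s) (n : ℕ) :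
    Integrable (fun x : ℤ => |stdPos o s x| ^ n) (lineMeasure o s) := by
  refine Integrable.mono' ((integrable_exp_abs_stdPos o hs).const_mul (n.factorial : ℝ))
    (measurable_of_countable _).aestronglyMeasurable (ae_of_all _ fun x => ?_)
  rw [Real.norm_of_nonneg (by positivity)]
  have := Real.pow_div_factorial_le_exp _ (abs_nonneg (stdPos o s x)) n
  rwa [div_le_iff₀' (by positivity)] at this

lemma integral_abs_stdPos_pow_le (o : CayleyKind) {s : ℝ} (hs : 1 ≤ s) (n : ℕ) :
    ∫ x : ℤ, |stdPos o s x| ^ n ∂(lineMeasure o s) ≤ n.factorial * 6 := by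
  have hs0 : 0 ≤ s := by linarith
  refine (integral_mono (integrable_abs_stdPos_pow o hs0 n)
    ((integrable_exp_abs_stdPos o hs0).const_mul (n.factorial : ℝ)) fun x => ?_).trans ?_
  · have := Real.pow_div_factorial_le_exp _ (abs_nonneg (stdPos o s x)) n
    rwa [div_le_iff₀' (by positivity)] at this
  · rw [integral_const_mul]
    exact mul_le_mul_of_nonneg_left (integral_exp_abs_stdPos_le o hs) (by positivity)

lemma prob_abs_stdPos_ge_le (o : CayleyKind) {s : ℝ} (hs : 1 ≤ s) (r : ℝ) :
    (lineMeasure o s).real {x | r ≤ |stdPos o s x|} ≤ 6 * Real.exp (-r) := by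
  have h := mul_meas_ge_le_integral_of_nonneg (μ := lineMeasure o s)
    (ae_of_all _ fun x : ℤ => (Real.exp_pos |stdPos o s x|).le)
    (integrable_exp_abs_stdPos o (by linarith)) (Real.exp r)
  simp only [Real.exp_le_exp] at h
  rw [Real.exp_neg, ← div_eq_mul_inv, le_div_iff₀ (Real.exp_pos r), mul_comm]
  exact h.trans (integral_exp_abs_stdPos_le o hs)

/-- Exponential Markov bound at `l = ± 2`. Being uniform over `s ≤ T` and exponentially small in
`x`, it supplies the summable majorant for continuity in time. -/
lemma mass_le_exp (o : CayleyKind) {s T : ℝ} (hs : 0 ≤ s) (hsT : s ≤ T) (x : ℤ) :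
    mass o s x ≤ Real.exp (T * Real.exp 2) * Real.exp (-(2 * |(x : ℝ)|)) := by
  have key : ∀ l : ℝ, |l| = 2 → mass o s x * Real.exp (l * x) ≤ Real.exp (T * Real.exp 2) := by
    intro l hl
    have h1 : mass o s x * Real.exp (l * x) ≤
        ∫ y : ℤ, Real.exp (l * y) ∂(lineMeasure o s) := by
      have := setIntegral_le_integral (s := {x}) (integrable_exp_mul o hs l)
        (ae_of_all _ fun y : ℤ => (Real.exp_pos (l * y)).le)
      rwa [integral_singleton, lineMeasure_real_singleton, smul_eq_mul] at this
    refine h1.trans ?_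
    rw [integral_exp_mul o hs]
    refine Real.exp_le_exp.2 ?_
    have h2 := stepMgf_le o l
    rw [hl] at h2
    have h3 : s * (stepMgf o l - 1) ≤ s * Real.exp 2 :=
      mul_le_mul_of_nonneg_left (by linarith) hs
    exact h3.trans (mul_le_mul_of_nonneg_right hsT (Real.exp_pos 2).le)
  have h1 : mass o s x * Real.exp (2 * |(x : ℝ)|) ≤ Real.exp (T * Real.exp 2) := by
    rcases abs_cases (x : ℝ) with ⟨h, _⟩ | ⟨h, _⟩
    · rw [h]
      exact key 2 (by norm_num)
    · rw [h]
      have := key (-2) (by norm_num)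
      rwa [neg_mul, ← mul_neg] at this
  rwa [Real.exp_neg, ← div_eq_mul_inv, le_div_iff₀ (Real.exp_pos _)]

/-! ### Second and fourth moments -/

/-- Kept general in `h` so that one computation serves both kinds of walk. Where `h = h1 = 0` the
derivatives reduce to `s h2` and `s h4 + 3 s² h2²`, the centred second and fourth moments. -/
lemma iteratedDeriv_exp_mul {h h1 h2 h3 h4 : ℝ → ℝ} (s : ℝ)
    (d0 : ∀ l, HasDerivAt h (h1 l) l) (d1 : ∀ l, HasDerivAt h1 (h2 l) l)
    (d2 : ∀ l, HasDerivAt h2 (h3 l) l) (d3 : ∀ l, HasDerivAt h3 (h4 l) l) :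
    iteratedDeriv 2 (fun l => Real.exp (s * h l)) =
      (fun l => (s * h2 l + s ^ 2 * h1 l ^ 2) * Real.exp (s * h l)) ∧
    iteratedDeriv 4 (fun l => Real.exp (s * h l)) =
      (fun l => (s * h4 l + 3 * s ^ 2 * h2 l ^ 2 + 4 * s ^ 2 * h1 l * h3 l +
        6 * s ^ 3 * h1 l ^ 2 * h2 l + s ^ 4 * h1 l ^ 4) * Real.exp (s * h l)) := by
  have e0 : ∀ l, HasDerivAt (fun l => Real.exp (s * h l)) (Real.exp (s * h l) * (s * h1 l)) l :=
    fun l => ((d0 l).const_mul s).exp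
  have i1 : iteratedDeriv 1 (fun l => Real.exp (s * h l)) =
      fun l => (s * h1 l) * Real.exp (s * h l) := by
    rw [iteratedDeriv_one]
    ext l
    rw [(e0 l).deriv, mul_comm]
  have i2 : iteratedDeriv 2 (fun l => Real.exp (s * h l)) =
      fun l => (s * h2 l + s ^ 2 * h1 l ^ 2) * Real.exp (s * h l) := by
    rw [iteratedDeriv_succ, i1]
    ext l
    rw [(((d1 l).const_mul s).fun_mul (e0 l)).deriv]
    ring
  have i3 : iteratedDeriv 3 (fun l => Real.exp (s * h l)) =
      fun l => (s * h3 l + 3 * s ^ 2 * (h1 l * h2 l) + s ^ 3 * h1 l ^ 3) * Real.exp (s * h l) := by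
    rw [iteratedDeriv_succ, i2]
    ext l
    have := ((((d2 l).const_mul s).add (((d1 l).pow 2).const_mul (s ^ 2))).mul (e0 l)).deriv
    rw [show (fun l => (s * h2 l + s ^ 2 * h1 l ^ 2) * Real.exp (s * h l)) =
      ((fun l => s * h2 l) + fun l => s ^ 2 * (h1 ^ 2) l) * fun l => Real.exp (s * h l) from rfl,
      this]
    simp only [Pi.add_apply, Pi.pow_apply]
    push_cast
    ring
  refine ⟨i2, ?_⟩
  rw [iteratedDeriv_succ, i3]
  ext l
  have := (((((d3 l).const_mul s).add (((d1 l).mul (d2 l)).const_mul (3 * s ^ 2))).add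
    (((d1 l).pow 3).const_mul (s ^ 3))).mul (e0 l)).deriv
  rw [show (fun l => (s * h3 l + 3 * s ^ 2 * (h1 l * h2 l) + s ^ 3 * h1 l ^ 3) *
      Real.exp (s * h l)) =
    (((fun l => s * h3 l) + fun l => 3 * s ^ 2 * (h1 * h2) l) + fun l => s ^ 3 * (h1 ^ 3) l) *
      fun l => Real.exp (s * h l) from rfl, this]
  simp only [Pi.add_apply, Pi.pow_apply, Pi.mul_apply]
  push_cast
  ring

lemma integral_centered_sq_pow_four (o : CayleyKind) {s : ℝ} (hs : 0 ≤ s) :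
    ∫ x : ℤ, ((x : ℝ) - lineMean o s) ^ 2 ∂(lineMeasure o s) = s ∧
    ∫ x : ℤ, ((x : ℝ) - lineMean o s) ^ 4 ∂(lineMeasure o s) = 3 * s ^ 2 + s := by
  have hset : integrableExpSet (fun x : ℤ => (x : ℝ) - lineMean o s) (lineMeasure o s) =
      Set.univ := by
    ext l
    simpa [integrableExpSet] using integrable_exp_mul_centered o hs l
  have hmgf : mgf (fun x : ℤ => (x : ℝ) - lineMean o s) (lineMeasure o s) =
      fun l => Real.exp (s * stepCgf o l) := funext (mgf_centered o hs)
  have h2 := iteratedDeriv_mgf_zero (X := fun x : ℤ => (x : ℝ) - lineMean o s)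
    (μ := lineMeasure o s) (by rw [hset]; simp) 2
  have h4 := iteratedDeriv_mgf_zero (X := fun x : ℤ => (x : ℝ) - lineMean o s)
    (μ := lineMeasure o s) (by rw [hset]; simp) 4
  rw [hmgf] at h2 h4
  simp only [Pi.pow_apply] at h2 h4
  rw [← h2, ← h4]
  have he : ∀ l, HasDerivAt Real.exp (Real.exp l) l := Real.hasDerivAt_exp
  have hn : ∀ l : ℝ, HasDerivAt (fun l => Real.exp (-l)) (-Real.exp (-l)) l := fun l => by
    simpa using (hasDerivAt_neg l).exp
  cases o
  · obtain ⟨a, b⟩ := iteratedDeriv_exp_mul (h := stepCgf .directed)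
      (h1 := fun l => Real.exp l - 1) (h2 := Real.exp) (h3 := Real.exp) (h4 := Real.exp) s
      (fun l => by
        have : stepCgf .directed = fun l => Real.exp l - 1 - l := by
          ext l
          simp [stepCgf, stepMgf, drift]
        rw [this]
        exact ((he l).sub_const 1).fun_sub (hasDerivAt_id' l))
      (fun l => (he l).sub_const 1) he he
    rw [a, b]
    simp [stepCgf, stepMgf, drift]
    ring
  · obtain ⟨a, b⟩ := iteratedDeriv_exp_mul (h := stepCgf .undirected)
      (h1 := fun l => (Real.exp l - Real.exp (-l)) / 2)
      (h2 := fun l => (Real.exp l + Real.exp (-l)) / 2)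
      (h3 := fun l => (Real.exp l - Real.exp (-l)) / 2)
      (h4 := fun l => (Real.exp l + Real.exp (-l)) / 2) s
      (fun l => by
        have : stepCgf .undirected = fun l => (Real.exp l + Real.exp (-l)) / 2 - 1 := by
          ext l
          simp [stepCgf, stepMgf, drift]
        rw [this]
        simpa [sub_eq_add_neg] using
          ((((he l).fun_add (hn l)).div_const 2).sub_const 1))
      (fun l => by simpa using ((he l).fun_sub (hn l)).div_const 2)
      (fun l => by simpa [sub_eq_add_neg] using ((he l).fun_add (hn l)).div_const 2)
      (fun l => by simpa using ((he l).fun_sub (hn l)).div_const 2)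
    rw [a, b]
    simp [stepCgf, stepMgf, drift]
    ring

lemma integral_stdPos_sq (o : CayleyKind) {s : ℝ} (hs : 0 < s) :
    ∫ x : ℤ, stdPos o s x ^ 2 ∂(lineMeasure o s) = 1 := by
  simp only [stdPos, div_pow, Real.sq_sqrt hs.le]
  rw [integral_div, (integral_centered_sq_pow_four o hs.le).1, div_self hs.ne']

lemma integral_stdPos_pow_four (o : CayleyKind) {s : ℝ} (hs : 0 < s) :
    ∫ x : ℤ, stdPos o s x ^ 4 ∂(lineMeasure o s) = 3 + 1 / s := by
  have h4 : √s ^ 4 = s ^ 2 := by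
    rw [show (4 : ℕ) = 2 * 2 from rfl, pow_mul, Real.sq_sqrt hs.le]
  simp only [stdPos, div_pow, h4]
  rw [integral_div, (integral_centered_sq_pow_four o hs.le).2]
  field_simp

/-! ### Comparison with the two-sided exponential law -/

/-- Recentring at `⌊m⌋ + 1` splits the sum into two halves whose `j`-th points are at distance at
least `j` from `m`. Each half is dominated by a geometric series of ratio `exp (-1 / r)`, with sum
at most `1 + r`. -/
lemma tsum_exp_neg_abs_le (m : ℝ) {r : ℝ} (hr : 0 < r) :
    ∑' x : ℤ, ENNReal.ofReal (Real.exp (-|(x - m) / r|)) ≤ ENNReal.ofReal (2 * (1 + r)) := by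
  set a : ℝ := Real.exp (-(1 / r)) with ha
  have ha0 : 0 < a := Real.exp_pos _
  have ha1 : a < 1 := by
    rw [ha, ← Real.exp_zero]
    exact Real.exp_lt_exp.2 (by simpa using hr)
  have hgeom : ∑' j : ℕ, ENNReal.ofReal (a ^ j) ≤ ENNReal.ofReal (1 + r) := by
    rw [← ENNReal.ofReal_tsum_of_nonneg (fun j => by positivity)
      (summable_geometric_of_lt_one ha0.le ha1), tsum_geometric_of_lt_one ha0.le ha1]
    refine ENNReal.ofReal_le_ofReal ?_
    have h1 : a * (1 + 1 / r) ≤ 1 := by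
      have := Real.add_one_le_exp (1 / r)
      calc a * (1 + 1 / r) ≤ a * Real.exp (1 / r) :=
            mul_le_mul_of_nonneg_left (by linarith) ha0.le
        _ = 1 := by rw [ha, ← Real.exp_add]; simp
    rw [inv_eq_one_div, div_le_iff₀ (by linarith)]
    have h2 : a * (1 + 1 / r) = a * (1 + r) / r := by field_simp; ring
    rw [h2, div_le_iff₀ hr] at h1
    nlinarith
  have hpow : ∀ j : ℕ, a ^ j = Real.exp (-(j / r)) := by
    intro j
    rw [ha, ← Real.exp_nat_mul]
    congr 1
    ring
  have hterm : ∀ (j : ℕ) (y : ℝ), (j : ℝ) ≤ |y| →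
      ENNReal.ofReal (Real.exp (-|y / r|)) ≤ ENNReal.ofReal (a ^ j) := by
    intro j y hy
    rw [hpow, abs_div, abs_of_pos hr]
    refine ENNReal.ofReal_le_ofReal (Real.exp_le_exp.2 (neg_le_neg ?_))
    exact div_le_div_of_nonneg_right hy hr.le
  have hfl := Int.floor_le m
  have hfl2 := Int.lt_floor_add_one m
  rw [← (Equiv.addRight (⌊m⌋ + 1)).tsum_eq fun x : ℤ =>
    ENNReal.ofReal (Real.exp (-|(x - m) / r|)), tsum_of_nat_of_neg_add_one ENNReal.summable
    ENNReal.summable, two_mul, ENNReal.ofReal_add (by linarith) (by linarith)]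
  refine add_le_add ((ENNReal.tsum_le_tsum fun j => hterm j _ ?_).trans hgeom)
    ((ENNReal.tsum_le_tsum fun j => hterm j _ ?_).trans hgeom)
  · simp only [Equiv.coe_addRight]
    push_cast
    rw [abs_of_nonneg (by have : (0 : ℝ) ≤ j := Nat.cast_nonneg j; linarith)]
    linarith
  · simp only [Equiv.coe_addRight]
    push_cast
    rw [abs_of_nonpos (by have : (0 : ℝ) ≤ j := Nat.cast_nonneg j; linarith)]
    linarith

/-- The surprisal `-log p` of the walk on `ℤ`. -/
noncomputable def surp (o : CayleyKind) (s : ℝ) (x : ℤ) : ℝ := -Real.log (mass o s x)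

lemma ae_mass_pos (o : CayleyKind) (s : ℝ) : ∀ᵐ x ∂(lineMeasure o s), 0 < mass o s x := by
  rw [ae_iff_of_countable]
  intro x hx
  rw [lineMeasure_singleton] at hx
  exact ENNReal.ofReal_pos.1 (pos_iff_ne_zero.2 hx)

/-- This is `E[q / p] ≤ 1` for the weight `q = exp (-|stdPos|) / (2 (1 + √s))`, of total at most
one. It controls large surprisals without any pointwise lower bound on the mass `p`. -/
lemma lintegral_exp_surp_sub_le (o : CayleyKind) {s : ℝ} (hs : 0 < s) :
    ∫⁻ x : ℤ, ENNReal.ofReal (Real.exp (surp o s x - |stdPos o s x| - Real.log (2 * (1 + √s))))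
      ∂(lineMeasure o s) ≤ 1 := by
  have hZ : 0 < 2 * (1 + √s) := by positivity
  rw [lintegral_countable']
  calc ∑' x : ℤ, ENNReal.ofReal (Real.exp (surp o s x - |stdPos o s x| -
        Real.log (2 * (1 + √s)))) * lineMeasure o s {x}
      ≤ ∑' x : ℤ, ENNReal.ofReal (Real.exp (-|(x - lineMean o s) / √s|)) *
          ENNReal.ofReal ((2 * (1 + √s))⁻¹) := by
        refine ENNReal.tsum_le_tsum fun x => ?_
        rw [lineMeasure_singleton, ← ENNReal.ofReal_mul (Real.exp_pos _).le,
          ← ENNReal.ofReal_mul (Real.exp_pos _).le]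
        refine ENNReal.ofReal_le_ofReal ?_
        rcases (mass_nonneg o s x).eq_or_lt with h | h
        · rw [← h, mul_zero]
          positivity
        · rw [Real.exp_sub, Real.exp_log hZ, sub_eq_add_neg, Real.exp_add, surp, Real.exp_neg,
            Real.exp_log h, stdPos]
          apply le_of_eq
          field_simp
    _ ≤ 1 := by
        rw [ENNReal.tsum_mul_right]
        refine (mul_le_mul_left (tsum_exp_neg_abs_le _ (Real.sqrt_pos.2 hs)) _).trans ?_
        rw [← ENNReal.ofReal_mul hZ.le, mul_inv_cancel₀ hZ.ne', ENNReal.ofReal_one]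

lemma integrable_exp_surp_sub (o : CayleyKind) {s : ℝ} (hs : 0 < s) :
    Integrable (fun x : ℤ => Real.exp (surp o s x - |stdPos o s x| - Real.log (2 * (1 + √s))))
      (lineMeasure o s) := by
  refine ⟨(measurable_of_countable _).aestronglyMeasurable, ?_⟩
  rw [hasFiniteIntegral_iff_ofReal (ae_of_all _ fun x => (Real.exp_pos _).le)]
  exact (lintegral_exp_surp_sub_le o hs).trans_lt ENNReal.one_lt_top

lemma integral_exp_surp_sub_le (o : CayleyKind) {s : ℝ} (hs : 0 < s) :
    ∫ x : ℤ, Real.exp (surp o s x - |stdPos o s x| - Real.log (2 * (1 + √s)))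
      ∂(lineMeasure o s) ≤ 1 := by
  rw [integral_eq_lintegral_of_nonneg_ae (ae_of_all _ fun x => (Real.exp_pos _).le)
    (measurable_of_countable _).aestronglyMeasurable]
  exact ENNReal.toReal_le_of_le_ofReal zero_le_one
    (by simpa using lintegral_exp_surp_sub_le o hs)

/-- The surprisal recentred at `½ log s`. -/
noncomputable def recSurp (o : CayleyKind) (s : ℝ) (x : ℤ) : ℝ := surp o s x - Real.log s / 2

lemma recSurp_ge (o : CayleyKind) {s : ℝ} (hs : 0 < s) {x : ℤ} (hx : 0 < mass o s x) :
    -Real.log 0.64 ≤ recSurp o s x := by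
  have h := Real.log_le_log hx (mass_le o hs x)
  rw [Real.log_div (by norm_num) (Real.sqrt_pos.2 hs).ne', Real.log_sqrt hs.le] at h
  rw [recSurp, surp]
  linarith

lemma recSurp_nonneg (o : CayleyKind) {s : ℝ} (hs : 0 < s) {x : ℤ} (hx : 0 < mass o s x) :
    0 ≤ recSurp o s x := by
  have := Real.log_nonpos (by norm_num : (0 : ℝ) ≤ 0.64) (by norm_num)
  linarith [recSurp_ge o hs hx]

/-- The exponent is halved so that `2 a b ≤ a² + b²` separates the two quantities whose exponential
moments are known. The inequality `2 (1 + √s) ≤ 4 √s` absorbs the recentring by `½ log s`. -/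
lemma exp_half_recSurp_le (o : CayleyKind) {s : ℝ} (hs : 1 ≤ s) (x : ℤ) :
    Real.exp (recSurp o s x / 2) ≤
      Real.exp (surp o s x - |stdPos o s x| - Real.log (2 * (1 + √s))) +
      Real.exp |stdPos o s x| := by
  have hs0 : 0 < s := by linarith
  have h1 : Real.log (2 * (1 + √s)) ≤ Real.log s / 2 + 2 * Real.log 2 := by
    rw [← Real.log_sqrt hs0.le, ← Real.log_rpow two_pos, ← Real.log_mul (by positivity) (by positivity)]
    refine Real.log_le_log (by positivity) ?_
    have := Real.one_le_sqrt.2 hs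
    norm_num
    linarith
  set U := surp o s x - |stdPos o s x| - Real.log (2 * (1 + √s))
  have h2 : recSurp o s x / 2 ≤ U / 2 + |stdPos o s x| / 2 + Real.log 2 := by
    simp only [recSurp, U]
    linarith
  calc Real.exp (recSurp o s x / 2) ≤ Real.exp (U / 2 + |stdPos o s x| / 2 + Real.log 2) :=
        Real.exp_le_exp.2 h2
    _ = Real.exp (U / 2) * Real.exp (|stdPos o s x| / 2) * 2 := by
        rw [Real.exp_add, Real.exp_add, Real.exp_log two_pos]
    _ ≤ Real.exp (U / 2) ^ 2 + Real.exp (|stdPos o s x| / 2) ^ 2 := by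
        nlinarith [sq_nonneg (Real.exp (U / 2) - Real.exp (|stdPos o s x| / 2))]
    _ = _ := by
        rw [← Real.exp_nat_mul, ← Real.exp_nat_mul]
        congr 2 <;> push_cast <;> ring

lemma integrable_exp_half_recSurp (o : CayleyKind) {s : ℝ} (hs : 1 ≤ s) :
    Integrable (fun x => Real.exp (recSurp o s x / 2)) (lineMeasure o s) := by
  refine Integrable.mono' ((integrable_exp_surp_sub o (by linarith)).add
    (integrable_exp_abs_stdPos o (by linarith))) (measurable_of_countable _).aestronglyMeasurable
    (ae_of_all _ fun x => ?_)
  rw [Real.norm_of_nonneg (Real.exp_pos _).le]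
  exact exp_half_recSurp_le o hs x

lemma integral_exp_half_recSurp_le (o : CayleyKind) {s : ℝ} (hs : 1 ≤ s) :
    ∫ x, Real.exp (recSurp o s x / 2) ∂(lineMeasure o s) ≤ 7 := by
  have hs0 : 0 < s := by linarith
  refine (integral_mono (integrable_exp_half_recSurp o hs) ((integrable_exp_surp_sub o hs0).add
    (integrable_exp_abs_stdPos o hs0.le)) (exp_half_recSurp_le o hs)).trans ?_
  rw [integral_add' (integrable_exp_surp_sub o hs0) (integrable_exp_abs_stdPos o hs0.le)]
  linarith [integral_exp_surp_sub_le o hs0, integral_exp_abs_stdPos_le o hs]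

lemma ae_abs_recSurp_pow_le (o : CayleyKind) {s : ℝ} (hs : 1 ≤ s) (n : ℕ) :
    ∀ᵐ x ∂(lineMeasure o s),
      |recSurp o s x| ^ n ≤ 2 ^ n * n.factorial * Real.exp (recSurp o s x / 2) := by
  filter_upwards [ae_mass_pos o s] with x hx
  have h0 := recSurp_nonneg o (by linarith) hx
  have h := Real.pow_div_factorial_le_exp (recSurp o s x / 2) (by positivity) n
  rw [div_le_iff₀' (by positivity), div_pow, div_le_iff₀' (by positivity)] at h
  rw [abs_of_nonneg h0]
  linarith

lemma integrable_abs_recSurp_pow (o : CayleyKind) {s : ℝ} (hs : 1 ≤ s) (n : ℕ) :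
    Integrable (fun x => |recSurp o s x| ^ n) (lineMeasure o s) := by
  refine Integrable.mono' ((integrable_exp_half_recSurp o hs).const_mul (2 ^ n * n.factorial : ℝ))
    (measurable_of_countable _).aestronglyMeasurable ?_
  filter_upwards [ae_abs_recSurp_pow_le o hs n] with x hx
  rwa [Real.norm_of_nonneg (by positivity)]

lemma integral_abs_recSurp_pow_le (o : CayleyKind) {s : ℝ} (hs : 1 ≤ s) (n : ℕ) :
    ∫ x, |recSurp o s x| ^ n ∂(lineMeasure o s) ≤ 2 ^ n * n.factorial * 7 := by
  refine (integral_mono_ae (integrable_abs_recSurp_pow o hs n)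
    ((integrable_exp_half_recSurp o hs).const_mul (2 ^ n * n.factorial : ℝ))
    (ae_abs_recSurp_pow_le o hs n)).trans ?_
  rw [integral_const_mul]
  exact mul_le_mul_of_nonneg_left (integral_exp_half_recSurp_le o hs) (by positivity)

/-! ### Entropy and varentropy of the walk on `ℤ` -/

lemma integrable_fun_sub {α : Type*} [MeasurableSpace α] {μ : Measure α} {f g : α → ℝ}
    (hf : Integrable f μ) (hg : Integrable g μ) : Integrable (fun x => f x - g x) μ :=
  hf.sub hg

/-- The entropy of the walk on `ℤ`. -/
noncomputable def lineEntropy (o : CayleyKind) (s : ℝ) : ℝ := ∫ x, surp o s x ∂(lineMeasure o s)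

/-- The varentropy of the walk on `ℤ`. -/
noncomputable def lineVar (o : CayleyKind) (s : ℝ) : ℝ := variance (surp o s) (lineMeasure o s)

lemma surprisal_eq (o : CayleyKind) (k : ℕ) [NeZero k] {t : ℝ} (ht : 0 ≤ t) :
    surprisal o k t = surp o (t / k) := by
  ext x
  rw [surprisal, coordLaw_eq o k ht, surp, mass]

lemma entropy_eq (o : CayleyKind) (k : ℕ) [NeZero k] {t : ℝ} (ht : 0 ≤ t) :
    entropy o k t = lineEntropy o (t / k) := by
  rw [entropy, surprisal_eq o k ht, coordLaw_eq o k ht, lineEntropy, lineMeasure]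

lemma varentropy_eq (o : CayleyKind) (k : ℕ) [NeZero k] {t : ℝ} (ht : 0 ≤ t) :
    varentropy o k t = lineVar o (t / k) := by
  rw [varentropy, surprisal_eq o k ht, coordLaw_eq o k ht, lineVar, lineMeasure]

/-- Applying `y^n ≤ n! exp y` to `y = -½ log p` trades the logarithms for a factor `1 / √p`; the
remaining `√p` still decays exponentially in the position by `sqrt_mass_le`. -/
lemma mul_abs_log_pow_le {p : ℝ} (hp : 0 ≤ p) (hp1 : p ≤ 1) (n : ℕ) :
    p * |Real.log p| ^ n ≤ 2 ^ n * n.factorial * √p := by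
  rcases hp.eq_or_lt with rfl | hp
  · simp
  · have h0 : 0 ≤ -Real.log p := by linarith [Real.log_nonpos hp.le hp1]
    have h := Real.pow_div_factorial_le_exp (-Real.log p / 2) (by positivity) n
    rw [div_le_iff₀' (by positivity), div_pow, div_le_iff₀' (by positivity)] at h
    have h1 : Real.exp (-Real.log p / 2) = (√p)⁻¹ := by
      rw [show -Real.log p / 2 = -Real.log √p by rw [Real.log_sqrt hp.le]; ring, Real.exp_neg,
        Real.exp_log (Real.sqrt_pos.2 hp)]
    rw [h1] at h
    rw [abs_of_nonpos (by linarith)]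
    calc p * (-Real.log p) ^ n ≤ p * (2 ^ n * (n.factorial * (√p)⁻¹)) :=
          mul_le_mul_of_nonneg_left h hp.le
      _ = 2 ^ n * n.factorial * (p / √p) := by rw [div_eq_mul_inv]; ring
      _ = _ := by rw [Real.div_sqrt]

lemma sqrt_mass_le (o : CayleyKind) {s T : ℝ} (hs : 0 ≤ s) (hsT : s ≤ T) (x : ℤ) :
    √(mass o s x) ≤ √(Real.exp (T * Real.exp 2)) * Real.exp (-|(x : ℝ)|) := by
  refine (Real.sqrt_le_sqrt (mass_le_exp o hs hsT x)).trans (le_of_eq ?_)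
  rw [Real.sqrt_mul (Real.exp_pos _).le]
  congr 1
  rw [show -(2 * |(x : ℝ)|) = -|(x : ℝ)| + -|(x : ℝ)| by ring, Real.exp_add,
    Real.sqrt_mul_self (Real.exp_pos _).le]

lemma summable_exp_neg_abs : Summable fun x : ℤ => Real.exp (-|(x : ℝ)|) := by
  have h := tsum_exp_neg_abs_le 0 one_pos
  have h2 := ENNReal.summable_toReal (h.trans_lt ENNReal.ofReal_lt_top).ne
  refine h2.congr fun x => ?_
  rw [ENNReal.toReal_ofReal (Real.exp_pos _).le]
  simp

/-- The `n`-th term of the series for the moments of the surprisal. -/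
lemma mass_mul_surp_pow_le (o : CayleyKind) {s T : ℝ} (hs : 0 ≤ s) (hsT : s ≤ T) (n : ℕ) (x : ℤ) :
    mass o s x * |surp o s x| ^ n ≤
      2 ^ n * n.factorial * √(Real.exp (T * Real.exp 2)) * Real.exp (-|(x : ℝ)|) := by
  rw [surp, abs_neg]
  refine (mul_abs_log_pow_le (mass_nonneg o s x) (mass_le_one o s x) n).trans ?_
  rw [mul_assoc _ (√(Real.exp (T * Real.exp 2)))]
  exact mul_le_mul_of_nonneg_left (sqrt_mass_le o hs hsT x) (by positivity)

lemma integrable_lineMeasure_iff (o : CayleyKind) (s : ℝ) (g : ℤ → ℝ) :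
    Integrable g (lineMeasure o s) ↔ Summable fun x => mass o s x * |g x| := by
  have hm : ∀ x, ENNReal.ofReal |g x| * lineMeasure o s {x} =
      ENNReal.ofReal (mass o s x * |g x|) := fun x => by
    rw [lineMeasure_singleton, ← ENNReal.ofReal_mul (abs_nonneg _), mul_comm]
  constructor
  · intro h
    have h2 := h.2
    rw [hasFiniteIntegral_iff_norm, lintegral_countable'] at h2
    simp only [Real.norm_eq_abs, hm] at h2
    refine (ENNReal.summable_toReal h2.ne).congr fun x => ?_
    rw [ENNReal.toReal_ofReal (mul_nonneg (mass_nonneg o s x) (abs_nonneg _))]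
  · intro h
    refine ⟨(measurable_of_countable _).aestronglyMeasurable, ?_⟩
    rw [hasFiniteIntegral_iff_norm, lintegral_countable']
    simp only [Real.norm_eq_abs, hm]
    rw [← ENNReal.ofReal_tsum_of_nonneg
      (fun x => mul_nonneg (mass_nonneg o s x) (abs_nonneg _)) h]
    exact ENNReal.ofReal_lt_top

lemma integral_lineMeasure (o : CayleyKind) {s : ℝ} {g : ℤ → ℝ}
    (h : Integrable g (lineMeasure o s)) :
    ∫ x, g x ∂(lineMeasure o s) = ∑' x, mass o s x * g x := by
  rw [integral_countable h]
  exact tsum_congr fun x => by rw [lineMeasure_real_singleton, smul_eq_mul]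

lemma integrable_surp_pow (o : CayleyKind) {s : ℝ} (hs : 0 ≤ s) (n : ℕ) :
    Integrable (fun x => surp o s x ^ n) (lineMeasure o s) := by
  rw [integrable_lineMeasure_iff]
  refine Summable.of_nonneg_of_le (fun x => mul_nonneg (mass_nonneg o s x) (abs_nonneg _))
    (fun x => ?_) (summable_exp_neg_abs.mul_left
      (2 ^ n * n.factorial * √(Real.exp (s * Real.exp 2))))
  rw [abs_pow]
  exact mass_mul_surp_pow_le o hs le_rfl n x

lemma integrable_surp (o : CayleyKind) {s : ℝ} (hs : 0 ≤ s) :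
    Integrable (surp o s) (lineMeasure o s) := by
  simpa using integrable_surp_pow o hs 1

lemma memLp_surp (o : CayleyKind) {s : ℝ} (hs : 0 ≤ s) : MemLp (surp o s) 2 (lineMeasure o s) :=
  (memLp_two_iff_integrable_sq (measurable_of_countable _).aestronglyMeasurable).2
    (integrable_surp_pow o hs 2)

/-- A series of continuous functions of `s` with a summable majorant uniform on each `[0, T]`. -/
lemma continuousOn_integral_surp_pow (o : CayleyKind) (n : ℕ)
    (hc : ContinuousOn (fun p : ℝ => p * (-Real.log p) ^ n) (Set.Ici 0)) :
    ContinuousOn (fun s => ∫ x, surp o s x ^ n ∂(lineMeasure o s)) (Set.Ici 0) := by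
  have hT : ∀ T : ℝ, ContinuousOn (fun s => ∫ x, surp o s x ^ n ∂(lineMeasure o s))
      (Set.Icc 0 T) := by
    intro T
    have h : ContinuousOn (fun s => ∑' x, mass o s x * surp o s x ^ n) (Set.Icc 0 T) := by
      refine continuousOn_tsum (fun x => ?_) (summable_exp_neg_abs.mul_left
        (2 ^ n * n.factorial * √(Real.exp (T * Real.exp 2)))) fun x s hs => ?_
      · exact hc.comp ((continuousOn_mass o x).mono Set.Icc_subset_Ici_self)
          fun s _ => mass_nonneg o s x
      · rw [norm_mul, norm_pow, Real.norm_of_nonneg (mass_nonneg o s x), Real.norm_eq_abs]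
        exact mass_mul_surp_pow_le o hs.1 hs.2 n x
    refine h.congr fun s hs => ?_
    exact integral_lineMeasure o (integrable_surp_pow o hs.1 n)
  intro s hs
  refine ((hT (s + 1)) s ⟨hs, by linarith⟩).mono_of_mem_nhdsWithin ?_
  rw [← Set.Ici_inter_Iic]
  exact inter_mem self_mem_nhdsWithin (mem_nhdsWithin_of_mem_nhds (Iic_mem_nhds (by linarith)))

lemma continuousOn_lineEntropy (o : CayleyKind) : ContinuousOn (lineEntropy o) (Set.Ici 0) := by
  have h := continuousOn_integral_surp_pow o 1 (by
    simpa using Real.continuous_mul_log.fun_neg.continuousOn)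
  simp only [pow_one] at h
  exact h

lemma continuousOn_mul_log_sq :
    ContinuousOn (fun p : ℝ => p * (-Real.log p) ^ 2) (Set.Ici 0) := by
  have h1 : Continuous fun p : ℝ => 4 * (√p * Real.log √p) ^ 2 :=
    continuous_const.mul ((Real.continuous_mul_log.comp Real.continuous_sqrt).pow 2)
  refine h1.continuousOn.congr fun p hp => ?_
  have hp0 : (0 : ℝ) ≤ p := hp
  simp only
  rw [Real.log_sqrt hp0, mul_pow, Real.sq_sqrt hp0]
  ring

lemma lineVar_eq (o : CayleyKind) {s : ℝ} (hs : 0 ≤ s) :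
    lineVar o s = ∫ x, surp o s x ^ 2 ∂(lineMeasure o s) - lineEntropy o s ^ 2 := by
  rw [lineVar, variance_eq_sub (memLp_surp o hs)]
  rfl

lemma continuousOn_lineVar (o : CayleyKind) : ContinuousOn (lineVar o) (Set.Ici 0) :=
  ((continuousOn_integral_surp_pow o 2 continuousOn_mul_log_sq).sub
    ((continuousOn_lineEntropy o).pow 2)).congr fun _ hs => lineVar_eq o hs

lemma lineEntropy_ge (o : CayleyKind) {s : ℝ} (hs : 0 < s) :
    Real.log s / 2 - Real.log 0.64 ≤ lineEntropy o s := by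
  have h : ∫ _, (Real.log s / 2 - Real.log 0.64) ∂(lineMeasure o s) ≤ lineEntropy o s := by
    refine integral_mono_ae (integrable_const _) (integrable_surp o hs.le) ?_
    filter_upwards [ae_mass_pos o s] with x hx
    have := recSurp_ge o hs hx
    rw [recSurp] at this
    linarith
  simpa using h

/-- Gibbs' inequality against the two-sided exponential weight, that is `u ≤ exp u - 1` inside the
expectation, together with `E|Y| ≤ (E Y² + 1) / 2 = 1` for the standardized position `Y`. -/
lemma lineEntropy_le (o : CayleyKind) {s : ℝ} (hs : 0 < s) :
    lineEntropy o s ≤ Real.log (2 * (1 + √s)) + 1 := by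
  have h1 : ∫ x, (surp o s x - |stdPos o s x| - Real.log (2 * (1 + √s))) ∂(lineMeasure o s) ≤
      ∫ x, (Real.exp (surp o s x - |stdPos o s x| - Real.log (2 * (1 + √s))) - 1)
        ∂(lineMeasure o s) := by
    have hi : Integrable (fun x => |stdPos o s x|) (lineMeasure o s) := by
      simpa using integrable_abs_stdPos_pow o hs.le 1
    refine integral_mono (((integrable_surp o hs.le).sub hi).sub (integrable_const _))
      ((integrable_exp_surp_sub o hs).sub (integrable_const _)) fun x => ?_
    linarith [Real.add_one_le_exp (surp o s x - |stdPos o s x| - Real.log (2 * (1 + √s)))]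
  have hi : Integrable (fun x => |stdPos o s x|) (lineMeasure o s) := by
    simpa using integrable_abs_stdPos_pow o hs.le 1
  have hi2 : Integrable (fun x => stdPos o s x ^ 2) (lineMeasure o s) := by
    simpa using integrable_abs_stdPos_pow o hs.le 2
  rw [integral_sub (integrable_fun_sub (integrable_surp o hs.le) hi) (integrable_const _),
    integral_sub (integrable_surp o hs.le) hi,
    integral_sub (integrable_exp_surp_sub o hs) (integrable_const _)] at h1
  have h2 : ∫ x, |stdPos o s x| ∂(lineMeasure o s) ≤
      ∫ x, (stdPos o s x ^ 2 + 1) / 2 ∂(lineMeasure o s) := by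
    refine integral_mono hi ((hi2.add (integrable_const _)).div_const 2) fun x => ?_
    have := sq_nonneg (|stdPos o s x| - 1)
    have h3 := sq_abs (stdPos o s x)
    simp only
    nlinarith
  rw [integral_div, integral_add hi2 (integrable_const _), integral_stdPos_sq o hs] at h2
  have h3 := integral_exp_surp_sub_le o hs
  simp only [integral_const, probReal_univ, smul_eq_mul, one_mul] at h1 h2
  rw [← lineEntropy] at h1
  linarith

/-! ### Concavity of the entropy in time -/

lemma bind_map_add_apply (p q : PMF ℤ) (z : ℤ) :
    (p.bind fun x => q.map (x + ·)) z = ∑' x, p x * q (z - x) := by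
  rw [PMF.bind_apply]
  refine tsum_congr fun x => ?_
  congr 1
  rw [PMF.map_apply, tsum_eq_single (z - x)]
  · simp
  · intro b hb
    rw [if_neg]
    rintro rfl
    simp at hb

lemma lineLaw_add_apply (o : CayleyKind) {s u : ℝ} (hs : 0 ≤ s) (hu : 0 ≤ u) (z : ℤ) :
    lineLaw o (s + u) z = ∑' x, lineLaw o s x * lineLaw o u (z - x) := by
  rw [lineLaw_add o hs hu, bind_map_add_apply]

lemma lintegral_lineMeasure_add (o : CayleyKind) {s u : ℝ} (hs : 0 ≤ s) (hu : 0 ≤ u)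
    (g : ℤ → ℝ≥0∞) : ∫⁻ x, ∫⁻ y, g (x + y) ∂(lineMeasure o u) ∂(lineMeasure o s) =
      ∫⁻ z, g z ∂(lineMeasure o (s + u)) := by
  simp only [lineMeasure, ← lsum_eq_lintegral]
  rw [lineLaw_add o hs hu, lsum_bind]
  simp_rw [lsum_map]
  rfl

/-- The joint law of three independent walks on `ℤ` at different times. -/
noncomputable def tripleMeasure (o : CayleyKind) (s u r : ℝ) : Measure (ℤ × ℤ × ℤ) :=
  (lineMeasure o s).prod ((lineMeasure o u).prod (lineMeasure o r))

instance (o : CayleyKind) (s u r : ℝ) : IsProbabilityMeasure (tripleMeasure o s u r) :=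
  inferInstanceAs (IsProbabilityMeasure
    ((lineMeasure o s).prod ((lineMeasure o u).prod (lineMeasure o r))))

lemma lintegral_tripleMeasure (o : CayleyKind) (s u r : ℝ) (g : ℤ × ℤ × ℤ → ℝ≥0∞) :
    ∫⁻ w, g w ∂(tripleMeasure o s u r) =
      ∫⁻ x, ∫⁻ y, ∫⁻ z, g (x, y, z) ∂(lineMeasure o r) ∂(lineMeasure o u) ∂(lineMeasure o s) := by
  rw [tripleMeasure, lintegral_prod _ (measurable_of_countable _).aemeasurable]
  congr 1
  ext x
  rw [lintegral_prod _ (measurable_of_countable _).aemeasurable]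

lemma tripleMeasure_maps (o : CayleyKind) {s u r : ℝ} (hs : 0 ≤ s) (hu : 0 ≤ u) (hr : 0 ≤ r) :
    MeasurePreserving (fun w : ℤ × ℤ × ℤ => w.1) (tripleMeasure o s u r) (lineMeasure o s) ∧
    MeasurePreserving (fun w : ℤ × ℤ × ℤ => w.1 + w.2.1) (tripleMeasure o s u r)
      (lineMeasure o (s + u)) ∧
    MeasurePreserving (fun w : ℤ × ℤ × ℤ => w.1 + w.2.2) (tripleMeasure o s u r)
      (lineMeasure o (s + r)) ∧
    MeasurePreserving (fun w : ℤ × ℤ × ℤ => w.1 + w.2.1 + w.2.2) (tripleMeasure o s u r)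
      (lineMeasure o (s + u + r)) := by
  have hm : ∀ (g : ℤ × ℤ × ℤ → ℤ) (ν : Measure ℤ),
      (∀ f : ℤ → ℝ≥0∞, ∫⁻ w, f (g w) ∂(tripleMeasure o s u r) = ∫⁻ x, f x ∂ν) →
      MeasurePreserving g (tripleMeasure o s u r) ν := by
    intro g ν h
    refine ⟨measurable_of_countable _, Measure.ext_of_lintegral _ fun f hf => ?_⟩
    rw [lintegral_map hf (measurable_of_countable _), h]
  refine ⟨hm _ _ fun f => ?_, hm _ _ fun f => ?_, hm _ _ fun f => ?_, hm _ _ fun f => ?_⟩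
  · simp [lintegral_tripleMeasure]
  · simp [lintegral_tripleMeasure, lintegral_lineMeasure_add o hs hu]
  · simp [lintegral_tripleMeasure, lintegral_lineMeasure_add o hs hr]
  · simp only [lintegral_tripleMeasure]
    rw [lintegral_lineMeasure_add o hs hu (fun y => ∫⁻ z, f (y + z) ∂(lineMeasure o r)),
      lintegral_lineMeasure_add o (add_nonneg hs hu) hr]

/-- Let `X`, `Y`, `Y'` be independent walks at times `s`, `u`, `r`. The weight of `X` cancels
`lineLaw o s` in the denominator. Summing over `a = X + Y'` in place of `X` turns the sum over `Y'`
into a convolution, which is exactly the remaining denominator. The cancellations are only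
inequalities because masses may vanish. -/
lemma lintegral_entropy_ratio_le (o : CayleyKind) {s u r : ℝ} (hs : 0 ≤ s) (hu : 0 ≤ u)
    (hr : 0 ≤ r) :
    ∫⁻ w : ℤ × ℤ × ℤ, lineLaw o (s + r) (w.1 + w.2.2) * lineLaw o (s + u) (w.1 + w.2.1) /
      (lineLaw o s w.1 * lineLaw o (s + u + r) (w.1 + w.2.1 + w.2.2))
      ∂(tripleMeasure o s u r) ≤ 1 := by
  rw [lintegral_tripleMeasure]
  simp only [lineMeasure, ← lsum_eq_lintegral, lsum]
  set F := lineLaw o (s + u + r)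
  set p := lineLaw o s
  set pr := lineLaw o (s + r)
  set pu := lineLaw o (s + u)
  set q := lineLaw o u
  set q' := lineLaw o r
  have hF : ∀ z, ∑' y', q' y' * pu (z - y') = F z := by
    intro z
    rw [← lineLaw_add_apply o hr (add_nonneg hs hu), add_comm r]
  calc ∑' x, p x * ∑' y, q y * ∑' y', q' y' * (pr (x + y') * pu (x + y) / (p x * F (x + y + y')))
      ≤ ∑' x, ∑' y, ∑' y', q y * (q' y' * (pr (x + y') * pu (x + y) / F (x + y + y'))) := by
        simp only [← ENNReal.tsum_mul_left]
        refine ENNReal.tsum_le_tsum fun x => ENNReal.tsum_le_tsum fun y =>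
          ENNReal.tsum_le_tsum fun y' => ?_
        have h1 : p x * (q y * (q' y' * (pr (x + y') * pu (x + y) / (p x * F (x + y + y'))))) =
            q y * (q' y' * (pr (x + y') * pu (x + y) * (p x / (p x * F (x + y + y'))))) := by
          rw [div_eq_mul_inv, div_eq_mul_inv]
          ring
        rw [h1]
        refine mul_le_mul_right (mul_le_mul_right ?_ _) _
        rw [div_eq_mul_inv (pr (x + y') * pu (x + y))]
        refine mul_le_mul_right ?_ _
        by_cases hp : p x = 0
        · simp [hp]
        · have := ENNReal.mul_div_mul_left 1 (F (x + y + y')) hp (p.apply_ne_top x)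
          rw [mul_one, one_div] at this
          exact this.le
    _ = ∑' a, ∑' y, ∑' y', q y * (q' y' * (pr a * pu (a + y - y') / F (a + y))) := by
        rw [ENNReal.tsum_comm]
        conv_rhs => rw [ENNReal.tsum_comm]
        refine tsum_congr fun y => ?_
        rw [ENNReal.tsum_comm]
        conv_rhs => rw [ENNReal.tsum_comm]
        refine tsum_congr fun y' => ?_
        rw [← (Equiv.addRight y').tsum_eq
          fun a => q y * (q' y' * (pr a * pu (a + y - y') / F (a + y)))]
        refine tsum_congr fun x => ?_
        simp only [Equiv.coe_addRight]
        rw [show x + y' + y - y' = x + y by ring, show x + y' + y = x + y + y' by ring]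
    _ ≤ ∑' a, ∑' y, q y * pr a := by
        refine ENNReal.tsum_le_tsum fun a => ENNReal.tsum_le_tsum fun y => ?_
        have h1 : ∀ y', q y * (q' y' * (pr a * pu (a + y - y') / F (a + y))) =
            q y * pr a * (F (a + y))⁻¹ * (q' y' * pu (a + y - y')) := by
          intro y'
          rw [div_eq_mul_inv]
          ring
        simp_rw [h1]
        rw [ENNReal.tsum_mul_left, hF, mul_assoc, mul_comm _ (F (a + y)), ← div_eq_mul_inv]
        exact mul_le_of_le_one_right zero_le ENNReal.div_self_le_one
    _ = 1 := by
        simp_rw [ENNReal.tsum_mul_right, PMF.tsum_coe, one_mul, PMF.tsum_coe]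

/-- Submodularity of entropy for sums of independent variables. -/
lemma lineEntropy_submodular (o : CayleyKind) {s u r : ℝ} (hs : 0 ≤ s) (hu : 0 ≤ u)
    (hr : 0 ≤ r) :
    lineEntropy o (s + u + r) + lineEntropy o s ≤
      lineEntropy o (s + u) + lineEntropy o (s + r) := by
  obtain ⟨m1, m2, m3, m4⟩ := tripleMeasure_maps o hs hu hr
  set μ := tripleMeasure o s u r
  set R : ℤ × ℤ × ℤ → ℝ := fun w => mass o (s + r) (w.1 + w.2.2) * mass o (s + u) (w.1 + w.2.1) /
      (mass o s w.1 * mass o (s + u + r) (w.1 + w.2.1 + w.2.2)) with hR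
  have hR0 : ∀ w, 0 ≤ R w := fun w => div_nonneg (mul_nonneg (mass_nonneg _ _ _)
    (mass_nonneg _ _ _)) (mul_nonneg (mass_nonneg _ _ _) (mass_nonneg _ _ _))
  have hp1 := m1.quasiMeasurePreserving.ae (ae_mass_pos o s)
  have hp2 := m2.quasiMeasurePreserving.ae (ae_mass_pos o (s + u))
  have hp3 := m3.quasiMeasurePreserving.ae (ae_mass_pos o (s + r))
  have hp4 := m4.quasiMeasurePreserving.ae (ae_mass_pos o (s + u + r))
  have hRle : ∫⁻ w, ENNReal.ofReal (R w) ∂μ ≤ 1 := by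
    refine le_trans (lintegral_mono_ae ?_) (lintegral_entropy_ratio_le o hs hu hr)
    filter_upwards [hp1, hp4] with w h1 h4
    rw [hR]
    simp only [mass]
    rw [← ENNReal.toReal_mul, ← ENNReal.toReal_mul, ← ENNReal.toReal_div]
    exact ENNReal.ofReal_toReal_le
  have hRi : Integrable R μ := by
    refine ⟨(measurable_of_countable _).aestronglyMeasurable, ?_⟩
    rw [hasFiniteIntegral_iff_ofReal (ae_of_all _ hR0)]
    exact hRle.trans_lt ENNReal.one_lt_top
  have hRint : ∫ w, R w ∂μ ≤ 1 := by
    rw [integral_eq_lintegral_of_nonneg_ae (ae_of_all _ hR0)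
      (measurable_of_countable _).aestronglyMeasurable]
    exact ENNReal.toReal_le_of_le_ofReal zero_le_one (by simpa using hRle)
  have i1 := m1.integrable_comp_of_integrable (integrable_surp o hs)
  have i2 := m2.integrable_comp_of_integrable (integrable_surp o (add_nonneg hs hu))
  have i3 := m3.integrable_comp_of_integrable (integrable_surp o (add_nonneg hs hr))
  have i4 := m4.integrable_comp_of_integrable
    (integrable_surp o (add_nonneg (add_nonneg hs hu) hr))
  have hint : ∀ {g : ℤ × ℤ × ℤ → ℤ} {t : ℝ}, MeasurePreserving g μ (lineMeasure o t) →
      ∫ w, (surp o t ∘ g) w ∂μ = lineEntropy o t := by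
    intro g t hg
    rw [lineEntropy, ← hg.map_eq, integral_map hg.measurable.aemeasurable
      (measurable_of_countable _).aestronglyMeasurable]
    rfl
  -- The expectation of `log R` is the defect in the submodularity inequality, and `log R ≤ R - 1`
  -- with `E R ≤ 1` makes it nonpositive.
  have key : ∫ w, ((surp o s ∘ fun w : ℤ × ℤ × ℤ => w.1) w +
        (surp o (s + u + r) ∘ fun w : ℤ × ℤ × ℤ => w.1 + w.2.1 + w.2.2) w -
        (surp o (s + u) ∘ fun w : ℤ × ℤ × ℤ => w.1 + w.2.1) w -
        (surp o (s + r) ∘ fun w : ℤ × ℤ × ℤ => w.1 + w.2.2) w) ∂μ ≤ ∫ w, (R w - 1) ∂μ := by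
    refine integral_mono_ae (((i1.add i4).sub i2).sub i3) (hRi.sub (integrable_const _)) ?_
    filter_upwards [hp1, hp2, hp3, hp4] with w h1 h2 h3 h4
    have h5 := Real.log_le_sub_one_of_pos (div_pos (mul_pos h3 h2) (mul_pos h1 h4))
    rw [Real.log_div (mul_pos h3 h2).ne' (mul_pos h1 h4).ne', Real.log_mul h3.ne' h2.ne',
      Real.log_mul h1.ne' h4.ne'] at h5
    simp only [surp, Function.comp, hR]
    linarith
  rw [integral_sub (integrable_fun_sub (i1.fun_add i4) i2) i3, integral_sub (i1.fun_add i4) i2, integral_add i1 i4,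
    integral_sub hRi (integrable_const _), hint m1, hint m2, hint m3, hint m4] at key
  simp only [integral_const, probReal_univ, smul_eq_mul, one_mul] at key
  linarith

/-- Subtracting the chord leaves a midpoint concave function `g` vanishing at both ends. A negative
minimum would be attained at a leftmost interior point `t`, and midpoint concavity at `t ± d` would
force the same minimum at `t - d`, further left. -/
lemma concaveOn_of_midpoint {f : ℝ → ℝ} (hc : ContinuousOn f (Set.Ici 0))
    (h : ∀ x y, 0 ≤ x → x ≤ y → f x + f y ≤ 2 * f ((x + y) / 2)) :
    ConcaveOn ℝ (Set.Ici 0) f := by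
  refine LinearOrder.concaveOn_of_lt (convex_Ici 0) fun x hx y hy hxy a b ha hb hab => ?_
  have hx0 : 0 ≤ x := hx
  have hyx : 0 < y - x := sub_pos.2 hxy
  set g : ℝ → ℝ := fun t => f t - (f x + (f y - f x) / (y - x) * (t - x)) with hg
  have hsub : Set.Icc x y ⊆ Set.Ici 0 := fun t ht => hx0.trans ht.1
  have hgc : ContinuousOn g (Set.Icc x y) := (hc.mono hsub).sub (by fun_prop)
  have hgx : g x = 0 := by simp [hg]
  have hgy : g y = 0 := by
    simp only [hg]
    rw [div_mul_cancel₀ _ hyx.ne']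
    ring
  have hgm : ∀ p q, x ≤ p → p ≤ q → g p + g q ≤ 2 * g ((p + q) / 2) := by
    intro p q hp hpq
    have := h p q (hx0.trans hp) hpq
    simp only [hg]
    linarith
  obtain ⟨m, hmem, hmin⟩ := isCompact_Icc.exists_isMinOn (Set.nonempty_Icc.2 hxy.le) hgc
  have hnonneg : 0 ≤ g m := by
    by_contra hneg
    push Not at hneg
    have hS : IsCompact (Set.Icc x y ∩ g ⁻¹' {g m}) := by
      refine isCompact_Icc.of_isClosed_subset
        (hgc.preimage_isClosed_of_isClosed isClosed_Icc isClosed_singleton) Set.inter_subset_left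
    obtain ⟨t, ⟨⟨htx, hty⟩, htm⟩, htmin⟩ := hS.exists_isLeast ⟨m, hmem, rfl⟩
    have htm : g t = g m := htm
    have htx' : x < t := lt_of_le_of_ne htx fun h => by rw [← h, hgx] at htm; linarith
    have hty' : t < y := lt_of_le_of_ne hty fun h => by rw [h, hgy] at htm; linarith
    set d := min (t - x) (y - t) with hd
    have hd0 : 0 < d := lt_min (by linarith) (by linarith)
    have hd1 : d ≤ t - x := min_le_left _ _
    have hd2 : d ≤ y - t := min_le_right _ _
    have h1 := hgm (t - d) (t + d) (by linarith) (by linarith)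
    rw [show (t - d + (t + d)) / 2 = t by ring] at h1
    have h2 : g m ≤ g (t + d) := hmin (show t + d ∈ Set.Icc x y from ⟨by linarith, by linarith⟩)
    have h3 : g m ≤ g (t - d) := hmin (show t - d ∈ Set.Icc x y from ⟨by linarith, by linarith⟩)
    have h4 := htmin (show t - d ∈ Set.Icc x y ∩ g ⁻¹' {g m} from
      ⟨⟨by linarith, by linarith⟩, show g (t - d) = g m by linarith⟩)
    linarith
  have hin : a * x + b * y ∈ Set.Icc x y := by
    constructor <;> nlinarith
  have hfin : 0 ≤ g (a * x + b * y) := hnonneg.trans (hmin hin)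
  simp only [hg] at hfin
  have hb' : a * x + b * y - x = b * (y - x) := by
    have : a = 1 - b := by linarith
    rw [this]
    ring
  rw [hb', mul_left_comm, div_mul_cancel₀ _ hyx.ne'] at hfin
  simp only [smul_eq_mul]
  have : a = 1 - b := by linarith
  rw [this]
  rw [this] at hfin
  linarith

/-- Submodularity with two equal increments of time is midpoint concavity. -/
lemma concaveOn_lineEntropy (o : CayleyKind) : ConcaveOn ℝ (Set.Ici 0) (lineEntropy o) := by
  refine concaveOn_of_midpoint (continuousOn_lineEntropy o) fun x y hx hxy => ?_
  have hd : 0 ≤ (y - x) / 2 := by linarith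
  have h := lineEntropy_submodular o hx hd hd
  rw [show x + (y - x) / 2 + (y - x) / 2 = y by ring, show x + (y - x) / 2 = (x + y) / 2 by ring]
    at h
  linarith

lemma tendsto_lineEntropy (o : CayleyKind) : Tendsto (lineEntropy o) atTop atTop := by
  have h : Tendsto (fun s => Real.log s / 2 - Real.log 0.64) atTop atTop :=
    tendsto_atTop_add_const_right _ _ (Real.tendsto_log_atTop.atTop_div_const two_pos)
  refine tendsto_atTop_mono' _ ?_ h
  filter_upwards [eventually_gt_atTop 0] with s hs using lineEntropy_ge o hs

/-- A concave function that once fails to increase is bounded above from there on, whereas the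
entropy tends to infinity. -/
lemma strictMonoOn_lineEntropy (o : CayleyKind) : StrictMonoOn (lineEntropy o) (Set.Ici 0) := by
  intro x hx y hy hxy
  by_contra hle
  push Not at hle
  obtain ⟨z, hzy, hz⟩ := ((eventually_gt_atTop y).and
    ((tendsto_lineEntropy o).eventually_gt_atTop (lineEntropy o y))).exists
  have hz0 : z ∈ Set.Ici (0 : ℝ) := (show (0 : ℝ) ≤ y from hy).trans hzy.le
  have h := (concaveOn_lineEntropy o).slope_anti_adjacent hx hz0 hxy hzy
  have h1 : 0 < (lineEntropy o z - lineEntropy o y) / (z - y) :=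
    div_pos (by linarith) (by linarith)
  have h2 : (lineEntropy o y - lineEntropy o x) / (y - x) ≤ 0 :=
    div_nonpos_of_nonpos_of_nonneg (by linarith) (by linarith)
  linarith

lemma lineEntropy_zero (o : CayleyKind) : lineEntropy o 0 = 0 := by
  have h : ∀ x, surp o 0 x = 0 := by
    intro x
    have h1 := mass_eq_integral o le_rfl x
    have h2 : ∀ θ : ℝ, Complex.exp (-(θ * x * Complex.I)) * lineChar o 0 θ =
        Complex.exp (θ * ((-x : ℤ) : ℂ) * Complex.I) := by
      intro θ
      rw [lineChar]
      push_cast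
      simp
    simp_rw [h2] at h1
    rw [integral_exp_int] at h1
    have h3 : mass o 0 x = 0 ∨ mass o 0 x = 1 := by
      split_ifs at h1
      · right
        rw [inv_mul_cancel₀ (by simp [Real.pi_ne_zero])] at h1
        exact_mod_cast h1
      · left
        simpa using h1
    rcases h3 with h3 | h3 <;> simp [surp, h3]
  simp [lineEntropy, h]

lemma bijOn_lineEntropy (o : CayleyKind) :
    Set.BijOn (lineEntropy o) (Set.Ici 0) (Set.Ici 0) := by
  refine ⟨fun s hs => ?_, (strictMonoOn_lineEntropy o).injOn, fun h hh => ?_⟩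
  · have := (strictMonoOn_lineEntropy o).monotoneOn Set.self_mem_Ici hs hs
    rwa [lineEntropy_zero] at this
  · obtain ⟨T, hT0, hT⟩ := ((eventually_ge_atTop (0 : ℝ)).and
      ((tendsto_lineEntropy o).eventually_ge_atTop h)).exists
    have := intermediate_value_Icc hT0 ((continuousOn_lineEntropy o).mono Set.Icc_subset_Ici_self)
    rw [lineEntropy_zero] at this
    obtain ⟨s, hs, rfl⟩ := this ⟨hh, hT⟩
    exact ⟨s, hs.1, rfl⟩

/-! ### Gaussian asymptotics of the surprisal -/

lemma sq_integral_mul_le {α : Type*} [MeasurableSpace α] {μ : Measure α} {f g : α → ℝ}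
    (hf : Integrable (fun x => f x ^ 2) μ) (hg : Integrable (fun x => g x ^ 2) μ)
    (hfg : Integrable (fun x => f x * g x) μ) :
    (∫ x, f x * g x ∂μ) ^ 2 ≤ (∫ x, f x ^ 2 ∂μ) * ∫ x, g x ^ 2 ∂μ := by
  have h : ∀ t : ℝ, 0 ≤ (∫ x, f x ^ 2 ∂μ) * (t * t) + (2 * ∫ x, f x * g x ∂μ) * t +
      ∫ x, g x ^ 2 ∂μ := by
    intro t
    have h1 : ∫ x, (t * f x + g x) ^ 2 ∂μ = (∫ x, f x ^ 2 ∂μ) * (t * t) +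
        (2 * ∫ x, f x * g x ∂μ) * t + ∫ x, g x ^ 2 ∂μ := by
      have h2 : ∀ x, (t * f x + g x) ^ 2 =
          (t * t) * f x ^ 2 + (2 * t) * (f x * g x) + g x ^ 2 := fun x => by ring
      simp_rw [h2]
      rw [integral_add ((hf.const_mul _).fun_add (hfg.const_mul _)) hg,
        integral_add (hf.const_mul _) (hfg.const_mul _), integral_const_mul, integral_const_mul]
      ring
    rw [← h1]
    exact integral_nonneg fun x => sq_nonneg _
  have := discrim_le_zero h
  rw [discrim] at this
  nlinarith

/-- The difference between the recentred surprisal and the Gaussian surprisal. -/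
noncomputable def surpError (o : CayleyKind) (s : ℝ) (x : ℤ) : ℝ :=
  recSurp o s x - Real.log (2 * Real.pi) / 2 - stdPos o s x ^ 2 / 2

lemma log_two_pi_half : |Real.log (2 * Real.pi) / 2| ≤ 1 := by
  have h3 := Real.pi_gt_three
  have h0 : 0 ≤ Real.log (2 * Real.pi) := Real.log_nonneg (by linarith)
  rw [abs_of_nonneg (by positivity), div_le_one two_pos, Real.log_le_iff_le_exp (by linarith)]
  have h1 : Real.exp 2 = Real.exp 1 * Real.exp 1 := by rw [← Real.exp_add]; norm_num
  have h2 := Real.exp_one_gt_d9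
  have h4 := Real.pi_lt_d2
  nlinarith

lemma surpError_pow_four_le (o : CayleyKind) (s : ℝ) (x : ℤ) :
    surpError o s x ^ 4 ≤ 27 * (|recSurp o s x| ^ 4 + 1 + |stdPos o s x| ^ 8) := by
  set a := recSurp o s x
  set c := Real.log (2 * Real.pi) / 2
  set b := stdPos o s x ^ 2 / 2
  have hc : c ^ 4 ≤ 1 := by
    rw [← (show Even 4 by decide).pow_abs c]
    exact pow_le_one₀ (abs_nonneg _) log_two_pi_half
  have hb : b ^ 4 ≤ |stdPos o s x| ^ 8 := by
    have : |stdPos o s x| ^ 8 = (stdPos o s x ^ 2) ^ 4 := by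
      rw [← sq_abs, ← pow_mul]
    rw [this]
    exact pow_le_pow_left₀ (by positivity) (by simp only [b]; nlinarith [sq_nonneg (stdPos o s x)]) 4
  have ha : |a| ^ 4 = a ^ 4 := by
    rw [show (4 : ℕ) = 2 * 2 from rfl, pow_mul, sq_abs, ← pow_mul]
  rw [ha]
  have h1 : (a - c - b) ^ 2 ≤ 3 * (a ^ 2 + c ^ 2 + b ^ 2) := by
    nlinarith [sq_nonneg (a + c), sq_nonneg (a + b), sq_nonneg (c - b)]
  have h2 : (a ^ 2 + c ^ 2 + b ^ 2) ^ 2 ≤ 3 * (a ^ 4 + c ^ 4 + b ^ 4) := by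
    nlinarith [sq_nonneg (a ^ 2 - c ^ 2), sq_nonneg (a ^ 2 - b ^ 2), sq_nonneg (c ^ 2 - b ^ 2)]
  calc surpError o s x ^ 4 = ((a - c - b) ^ 2) ^ 2 := by rw [surpError, ← pow_mul]
    _ ≤ (3 * (a ^ 2 + c ^ 2 + b ^ 2)) ^ 2 := pow_le_pow_left₀ (sq_nonneg _) h1 2
    _ = 9 * (a ^ 2 + c ^ 2 + b ^ 2) ^ 2 := by ring
    _ ≤ 27 * (a ^ 4 + c ^ 4 + b ^ 4) := by linarith
    _ ≤ _ := by linarith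

lemma integrable_surpError_pow_four (o : CayleyKind) {s : ℝ} (hs : 1 ≤ s) :
    Integrable (fun x => surpError o s x ^ 4) (lineMeasure o s) := by
  refine Integrable.mono' ((((integrable_abs_recSurp_pow o hs 4).add (integrable_const 1)).add
    (integrable_abs_stdPos_pow o (by linarith) 8)).const_mul 27)
    (measurable_of_countable _).aestronglyMeasurable (ae_of_all _ fun x => ?_)
  rw [Real.norm_of_nonneg (by positivity)]
  exact surpError_pow_four_le o s x

lemma integral_surpError_pow_four_le (o : CayleyKind) :
    ∃ C : ℝ, 0 ≤ C ∧ ∀ s, 1 ≤ s → ∫ x, surpError o s x ^ 4 ∂(lineMeasure o s) ≤ C := by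
  refine ⟨27 * (2 ^ 4 * (4 : ℕ).factorial * 7 + 1 + (8 : ℕ).factorial * 6), by positivity,
    fun s hs => ?_⟩
  have h := integral_mono (integrable_surpError_pow_four o hs)
    ((((integrable_abs_recSurp_pow o hs 4).fun_add (integrable_const 1)).fun_add
    (integrable_abs_stdPos_pow o (by linarith) 8)).const_mul 27) (surpError_pow_four_le o s)
  rw [integral_const_mul, integral_add ((integrable_abs_recSurp_pow o hs 4).fun_add
    (integrable_const 1)) (integrable_abs_stdPos_pow o (by linarith) 8),
    integral_add (integrable_abs_recSurp_pow o hs 4) (integrable_const 1)] at h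
  have h1 := integral_abs_recSurp_pow_le o hs 4
  have h2 := integral_abs_stdPos_pow_le o hs 8
  simp only [integral_const, probReal_univ, smul_eq_mul, one_mul] at h
  linarith

lemma integrable_surpError_sq (o : CayleyKind) {s : ℝ} (hs : 1 ≤ s) :
    Integrable (fun x => surpError o s x ^ 2) (lineMeasure o s) := by
  refine Integrable.mono' ((integrable_surpError_pow_four o hs).add (integrable_const 1))
    (measurable_of_countable _).aestronglyMeasurable (ae_of_all _ fun x => ?_)
  rw [Real.norm_of_nonneg (by positivity), Pi.add_apply]
  nlinarith [sq_nonneg (surpError o s x ^ 2 - 1)]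

lemma integrable_surpError (o : CayleyKind) {s : ℝ} (hs : 1 ≤ s) :
    Integrable (surpError o s) (lineMeasure o s) :=
  ((memLp_two_iff_integrable_sq (measurable_of_countable _).aestronglyMeasurable).2
    (integrable_surpError_sq o hs)).integrable one_le_two

lemma gaussDensity_pos (y : ℝ) : 0 < gaussDensity y := by
  have := Real.pi_pos
  unfold gaussDensity
  positivity

lemma gaussDensity_le_of_abs_le {y K : ℝ} (h : |y| ≤ K) : gaussDensity K ≤ gaussDensity y := by
  unfold gaussDensity
  refine mul_le_mul_of_nonneg_left (Real.exp_le_exp.2 ?_) (by positivity)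
  have := sq_le_sq' (by linarith [neg_abs_le y, abs_nonneg y]) ((le_abs_self y).trans h)
  linarith

lemma abs_log_sub_log_le {a b c : ℝ} (hc : 0 < c) (ha : c ≤ a) (hb : c ≤ b) :
    |Real.log a - Real.log b| ≤ |a - b| / c := by
  have hlog : ∀ {a b : ℝ}, c ≤ a → c ≤ b → Real.log a - Real.log b ≤ |a - b| / c := by
    intro a b ha hb
    have ha0 := hc.trans_le ha
    have hb0 := hc.trans_le hb
    rw [← Real.log_div ha0.ne' hb0.ne']
    refine (Real.log_le_sub_one_of_pos (div_pos ha0 hb0)).trans ?_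
    calc a / b - 1 = (a - b) / b := by field_simp
      _ ≤ |a - b| / b := div_le_div_of_nonneg_right (le_abs_self _) hb0.le
      _ ≤ |a - b| / c := div_le_div_of_nonneg_left (abs_nonneg _) hc hb
  rw [abs_le]
  have h1 := hlog ha hb
  have h2 := hlog hb ha
  rw [abs_sub_comm] at h2
  constructor <;> linarith

/-- For `|stdPos| ≤ K` both masses in the local limit theorem are at least `gaussDensity K / 2`, so
their logarithms are close. For `|stdPos| > K`, `K e² ≤ e² |stdPos| ≤ (e⁴ + stdPos²) / 2` leaves
quantities of bounded expectation divided by `K`. -/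
lemma surpError_sq_le (o : CayleyKind) {s K : ℝ} (hs : 0 < s) (hK : 0 < K)
    (he : charError o s ≤ gaussDensity K / 2) {x : ℤ} (hx : 0 < mass o s x) :
    surpError o s x ^ 2 ≤ (2 * charError o s / gaussDensity K) ^ 2 +
      (surpError o s x ^ 4 + |stdPos o s x| ^ 2) / (2 * K) := by
  have hpi := Real.pi_pos
  have hss := Real.sqrt_pos.2 hs
  by_cases hX : |stdPos o s x| ≤ K
  · have hg := gaussDensity_le_of_abs_le hX
    have hl := abs_sqrt_mul_mass_sub_le o hs x
    have hlog : surpError o s x =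
        Real.log (gaussDensity (stdPos o s x)) - Real.log (√s * mass o s x) := by
      rw [gaussDensity, Real.log_mul (by positivity) (by positivity), Real.log_exp, Real.log_inv,
        Real.log_sqrt (by positivity), Real.log_mul hss.ne' hx.ne', Real.log_sqrt hs.le,
        surpError, recSurp, surp]
      ring
    have hgp := gaussDensity_pos K
    have h1 := (abs_le.1 hl).1
    change -charError o s ≤ √s * mass o s x - gaussDensity (stdPos o s x) at h1
    have h2 := abs_log_sub_log_le (half_pos hgp) (a := gaussDensity (stdPos o s x))
      (b := √s * mass o s x) (by linarith) (by linarith)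
    rw [← hlog, abs_sub_comm] at h2
    have h3 : |surpError o s x| ≤ 2 * charError o s / gaussDensity K := by
      refine h2.trans ?_
      rw [div_le_div_iff₀ (by positivity) hgp]
      have : |√s * mass o s x - gaussDensity (stdPos o s x)| ≤ charError o s := hl
      nlinarith
    rw [← sq_abs]
    have h4 := pow_le_pow_left₀ (abs_nonneg _) h3 2
    have h5 : 0 ≤ (surpError o s x ^ 4 + |stdPos o s x| ^ 2) / (2 * K) := by positivity
    linarith
  · push Not at hX
    have h1 : surpError o s x ^ 2 ≤ (surpError o s x ^ 4 + |stdPos o s x| ^ 2) / (2 * K) := by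
      rw [le_div_iff₀ (by positivity)]
      nlinarith [sq_nonneg (surpError o s x ^ 2 - |stdPos o s x|), sq_nonneg (surpError o s x)]
    have := sq_nonneg (2 * charError o s / gaussDensity K)
    linarith

lemma tendsto_integral_surpError_sq (o : CayleyKind) :
    Tendsto (fun s => ∫ x, surpError o s x ^ 2 ∂(lineMeasure o s)) atTop (𝓝 0) := by
  obtain ⟨C, hC0, hC⟩ := integral_surpError_pow_four_le o
  refine (nhds_basis_abs_sub_lt (0 : ℝ)).tendsto_right_iff.2 fun ε hε => ?_
  -- With this truncation level the contribution beyond `K`, at most `(C + 1) / (2 K)`, is `ε / 2`.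
  set K : ℝ := (C + 1) / ε with hK
  have hK0 : 0 < K := by positivity
  have hg := gaussDensity_pos K
  have hch := tendsto_charError o
  have h1 : ∀ᶠ s in atTop, charError o s < gaussDensity K / 2 := hch.eventually_lt_const (by linarith)
  have h2 : Tendsto (fun s => (2 * charError o s / gaussDensity K) ^ 2) atTop (𝓝 0) := by
    simpa using ((hch.const_mul 2).div_const (gaussDensity K)).pow 2
  filter_upwards [h1, h2.eventually_lt_const (half_pos hε), eventually_ge_atTop 1] with s e1 e2 hs
  have hs0 : 0 < s := by linarith
  have i1 := (integrable_surpError_pow_four o hs).fun_add (integrable_abs_stdPos_pow o hs0.le 2)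
  have h3 : ∫ x, surpError o s x ^ 2 ∂(lineMeasure o s) ≤
      ∫ x, ((2 * charError o s / gaussDensity K) ^ 2 +
        (surpError o s x ^ 4 + |stdPos o s x| ^ 2) / (2 * K)) ∂(lineMeasure o s) := by
    refine integral_mono_ae (integrable_surpError_sq o hs)
      ((integrable_const _).add (i1.div_const _)) ?_
    filter_upwards [ae_mass_pos o s] with x hx using surpError_sq_le o hs0 hK0 e1.le hx
  rw [integral_add (integrable_const _) (i1.div_const _), integral_div,
    integral_add (integrable_surpError_pow_four o hs) (integrable_abs_stdPos_pow o hs0.le 2)] at h3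
  simp only [integral_const, probReal_univ, smul_eq_mul, one_mul, sq_abs,
    integral_stdPos_sq o hs0] at h3
  have h4 : (∫ x, surpError o s x ^ 4 ∂(lineMeasure o s) + 1) / (2 * K) ≤ ε / 2 := by
    rw [div_le_iff₀ (by positivity)]
    have : ε / 2 * (2 * K) = C + 1 := by rw [hK]; field_simp
    rw [this]
    linarith [hC s hs]
  have h5 : 0 ≤ ∫ x, surpError o s x ^ 2 ∂(lineMeasure o s) := integral_nonneg fun _ => sq_nonneg _
  rw [sub_zero, abs_of_nonneg h5]
  linarith

lemma integrable_stdPos_sq (o : CayleyKind) {s : ℝ} (hs : 0 ≤ s) :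
    Integrable (fun x => stdPos o s x ^ 2) (lineMeasure o s) := by
  simpa using integrable_abs_stdPos_pow o hs 2

lemma integrable_stdPos_pow_four (o : CayleyKind) {s : ℝ} (hs : 0 ≤ s) :
    Integrable (fun x => stdPos o s x ^ 4) (lineMeasure o s) := by
  refine (integrable_abs_stdPos_pow o hs 4).congr (ae_of_all _ fun x => ?_)
  exact (show Even 4 by decide).pow_abs _

lemma surp_eq_surpError_add (o : CayleyKind) (s : ℝ) (x : ℤ) :
    surp o s x = surpError o s x + (Real.log s / 2 + Real.log (2 * Real.pi) / 2 +
      stdPos o s x ^ 2 / 2) := by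
  rw [surpError, recSurp]
  ring

lemma lineEntropy_eq_add_error (o : CayleyKind) {s : ℝ} (hs : 1 ≤ s) :
    lineEntropy o s = ∫ x, surpError o s x ∂(lineMeasure o s) +
      (Real.log s / 2 + Real.log (2 * Real.pi) / 2 + 1 / 2) := by
  have hs0 : 0 < s := by linarith
  have i2 := (integrable_stdPos_sq o hs0.le).div_const 2
  rw [lineEntropy]
  simp_rw [surp_eq_surpError_add]
  rw [integral_add (integrable_surpError o hs) ((integrable_const _).fun_add i2),
    integral_add (integrable_const _) i2, integral_div, integral_stdPos_sq o hs0]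
  simp

lemma sq_integral_surpError_le (o : CayleyKind) {s : ℝ} (hs : 1 ≤ s) :
    (∫ x, surpError o s x ∂(lineMeasure o s)) ^ 2 ≤
      ∫ x, surpError o s x ^ 2 ∂(lineMeasure o s) := by
  have h := sq_integral_mul_le (μ := lineMeasure o s) (f := surpError o s) (g := fun _ => 1)
    (integrable_surpError_sq o hs) (by simp) (by simpa using integrable_surpError o hs)
  simpa using h

lemma tendsto_integral_surpError (o : CayleyKind) :
    Tendsto (fun s => ∫ x, surpError o s x ∂(lineMeasure o s)) atTop (𝓝 0) := by
  have h1 : Tendsto (fun s => √(∫ x, surpError o s x ^ 2 ∂(lineMeasure o s))) atTop (𝓝 0) := by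
    simpa using (tendsto_integral_surpError_sq o).sqrt
  refine squeeze_zero_norm' ?_ h1
  filter_upwards [eventually_ge_atTop 1] with s hs
  exact Real.abs_le_sqrt (sq_integral_surpError_le o hs)

/-- The entropy is asymptotically that of a Gaussian of variance `s`. -/
lemma tendsto_lineEntropy_sub (o : CayleyKind) :
    Tendsto (fun s => lineEntropy o s - (Real.log s / 2 + Real.log (2 * Real.pi) / 2 + 1 / 2))
      atTop (𝓝 0) := by
  refine (tendsto_integral_surpError o).congr' ?_
  filter_upwards [eventually_ge_atTop 1] with s hs
  rw [lineEntropy_eq_add_error o hs]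
  ring

/-- The centred surprisal is the centred error plus `(Y² - 1) / 2`, with `Y` the standardized
position. The second part has variance `(E Y⁴ - 1) / 4 = 1 / 2 + 1 / (4 s)`, and Cauchy–Schwarz
bounds the cross term. -/
lemma abs_lineVar_sub_le (o : CayleyKind) {s : ℝ} (hs : 1 ≤ s) :
    |lineVar o s - 1 / 2| ≤ 2 * ∫ x, surpError o s x ^ 2 ∂(lineMeasure o s) +
      2 * √(∫ x, surpError o s x ^ 2 ∂(lineMeasure o s)) + 1 / (4 * s) := by
  have hs0 : 0 < s := by linarith
  set m := ∫ x, surpError o s x ^ 2 ∂(lineMeasure o s) with hm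
  have hm0 : 0 ≤ m := integral_nonneg fun _ => sq_nonneg _
  set b : ℤ → ℝ := fun x => (stdPos o s x ^ 2 - 1) / 2 with hb
  have ib2 : Integrable (fun x => b x ^ 2) (lineMeasure o s) := by
    have : ∀ x, b x ^ 2 = stdPos o s x ^ 4 / 4 - stdPos o s x ^ 2 / 2 + 1 / 4 := fun x => by
      simp only [hb]; ring
    simp_rw [this]
    exact (((integrable_stdPos_pow_four o hs0.le).div_const 4).sub
      ((integrable_stdPos_sq o hs0.le).div_const 2)).add (integrable_const _)
  have hb2 : ∫ x, b x ^ 2 ∂(lineMeasure o s) = 1 / 2 + 1 / (4 * s) := by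
    have : ∀ x, b x ^ 2 = stdPos o s x ^ 4 / 4 - stdPos o s x ^ 2 / 2 + 1 / 4 := fun x => by
      simp only [hb]; ring
    simp_rw [this]
    rw [integral_add (integrable_fun_sub ((integrable_stdPos_pow_four o hs0.le).div_const 4)
      ((integrable_stdPos_sq o hs0.le).div_const 2)) (integrable_const _),
      integral_sub ((integrable_stdPos_pow_four o hs0.le).div_const 4)
      ((integrable_stdPos_sq o hs0.le).div_const 2), integral_div, integral_div,
      integral_stdPos_sq o hs0, integral_stdPos_pow_four o hs0]
    simp
    field_simp
    ring
  have iab : Integrable (fun x => surpError o s x * b x) (lineMeasure o s) := by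
    refine Integrable.mono' ((integrable_surpError_sq o hs).add ib2)
      (measurable_of_countable _).aestronglyMeasurable (ae_of_all _ fun x => ?_)
    rw [Real.norm_eq_abs, Pi.add_apply, abs_le]
    constructor <;> nlinarith [sq_nonneg (surpError o s x + b x), sq_nonneg (surpError o s x - b x)]
  have hcs := sq_integral_mul_le (integrable_surpError_sq o hs) ib2 iab
  rw [← hm, hb2] at hcs
  set ab := ∫ x, surpError o s x * b x ∂(lineMeasure o s)
  set a := ∫ x, surpError o s x ∂(lineMeasure o s) with ha
  have hvar : lineVar o s = m + 2 * ab + (1 / 2 + 1 / (4 * s)) - a ^ 2 := by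
    rw [lineVar, variance_eq_integral (measurable_of_countable _).aemeasurable]
    change ∫ x, (surp o s x - lineEntropy o s) ^ 2 ∂(lineMeasure o s) = _
    have h1 : ∀ x, (surp o s x - lineEntropy o s) ^ 2 =
        (surpError o s x ^ 2 + 2 * (surpError o s x * b x) + b x ^ 2) -
        (2 * a * (surpError o s x + b x) - a ^ 2) := by
      intro x
      rw [lineEntropy_eq_add_error o hs, surp_eq_surpError_add]
      simp only [hb, ← ha]
      ring
    have ib : Integrable b (lineMeasure o s) :=
      ((integrable_stdPos_sq o hs0.le).sub (integrable_const _)).div_const 2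
    have hb1 : ∫ x, b x ∂(lineMeasure o s) = 0 := by
      simp only [hb]
      rw [integral_div, integral_sub (integrable_stdPos_sq o hs0.le) (integrable_const _),
        integral_stdPos_sq o hs0]
      simp
    simp_rw [h1]
    rw [integral_sub (((integrable_surpError_sq o hs).fun_add (iab.const_mul 2)).fun_add ib2)
      (integrable_fun_sub (((integrable_surpError o hs).fun_add ib).const_mul _)
        (integrable_const _)),
      integral_add ((integrable_surpError_sq o hs).fun_add (iab.const_mul 2)) ib2,
      integral_add (integrable_surpError_sq o hs) (iab.const_mul 2),
      integral_sub (((integrable_surpError o hs).fun_add ib).const_mul _) (integrable_const _),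
      integral_const_mul, integral_const_mul, integral_add (integrable_surpError o hs) ib, hb1, hb2]
    simp only [integral_const, probReal_univ, smul_eq_mul, one_mul, ← ha, ← hm]
    ring
  have ha2 : a ^ 2 ≤ m := sq_integral_surpError_le o hs
  have hab : |ab| ≤ √m := by
    refine Real.abs_le_sqrt (hcs.trans (mul_le_of_le_one_right hm0 ?_))
    have : 1 / (4 * s) ≤ 1 / 4 := by
      apply div_le_div_of_nonneg_left <;> linarith
    linarith
  have h4 : 0 ≤ 1 / (4 * s) := by positivity
  obtain ⟨h5, h6⟩ := abs_le.1 hab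
  rw [hvar, abs_le]
  constructor <;> nlinarith [sq_nonneg a, Real.sqrt_nonneg m]

lemma tendsto_lineVar (o : CayleyKind) : Tendsto (lineVar o) atTop (𝓝 (1 / 2)) := by
  rw [tendsto_iff_norm_sub_tendsto_zero]
  have h := tendsto_integral_surpError_sq o
  have h1 : Tendsto (fun s : ℝ => 2 * ∫ x, surpError o s x ^ 2 ∂(lineMeasure o s) +
      2 * √(∫ x, surpError o s x ^ 2 ∂(lineMeasure o s)) + 1 / (4 * s)) atTop (𝓝 0) := by
    have h2 : Tendsto (fun s : ℝ => 1 / (4 * s)) atTop (𝓝 0) :=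
      tendsto_const_nhds.div_atTop (tendsto_id.const_mul_atTop (by norm_num))
    simpa using ((h.const_mul 2).add (h.sqrt.const_mul 2)).add h2
  refine squeeze_zero' (Eventually.of_forall fun _ => norm_nonneg _) ?_ h1
  filter_upwards [eventually_ge_atTop 1] with s hs using abs_lineVar_sub_le o hs

/-! ### Lower bound and regularity of the varentropy -/

lemma natCast_mem_support_discreteWalk {p : PMF ℤ} (hp : 1 ∈ p.support) (n : ℕ) :
    (n : ℤ) ∈ (discreteWalk p n).support := by
  induction n with
  | zero => simp [discreteWalk]
  | succ n ih =>
    rw [discreteWalk, PMF.mem_support_bind_iff]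
    refine ⟨n, ih, ?_⟩
    rw [PMF.mem_support_map_iff]
    exact ⟨1, hp, by push_cast; rfl⟩

lemma mass_natCast_pos (o : CayleyKind) {s : ℝ} (hs : 0 < s) (n : ℕ) : 0 < mass o s n := by
  refine ENNReal.toReal_pos ?_ (PMF.apply_ne_top _ _)
  rw [← PMF.mem_support_iff, lineLaw, walkLaw, PMF.mem_support_bind_iff]
  refine ⟨n, ?_, natCast_mem_support_discreteWalk ?_ n⟩
  · rw [PMF.mem_support_iff, Measure.toPMF_apply, poissonMeasure_singleton]
    have : 0 < s.toNNReal := by simpa using hs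
    have : (0 : ℝ) < s.toNNReal := by exact_mod_cast this
    simp only [ne_eq, ENNReal.ofReal_eq_zero, not_le]
    positivity
  · cases o
    · rw [stepLaw, PMF.mem_support_map_iff]
      exact ⟨0, by simp, rfl⟩
    · rw [stepLaw, PMF.mem_support_map_iff]
      exact ⟨(0, true), by simp, rfl⟩

/-- Zero variance would make the mass constant on its support, which contains every natural number;
a constant positive mass there is not summable. -/
lemma lineVar_pos (o : CayleyKind) {s : ℝ} (hs : 0 < s) : 0 < lineVar o s := by
  refine (variance_nonneg _ _).lt_of_ne fun h => ?_
  have hv := (memLp_surp o hs.le).ofReal_variance_eq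
  rw [← h, ENNReal.ofReal_zero] at hv
  have h2 := (evariance_eq_zero_iff (measurable_of_countable _).aemeasurable).1 hv.symm
  rw [Filter.EventuallyEq, ae_iff_of_countable] at h2
  have h3 : ∀ n : ℕ, mass o s n = Real.exp (-lineEntropy o s) := by
    intro n
    have hp := mass_natCast_pos o hs n
    have := h2 n (by rw [lineMeasure_singleton]; simpa using hp)
    rw [surp] at this
    change -Real.log (mass o s n) = lineEntropy o s at this
    rw [← this, neg_neg, Real.exp_log hp]
  have h4 : Tendsto (fun n : ℕ => mass o s n) atTop (𝓝 0) :=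
    ((summable_mass o s).comp_injective Nat.cast_injective).tendsto_atTop_zero
  simp_rw [h3] at h4
  exact (Real.exp_pos _).ne' (tendsto_nhds_unique tendsto_const_nhds h4)

lemma exists_lineVar_ge (o : CayleyKind) : ∃ c : ℝ, 0 < c ∧ ∀ s, 1 ≤ s → c ≤ lineVar o s := by
  obtain ⟨T', hT'⟩ := eventually_atTop.1 ((tendsto_lineVar o).eventually_const_le
    (by norm_num : (1 / 4 : ℝ) < 1 / 2))
  set T := max T' 1
  have hT1 : 1 ≤ T := le_max_right _ _
  have hT : ∀ s, T ≤ s → 1 / 4 ≤ lineVar o s := fun s hs => hT' s ((le_max_left _ _).trans hs)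
  obtain ⟨m, hm, hmin⟩ := isCompact_Icc.exists_isMinOn (Set.nonempty_Icc.2 hT1)
    ((continuousOn_lineVar o).mono fun s hs => (zero_le_one.trans hs.1 : (0 : ℝ) ≤ s))
  refine ⟨min (lineVar o m) (1 / 4), lt_min (lineVar_pos o (by linarith [hm.1])) (by norm_num),
    fun s hs => ?_⟩
  rcases le_total s T with h | h
  · exact (min_le_left _ _).trans (hmin ⟨hs, h⟩)
  · exact (min_le_right _ _).trans (hT s h)

/-- In the variable `log s` the varentropy is uniformly continuous on `[0, ∞)`, being continuous
with a limit at infinity. Ratios tending to one are logarithmic differences tending to zero, and the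
positive lower bound `c` turns differences of varentropies into ratios. -/
lemma tendsto_lineVar_div (o : CayleyKind) {ι : Type*} {l : Filter ι} {a b : ι → ℝ}
    (ha : ∀ᶠ i in l, 1 ≤ a i) (hb : ∀ᶠ i in l, 1 ≤ b i)
    (hab : Tendsto (fun i => b i / a i) l (𝓝 1)) :
    Tendsto (fun i => lineVar o (b i) / lineVar o (a i)) l (𝓝 1) := by
  obtain ⟨c, hc, hcV⟩ := exists_lineVar_ge o
  set g : ℝ → ℝ := fun u => lineVar o (Real.exp |u|) with hg
  have hgc : Continuous g := (continuousOn_lineVar o).comp_continuous (by fun_prop)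
    fun u => (Real.exp_pos _).le
  have hgt : Tendsto g (cocompact ℝ) (𝓝 (1 / 2)) := by
    have h1 : Tendsto (fun u : ℝ => |u|) (cocompact ℝ) atTop := tendsto_norm_cocompact_atTop
    exact (tendsto_lineVar o).comp (Real.tendsto_exp_atTop.comp h1)
  have hgu := hgc.uniformContinuous_of_tendsto_cocompact hgt
  have hlog : Tendsto (fun i => Real.log (b i) - Real.log (a i)) l (𝓝 0) := by
    have h1 := ((Real.continuousAt_log one_ne_zero).tendsto.comp hab)
    rw [Real.log_one] at h1
    refine h1.congr' ?_
    filter_upwards [ha, hb] with i h1 h2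
    exact Real.log_div (by linarith) (by linarith)
  have hdiff : Tendsto (fun i => lineVar o (b i) - lineVar o (a i)) l (𝓝 0) := by
    rw [Metric.uniformContinuous_iff] at hgu
    refine (nhds_basis_abs_sub_lt (0 : ℝ)).tendsto_right_iff.2 fun ε hε => ?_
    obtain ⟨δ, hδ, h⟩ := hgu ε hε
    filter_upwards [ha, hb, (nhds_basis_abs_sub_lt (0 : ℝ)).tendsto_right_iff.1 hlog δ hδ]
      with i h1 h2 h3
    have h4 := @h (Real.log (b i)) (Real.log (a i)) (by rwa [Real.dist_eq, ← sub_zero (_ - _)])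
    simp only [hg] at h4
    rw [abs_of_nonneg (Real.log_nonneg h1), abs_of_nonneg (Real.log_nonneg h2),
      Real.exp_log (by linarith), Real.exp_log (by linarith), Real.dist_eq] at h4
    rwa [sub_zero]
  rw [tendsto_iff_norm_sub_tendsto_zero]
  have h5 : Tendsto (fun i => |lineVar o (b i) - lineVar o (a i)| / c) l (𝓝 0) := by
    simpa using hdiff.abs.div_const c
  refine squeeze_zero' (Eventually.of_forall fun _ => norm_nonneg _) ?_ h5
  filter_upwards [ha] with i h1
  have h2 := hcV _ h1
  have h3 : 0 < lineVar o (a i) := hc.trans_le h2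
  rw [div_sub_one h3.ne', norm_div, Real.norm_eq_abs, Real.norm_of_nonneg h3.le]
  exact div_le_div_of_nonneg_left (abs_nonneg _) hc h2

/-- The centred surprisal has a bounded third absolute moment. -/
lemma exists_integral_abs_surp_sub_pow_three_le (o : CayleyKind) :
    ∃ C : ℝ, 0 ≤ C ∧ ∀ s, 1 ≤ s →
      Integrable (fun x => |surp o s x - lineEntropy o s| ^ 3) (lineMeasure o s) ∧
      ∫ x, |surp o s x - lineEntropy o s| ^ 3 ∂(lineMeasure o s) ≤ C := by
  refine ⟨4 * (2 ^ 3 * (3 : ℕ).factorial * 7) + 4 * (14 : ℝ) ^ 3, by positivity, fun s hs => ?_⟩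
  have hs0 : 0 < s := by linarith
  have i1 : Integrable (fun x => |recSurp o s x|) (lineMeasure o s) := by
    simpa using integrable_abs_recSurp_pow o hs 1
  have hm : |lineEntropy o s - Real.log s / 2| ≤ 14 := by
    have h1 : lineEntropy o s - Real.log s / 2 = ∫ x, recSurp o s x ∂(lineMeasure o s) := by
      simp only [recSurp]
      rw [integral_sub (integrable_surp o hs0.le) (integrable_const _)]
      simp [lineEntropy]
    rw [h1]
    refine (abs_integral_le_integral_abs).trans ?_
    have := integral_abs_recSurp_pow_le o hs 1
    simp only [pow_one, Nat.factorial_one, Nat.cast_one, mul_one] at this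
    linarith
  have hle : ∀ x, |surp o s x - lineEntropy o s| ^ 3 ≤
      4 * |recSurp o s x| ^ 3 + 4 * (14 : ℝ) ^ 3 := by
    intro x
    have h1 : |surp o s x - lineEntropy o s| ≤ |recSurp o s x| + 14 := by
      have : surp o s x - lineEntropy o s =
          recSurp o s x - (lineEntropy o s - Real.log s / 2) := by rw [recSurp]; ring
      rw [this]
      exact (abs_sub _ _).trans (by linarith)
    refine (pow_le_pow_left₀ (abs_nonneg _) h1 3).trans ?_
    have h0 := abs_nonneg (recSurp o s x)
    nlinarith [mul_nonneg (add_nonneg h0 (by norm_num : (0 : ℝ) ≤ 14))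
      (sq_nonneg (|recSurp o s x| - 14))]
  have i3 := ((integrable_abs_recSurp_pow o hs 3).const_mul 4)
  have i4 : Integrable (fun x => |surp o s x - lineEntropy o s| ^ 3) (lineMeasure o s) := by
    refine Integrable.mono' (i3.add (integrable_const (4 * (14 : ℝ) ^ 3)))
      (measurable_of_countable _).aestronglyMeasurable (ae_of_all _ fun x => ?_)
    rw [Real.norm_of_nonneg (by positivity)]
    exact hle x
  refine ⟨i4, (integral_mono i4 (i3.fun_add (integrable_const _)) hle).trans ?_⟩
  rw [integral_add i3 (integrable_const _), integral_const_mul]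
  have := integral_abs_recSurp_pow_le o hs 3
  simp only [integral_const, probReal_univ, smul_eq_mul, one_mul]
  linarith

/-! ### Central limit theorem for triangular rows -/

lemma norm_pow_sub_pow_le {z w : ℂ} (hz : ‖z‖ ≤ 1) (hw : ‖w‖ ≤ 1) (n : ℕ) :
    ‖z ^ n - w ^ n‖ ≤ n * ‖z - w‖ := by
  induction n with
  | zero => simp
  | succ n ih =>
    have h : z ^ (n + 1) - w ^ (n + 1) = z * (z ^ n - w ^ n) + (z - w) * w ^ n := by ring
    have h1 : ‖z * (z ^ n - w ^ n)‖ ≤ n * ‖z - w‖ := by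
      rw [norm_mul]
      exact (mul_le_of_le_one_left (norm_nonneg _) hz).trans ih
    have h2 : ‖(z - w) * w ^ n‖ ≤ ‖z - w‖ := by
      rw [norm_mul, norm_pow]
      exact mul_le_of_le_one_right (norm_nonneg _) (pow_le_one₀ (norm_nonneg _) hw)
    rw [h]
    push_cast
    linarith [norm_add_le (z * (z ^ n - w ^ n)) ((z - w) * w ^ n)]

section Triangular

variable {μ : Measure ℤ} [IsProbabilityMeasure μ] {g : ℤ → ℝ}

lemma norm_integral_exp_sub_le (h1 : Integrable g μ) (h2 : Integrable (fun x => g x ^ 2) μ)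
    (h3 : Integrable (fun x => |g x| ^ 3) μ) (hm : ∫ x, g x ∂μ = 0) (hv : ∫ x, g x ^ 2 ∂μ = 1)
    (u : ℝ) :
    ‖∫ x, Complex.exp ((u * g x : ℝ) * Complex.I) ∂μ - (1 - (u : ℂ) ^ 2 / 2)‖ ≤
      4 * |u| ^ 3 * ∫ x, |g x| ^ 3 ∂μ := by
  have ie : Integrable (fun x => Complex.exp ((u * g x : ℝ) * Complex.I)) μ := by
    refine Integrable.mono' (integrable_const (1 : ℝ))
      (measurable_of_countable _).aestronglyMeasurable (ae_of_all _ fun x => ?_)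
    rw [Complex.norm_exp_ofReal_mul_I]
  have i1 : Integrable (fun x => ((u * g x : ℝ) : ℂ) * Complex.I) μ :=
    ((h1.const_mul u).ofReal).mul_const _
  have i2 : Integrable (fun x => ((u * g x : ℝ) : ℂ) ^ 2 / 2) μ := by
    refine (((h2.const_mul (u ^ 2)).ofReal (𝕜 := ℂ)).div_const 2).congr (ae_of_all _ fun x => ?_)
    push_cast
    simp only [Complex.coe_algebraMap]
    simp
    ring
  have e1 : ∫ x, ((u * g x : ℝ) : ℂ) * Complex.I ∂μ = 0 := by
    rw [integral_mul_const, integral_complex_ofReal, integral_const_mul, hm]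
    simp
  have e2 : ∫ x, ((u * g x : ℝ) : ℂ) ^ 2 / 2 ∂μ = (u : ℂ) ^ 2 / 2 := by
    have : ∀ x, ((u * g x : ℝ) : ℂ) ^ 2 / 2 = ((u ^ 2 / 2 * g x ^ 2 : ℝ) : ℂ) := fun x => by
      push_cast; ring
    simp only [this]
    rw [integral_complex_ofReal, integral_const_mul, hv]
    push_cast
    ring
  have e : ∫ x, Complex.exp ((u * g x : ℝ) * Complex.I) ∂μ - (1 - (u : ℂ) ^ 2 / 2) =
      ∫ x, (Complex.exp ((u * g x : ℝ) * Complex.I) - 1 - ((u * g x : ℝ) : ℂ) * Complex.I +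
        ((u * g x : ℝ) : ℂ) ^ 2 / 2) ∂μ := by
    have i0 : Integrable (fun x => Complex.exp ((u * g x : ℝ) * Complex.I) - 1) μ :=
      ie.sub (integrable_const 1)
    have i01 : Integrable (fun x => Complex.exp ((u * g x : ℝ) * Complex.I) - 1 -
      ((u * g x : ℝ) : ℂ) * Complex.I) μ := i0.sub i1
    rw [integral_add i01 i2, integral_sub i0 i1,
      integral_sub ie (integrable_const 1), e1, e2]
    simp
    ring
  rw [e, mul_assoc, ← integral_const_mul, ← integral_const_mul]
  refine norm_integral_le_of_norm_le ((h3.const_mul _).const_mul _) (ae_of_all _ fun x => ?_)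
  refine (norm_exp_I_sub_taylor_two (u * g x)).trans_eq ?_
  rw [abs_mul, mul_pow]

lemma charFun_normalized_sum (k : ℕ) (ξ : ℝ) :
    charFun ((Measure.pi fun _ : Fin k => μ).map fun w => (∑ i, g (w i)) / √k) ξ =
      (∫ x, Complex.exp ((ξ / √k * g x : ℝ) * Complex.I) ∂μ) ^ k := by
  rw [charFun_apply_real, integral_map (measurable_of_countable _).aemeasurable
    (by fun_prop)]
  rw [← Fintype.card_fin k, ← integral_fintype_prod_eq_pow, Fintype.card_fin]
  refine integral_congr_ae (ae_of_all _ fun w => ?_)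
  simp only
  rw [← Complex.exp_sum, ← Finset.sum_mul]
  congr 2
  push_cast
  rw [Finset.sum_div, Finset.mul_sum]
  exact Finset.sum_congr rfl fun i _ => by ring

/-- On the unit disc `|z^k - w^k| ≤ k |z - w|`, so it is enough to compare one factor of each kind
with `1 - u² / 2` at `u = ξ / √k`. The assumption `ξ² ≤ k` keeps `u² / 2` in the range of the
quadratic estimate for the exponential. -/
lemma norm_charFun_normalized_sum_sub_le (h1 : Integrable g μ)
    (h2 : Integrable (fun x => g x ^ 2) μ)
    (h3 : Integrable (fun x => |g x| ^ 3) μ) (hm : ∫ x, g x ∂μ = 0) (hv : ∫ x, g x ^ 2 ∂μ = 1)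
    {C : ℝ} (hC : ∫ x, |g x| ^ 3 ∂μ ≤ C) {k : ℕ} (hk : 0 < k) {ξ : ℝ} (hξ : ξ ^ 2 ≤ k) :
    ‖charFun ((Measure.pi fun _ : Fin k => μ).map fun w => (∑ i, g (w i)) / √k) ξ -
      charFun (gaussianReal 0 1) ξ‖ ≤ 4 * |ξ| ^ 3 * C / √k + ξ ^ 4 / (4 * k) := by
  have hk0 : (0 : ℝ) < k := by exact_mod_cast hk
  have hsk : 0 < √(k : ℝ) := Real.sqrt_pos.2 hk0
  have hsq : √(k : ℝ) ^ 2 = k := Real.sq_sqrt hk0.le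
  set u := ξ / √k with hu
  have hu2 : u ^ 2 = ξ ^ 2 / k := by rw [hu, div_pow, hsq]
  have hg : charFun (gaussianReal 0 1) ξ = ((Real.exp (-(u ^ 2 / 2)) : ℝ) : ℂ) ^ k := by
    rw [charFun_gaussianReal, ← Complex.ofReal_pow _ k, ← Real.exp_nat_mul, hu2]
    push_cast
    congr 1
    have : (k : ℂ) ≠ 0 := by exact_mod_cast hk.ne'
    field_simp
    simp
    ring
  have hw : ‖((Real.exp (-(u ^ 2 / 2)) : ℝ) : ℂ)‖ ≤ 1 := by
    rw [Complex.norm_real, Real.norm_of_nonneg (Real.exp_pos _).le, Real.exp_le_one_iff]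
    nlinarith [sq_nonneg u]
  have hz : ‖∫ x, Complex.exp ((u * g x : ℝ) * Complex.I) ∂μ‖ ≤ 1 := by
    refine (norm_integral_le_of_norm_le (integrable_const (1 : ℝ)) (ae_of_all _ fun x => ?_)).trans
      (by simp)
    rw [Complex.norm_exp_ofReal_mul_I]
  have hd1 := norm_integral_exp_sub_le h1 h2 h3 hm hv u
  have hu1 : |-(u ^ 2 / 2)| ≤ 1 := by
    rw [abs_neg, abs_of_nonneg (by positivity), hu2]
    have : ξ ^ 2 / k ≤ 1 := (div_le_one hk0).2 hξ
    linarith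
  have hd2 : ‖(1 - (u : ℂ) ^ 2 / 2) - ((Real.exp (-(u ^ 2 / 2)) : ℝ) : ℂ)‖ ≤ u ^ 4 / 4 := by
    have h := Real.abs_exp_sub_one_sub_id_le hu1
    rw [show (1 - (u : ℂ) ^ 2 / 2) - ((Real.exp (-(u ^ 2 / 2)) : ℝ) : ℂ) =
      ((-(Real.exp (-(u ^ 2 / 2)) - 1 - -(u ^ 2 / 2)) : ℝ) : ℂ) by push_cast; ring,
      Complex.norm_real, Real.norm_eq_abs, abs_neg]
    exact h.trans_eq (by ring)
  rw [charFun_normalized_sum, ← hu, hg]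
  refine (norm_pow_sub_pow_le hz hw k).trans ?_
  have hd3 : ‖∫ x, Complex.exp ((u * g x : ℝ) * Complex.I) ∂μ -
      ((Real.exp (-(u ^ 2 / 2)) : ℝ) : ℂ)‖ ≤ 4 * |u| ^ 3 * C + u ^ 4 / 4 := by
    refine (norm_sub_le_norm_sub_add_norm_sub _ (1 - (u : ℂ) ^ 2 / 2) _).trans ?_
    have : 4 * |u| ^ 3 * ∫ x, |g x| ^ 3 ∂μ ≤ 4 * |u| ^ 3 * C := by gcongr
    linarith
  refine (mul_le_mul_of_nonneg_left hd3 hk0.le).trans_eq ?_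
  have ha : |u| = |ξ| / √k := by rw [hu, abs_div, abs_of_pos hsk]
  have h4 : u ^ 4 = ξ ^ 4 / k ^ 2 := by
    rw [show u ^ 4 = (u ^ 2) ^ 2 by ring, hu2]; ring
  have hs3 : √(k : ℝ) ^ 3 = k * √k := by rw [pow_succ, hsq]
  rw [ha, h4, div_pow, hs3]
  field_simp

end Triangular

/-- The central limit theorem for rows of independent, identically distributed variables with
uniformly bounded third moments. -/
lemma tendsto_charFun_normalized_sum {k : ℕ → ℕ} (hk : Tendsto k atTop atTop)
    {μ : ℕ → Measure ℤ} [∀ N, IsProbabilityMeasure (μ N)] {g : ℕ → ℤ → ℝ} {C : ℝ}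
    (h1 : ∀ N, Integrable (g N) (μ N)) (h2 : ∀ N, Integrable (fun x => g N x ^ 2) (μ N))
    (h3 : ∀ N, Integrable (fun x => |g N x| ^ 3) (μ N)) (hm : ∀ N, ∫ x, g N x ∂(μ N) = 0)
    (hv : ∀ N, ∫ x, g N x ^ 2 ∂(μ N) = 1) (hC : ∀ N, ∫ x, |g N x| ^ 3 ∂(μ N) ≤ C) (ξ : ℝ) :
    Tendsto (fun N => charFun ((Measure.pi fun _ : Fin (k N) => μ N).map
      fun w => (∑ i, g N (w i)) / √(k N)) ξ) atTop (𝓝 (charFun (gaussianReal 0 1) ξ)) := by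
  have hkr : Tendsto (fun N => (k N : ℝ)) atTop atTop := tendsto_natCast_atTop_atTop.comp hk
  rw [tendsto_iff_norm_sub_tendsto_zero]
  have hlim : Tendsto (fun N => 4 * |ξ| ^ 3 * C / √(k N) + ξ ^ 4 / (4 * k N)) atTop (𝓝 0) := by
    have a := (Real.tendsto_sqrt_atTop.comp hkr).const_div_atTop (4 * |ξ| ^ 3 * C)
    have b := (hkr.const_mul_atTop (by norm_num : (0 : ℝ) < 4)).const_div_atTop (ξ ^ 4)
    simpa using a.add b
  refine squeeze_zero' (Eventually.of_forall fun _ => norm_nonneg _) ?_ hlim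
  filter_upwards [hkr.eventually_ge_atTop (ξ ^ 2), hk.eventually_gt_atTop 0] with N hN hN0
  exact norm_charFun_normalized_sum_sub_le (h1 N) (h2 N) (h3 N) (hm N) (hv N) (hC N) hN0 hN

/-! ### The Gaussian tail -/

lemma Psi_eq_one_sub_cdf (a : ℝ) : Psi a = 1 - cdf (gaussianReal 0 1) a := by
  rw [cdf_eq_real, Psi, ← Set.compl_Iic, probReal_compl_eq_one_sub measurableSet_Iic]

lemma Psi_sub_Psi {a b : ℝ} (h : a ≤ b) : Psi a - Psi b = (gaussianReal 0 1).real (Set.Ioc a b) := by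
  rw [Psi, Psi, ← Set.Ioc_union_Ioi_eq_Ioi h, measureReal_union _ measurableSet_Ioi]
  · ring
  · exact Set.Ioc_disjoint_Ioi le_rfl

lemma Psi_antitone : Antitone Psi := fun a b h => by
  linarith [Psi_sub_Psi h, measureReal_nonneg (μ := gaussianReal 0 1) (s := Set.Ioc a b)]

lemma Psi_strictAnti : StrictAnti Psi := fun a b h => by
  have h1 := Psi_sub_Psi h.le
  have h2 : 0 < (gaussianReal 0 1).real (Set.Ioc a b) := by
    refine ENNReal.toReal_pos (fun h0 => ?_) (measure_ne_top _ _)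
    have := gaussianReal_absolutelyContinuous' 0 one_ne_zero h0
    rw [Real.volume_Ioc, ENNReal.ofReal_eq_zero] at this
    linarith
  linarith

lemma Psi_sub_le {a b : ℝ} (h : a ≤ b) : Psi a - Psi b ≤ b - a := by
  rw [Psi_sub_Psi h]
  refine ENNReal.toReal_le_of_le_ofReal (by linarith) ?_
  rw [gaussianReal_apply _ one_ne_zero, ← Real.volume_Ioc, ← setLIntegral_one]
  refine lintegral_mono fun x => ?_
  rw [gaussianPDF, ENNReal.ofReal_le_one, gaussianPDFReal]
  refine mul_le_one₀ (inv_le_one_of_one_le₀ ?_) (Real.exp_pos _).le ?_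
  · rw [Real.one_le_sqrt]
    have := Real.pi_gt_three
    simp
    linarith
  · rw [Real.exp_le_one_iff]
    exact div_nonpos_of_nonpos_of_nonneg (by nlinarith [sq_nonneg (x - 0)]) (by simp)

lemma continuous_Psi : Continuous Psi := by
  refine continuous_iff_continuousAt.2 fun a => ?_
  refine tendsto_iff_norm_sub_tendsto_zero.2 (squeeze_zero (fun _ => norm_nonneg _)
    (g := fun x => ‖x - a‖) (fun x => ?_) ?_)
  · rcases le_total x a with h | h
    · rw [Real.norm_of_nonneg (by linarith [Psi_antitone h]), Real.norm_of_nonpos (by linarith)]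
      linarith [Psi_sub_le h]
    · rw [Real.norm_of_nonpos (by linarith [Psi_antitone h]), Real.norm_of_nonneg (by linarith)]
      linarith [Psi_sub_le h]
  · exact tendsto_iff_norm_sub_tendsto_zero.1 tendsto_id

lemma tendsto_Psi_atTop : Tendsto Psi atTop (𝓝 0) := by
  simpa [← Psi_eq_one_sub_cdf] using (tendsto_cdf_atTop (gaussianReal 0 1)).const_sub 1

lemma tendsto_Psi_atBot : Tendsto Psi atBot (𝓝 1) := by
  simpa [← Psi_eq_one_sub_cdf] using (tendsto_cdf_atBot (gaussianReal 0 1)).const_sub 1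

lemma Psi_neg (a : ℝ) : Psi (-a) = 1 - Psi a := by
  have h : Psi (-a) = (gaussianReal 0 1).real (Set.Iio a) := by
    have h0 : gaussianReal 0 1 = (gaussianReal 0 1).map (fun x => -x) := by
      rw [gaussianReal_map_neg, neg_zero]
    rw [Psi]
    nth_rw 1 [h0]
    rw [map_measureReal_apply measurable_neg measurableSet_Ioi]
    congr 1
    ext x
    simp
  have := nullSingletonClass_gaussianReal (μ := 0) (one_ne_zero (α := ℝ≥0))
  rw [h, Psi_eq_one_sub_cdf, cdf_eq_real, sub_sub_cancel]
  exact measureReal_congr Iio_ae_eq_Iic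

lemma Psi_zero : Psi 0 = 1 / 2 := by
  have := Psi_neg 0
  rw [neg_zero] at this
  linarith

lemma exists_Psi_eq {ε : ℝ} (h0 : 0 < ε) (h1 : ε < 1) : ∃ a, Psi a = ε := by
  obtain ⟨a, ha⟩ := (tendsto_Psi_atTop.eventually_lt_const h0).exists
  obtain ⟨b, hb⟩ := (tendsto_Psi_atBot.eventually_const_lt h1).exists
  exact mem_range_of_exists_le_of_exists_ge continuous_Psi ⟨a, ha.le⟩ ⟨b, hb.le⟩

/-- `F` plays the role of tails over open half-lines and `G` over closed ones. Monotonicity squeezes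
both at the moving point `b N` between the values of `F` at `a ± ε / 2`, and `Psi` is 1-Lipschitz by
`Psi_sub_le`. -/
lemma tendsto_of_tail_tendsto {F G : ℕ → ℝ → ℝ} (hF : ∀ N, Antitone (F N))
    (hG : ∀ N c d, c < d → F N d ≤ G N d ∧ G N d ≤ F N c)
    (h : ∀ a, Tendsto (fun N => F N a) atTop (𝓝 (Psi a))) {b : ℕ → ℝ} {a : ℝ}
    (hb : Tendsto b atTop (𝓝 a)) :
    Tendsto (fun N => F N (b N)) atTop (𝓝 (Psi a)) ∧
      Tendsto (fun N => G N (b N)) atTop (𝓝 (Psi a)) := by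
  have key : ∀ ε > 0, ∀ᶠ N in atTop, Psi a - ε < F N (b N) ∧ F N (b N) ≤ G N (b N) ∧
      G N (b N) < Psi a + ε := by
    intro ε hε
    filter_upwards [hb.eventually_lt_const (show a < a + ε / 2 by linarith),
      hb.eventually_const_lt (show a - ε / 2 < a by linarith),
      (h (a + ε / 2)).eventually_const_lt
        (show Psi a - ε < Psi (a + ε / 2) by linarith [Psi_sub_le (show a ≤ a + ε / 2 by linarith)]),
      (h (a - ε / 2)).eventually_lt_const
        (show Psi (a - ε / 2) < Psi a + ε by
          linarith [Psi_sub_le (show a - ε / 2 ≤ a by linarith)])] with N h1 h2 h3 h4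
    have g1 := hG N _ _ h2
    exact ⟨h3.trans_le (hF N h1.le), g1.1, g1.2.trans_lt h4⟩
  constructor
  · refine (nhds_basis_abs_sub_lt (Psi a)).tendsto_right_iff.2 fun ε hε => ?_
    filter_upwards [key ε hε] with N hN
    exact abs_lt.2 ⟨by linarith, by linarith⟩
  · refine (nhds_basis_abs_sub_lt (Psi a)).tendsto_right_iff.2 fun ε hε => ?_
    filter_upwards [key ε hε] with N hN
    exact abs_lt.2 ⟨by linarith, by linarith⟩

/-- Lévy's continuity theorem; the frontier of a half-line is a point, which is null for the
Gaussian. -/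
lemma tendsto_real_Ioi_of_charFun {ν : ℕ → Measure ℝ} [∀ N, IsProbabilityMeasure (ν N)]
    (h : ∀ ξ, Tendsto (fun N => charFun (ν N) ξ) atTop (𝓝 (charFun (gaussianReal 0 1) ξ)))
    {b : ℕ → ℝ} {a : ℝ} (hb : Tendsto b atTop (𝓝 a)) :
    Tendsto (fun N => (ν N).real (Set.Ioi (b N))) atTop (𝓝 (Psi a)) ∧
      Tendsto (fun N => (ν N).real (Set.Ici (b N))) atTop (𝓝 (Psi a)) := by
  have := nullSingletonClass_gaussianReal (μ := 0) (one_ne_zero (α := ℝ≥0))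
  refine tendsto_of_tail_tendsto (F := fun N c => (ν N).real (Set.Ioi c))
    (G := fun N c => (ν N).real (Set.Ici c))
    (fun N c d hcd => measureReal_mono (Set.Ioi_subset_Ioi hcd)) (fun N c d hcd =>
    ⟨measureReal_mono Set.Ioi_subset_Ici_self, measureReal_mono fun x hx => hcd.trans_le hx⟩)
    (fun c => ?_) hb
  have hconv := ProbabilityMeasure.tendsto_of_tendsto_charFun
    (μ₀ := (⟨gaussianReal 0 1, inferInstance⟩ : ProbabilityMeasure ℝ))
    (μ := fun N => (⟨ν N, inferInstance⟩ : ProbabilityMeasure ℝ)) h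
  have := ProbabilityMeasure.tendsto_measure_of_null_frontier_of_tendsto' hconv
    (E := Set.Ioi c) (by
      rw [frontier_Ioi]
      exact measure_singleton (μ := gaussianReal 0 1) c)
  exact (ENNReal.tendsto_toReal (measure_ne_top _ _)).comp this

/-! ### Central limit theorem for the surprisals -/

lemma integral_surp_sub (o : CayleyKind) {s : ℝ} (hs : 0 ≤ s) :
    ∫ x, (surp o s x - lineEntropy o s) ∂(lineMeasure o s) = 0 := by
  rw [integral_sub (integrable_surp o hs) (integrable_const _), lineEntropy]
  simp

lemma integral_surp_sub_sq (o : CayleyKind) {s : ℝ} :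
    ∫ x, (surp o s x - lineEntropy o s) ^ 2 ∂(lineMeasure o s) = lineVar o s := by
  rw [lineVar, variance_eq_integral (measurable_of_countable _).aemeasurable, lineEntropy]

/-- The product measure of `k` independent coordinates, each with law `lineMeasure o s`. -/
noncomputable abbrev prodMeasure (o : CayleyKind) (k : ℕ) (s : ℝ) : Measure (Fin k → ℤ) :=
  Measure.pi fun _ => lineMeasure o s

lemma tendsto_prob_normalized_sum {k : ℕ → ℕ} (hk : Tendsto k atTop atTop)
    {μ : ℕ → Measure ℤ} [∀ N, IsProbabilityMeasure (μ N)] {g : ℕ → ℤ → ℝ} {C : ℝ}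
    (h1 : ∀ N, Integrable (g N) (μ N)) (h2 : ∀ N, Integrable (fun x => g N x ^ 2) (μ N))
    (h3 : ∀ N, Integrable (fun x => |g N x| ^ 3) (μ N)) (hm : ∀ N, ∫ x, g N x ∂(μ N) = 0)
    (hv : ∀ N, ∫ x, g N x ^ 2 ∂(μ N) = 1) (hC : ∀ N, ∫ x, |g N x| ^ 3 ∂(μ N) ≤ C)
    {b : ℕ → ℝ} {a : ℝ} (hb : Tendsto b atTop (𝓝 a)) :
    Tendsto (fun N => (Measure.pi fun _ : Fin (k N) => μ N).real
      {w | b N < (∑ i, g N (w i)) / √(k N)}) atTop (𝓝 (Psi a)) ∧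
    Tendsto (fun N => (Measure.pi fun _ : Fin (k N) => μ N).real
      {w | b N ≤ (∑ i, g N (w i)) / √(k N)}) atTop (𝓝 (Psi a)) := by
  have hp : ∀ N, IsProbabilityMeasure ((Measure.pi fun _ : Fin (k N) => μ N).map
      fun w => (∑ i, g N (w i)) / √(k N)) := fun N =>
    Measure.isProbabilityMeasure_map (measurable_of_countable _).aemeasurable
  have hmap : ∀ N (s : Set ℝ), MeasurableSet s → ((Measure.pi fun _ : Fin (k N) => μ N).map
      fun w => (∑ i, g N (w i)) / √(k N)).real s = (Measure.pi fun _ : Fin (k N) => μ N).real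
      {w | (∑ i, g N (w i)) / √(k N) ∈ s} := fun N s hs =>
    map_measureReal_apply (measurable_of_countable _) hs
  have hchar := tendsto_charFun_normalized_sum hk h1 h2 h3 hm hv hC
  obtain ⟨ν, hν⟩ : ∃ ν : ℕ → Measure ℝ, ∀ N, ν N = (Measure.pi fun _ : Fin (k N) => μ N).map
      fun w => (∑ i, g N (w i)) / √(k N) := ⟨_, fun _ => rfl⟩
  simp only [← hν] at hp hmap hchar
  have hmain := tendsto_real_Ioi_of_charFun hchar hb
  simp only [hmap _ _ measurableSet_Ioi, hmap _ _ measurableSet_Ici] at hmain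
  exact hmain

lemma tendsto_prob_sum_surp_aux (o : CayleyKind) {k : ℕ → ℕ} (hk : Tendsto k atTop atTop)
    {s : ℕ → ℝ} (hs : ∀ N, 1 ≤ s N) {b : ℕ → ℝ} {a : ℝ}
    (hb : Tendsto (fun N => b N / √(k N * lineVar o (s N))) atTop (𝓝 a)) :
    Tendsto (fun N => (prodMeasure o (k N) (s N)).real
      {w | b N < ∑ i, surp o (s N) (w i) - k N * lineEntropy o (s N)}) atTop (𝓝 (Psi a)) ∧
    Tendsto (fun N => (prodMeasure o (k N) (s N)).real
      {w | b N ≤ ∑ i, surp o (s N) (w i) - k N * lineEntropy o (s N)}) atTop (𝓝 (Psi a)) := by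
  obtain ⟨c, hc, hcV⟩ := exists_lineVar_ge o
  obtain ⟨C, hC0, hC⟩ := exists_integral_abs_surp_sub_pow_three_le o
  have hV : ∀ N, 0 < lineVar o (s N) := fun N => hc.trans_le (hcV _ (hs N))
  have hsV : ∀ N, 0 < √(lineVar o (s N)) := fun N => Real.sqrt_pos.2 (hV N)
  set g : ℕ → ℤ → ℝ := fun N x => (surp o (s N) x - lineEntropy o (s N)) / √(lineVar o (s N))
    with hg
  have i1 : ∀ N, Integrable (g N) (lineMeasure o (s N)) := fun N =>
    (integrable_fun_sub (integrable_surp o (by linarith [hs N])) (integrable_const _)).div_const _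
  have e2 : ∀ N x, g N x ^ 2 =
      (surp o (s N) x - lineEntropy o (s N)) ^ 2 / lineVar o (s N) := fun N x => by
    simp only [hg]; rw [div_pow, Real.sq_sqrt (hV N).le]
  have e3 : ∀ N x, |g N x| ^ 3 =
      |surp o (s N) x - lineEntropy o (s N)| ^ 3 / √(lineVar o (s N)) ^ 3 := fun N x => by
    simp only [hg]; rw [abs_div, div_pow, abs_of_pos (hsV N)]
  have i2 : ∀ N, Integrable (fun x => g N x ^ 2) (lineMeasure o (s N)) := fun N => by
    refine Integrable.congr ?_ (ae_of_all _ fun x => (e2 N x).symm)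
    exact (((memLp_surp o (by linarith [hs N])).sub (memLp_const _)).integrable_sq).div_const _
  have i3 : ∀ N, Integrable (fun x => |g N x| ^ 3) (lineMeasure o (s N)) := fun N => by
    simp only [e3]
    exact (hC _ (hs N)).1.div_const _
  have hmain := tendsto_prob_normalized_sum hk (μ := fun N => lineMeasure o (s N)) (g := g)
    (C := C / √c ^ 3) i1 i2 i3
    (fun N => by
      simp only [hg]
      rw [integral_div, integral_surp_sub o (by linarith [hs N]), zero_div])
    (fun N => by
      simp only [e2]
      rw [integral_div, integral_surp_sub_sq, div_self (hV N).ne'])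
    (fun N => by
      simp only [e3]
      rw [integral_div]
      have := hcV _ (hs N)
      have := Real.sqrt_pos.2 hc
      gcongr
      exact (hC _ (hs N)).2) hb
  have hsum : ∀ N, 0 < k N → ∀ w : Fin (k N) → ℤ, (∑ i, g N (w i)) / √(k N) =
      (∑ i, surp o (s N) (w i) - k N * lineEntropy o (s N)) / √(k N * lineVar o (s N)) := by
    intro N hN w
    simp only [hg]
    rw [← Finset.sum_div, Finset.sum_sub_distrib, Real.sqrt_mul (Nat.cast_nonneg _), div_div,
      mul_comm √(k N : ℝ)]
    simp
  refine ⟨hmain.1.congr' ?_, hmain.2.congr' ?_⟩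
  all_goals
    filter_upwards [hk.eventually_gt_atTop 0] with N hN
    have hp : 0 < √(k N * lineVar o (s N)) :=
      Real.sqrt_pos.2 (mul_pos (by exact_mod_cast hN) (hV N))
    congr 1
    ext w
    simp only [hsum N hN w, Set.mem_ofPred_eq]
    first
      | rw [div_lt_div_iff_of_pos_right hp]
      | rw [div_le_div_iff_of_pos_right hp]

/-- Central limit theorem for the information content of the auxiliary walk. -/
lemma tendsto_prob_sum_surp (o : CayleyKind) {k : ℕ → ℕ} (hk : Tendsto k atTop atTop)
    {s : ℕ → ℝ} (hs : ∀ᶠ N in atTop, 1 ≤ s N) {b : ℕ → ℝ} {a : ℝ}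
    (hb : Tendsto (fun N => b N / √(k N * lineVar o (s N))) atTop (𝓝 a)) :
    Tendsto (fun N => (prodMeasure o (k N) (s N)).real
      {w | b N < ∑ i, surp o (s N) (w i) - k N * lineEntropy o (s N)}) atTop (𝓝 (Psi a)) ∧
    Tendsto (fun N => (prodMeasure o (k N) (s N)).real
      {w | b N ≤ ∑ i, surp o (s N) (w i) - k N * lineEntropy o (s N)}) atTop (𝓝 (Psi a)) := by
  -- The moment bounds need `1 ≤ s N` for every `N`; replacing `s` by `max 1 s` changes only
  -- finitely many terms.
  have hs' : ∀ᶠ N in atTop, max 1 (s N) = s N := hs.mono fun N h => max_eq_right h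
  have := tendsto_prob_sum_surp_aux o hk (s := fun N => max 1 (s N)) (fun N => le_max_left _ _)
    (b := b) (a := a) (hb.congr' (hs'.mono fun N h => by simp only [h]))
  exact ⟨this.1.congr' (hs'.mono fun N h => by simp only [h]),
    this.2.congr' (hs'.mono fun N h => by simp only [h])⟩

/-! ### Increments of the entropy and inversion in time -/

lemma lineEntropy_le_of_one_le (o : CayleyKind) {s : ℝ} (hs : 1 ≤ s) :
    lineEntropy o s ≤ Real.log s / 2 + 2.4 := by
  have hs0 : 0 < s := by linarith
  have hss : 1 ≤ √s := Real.one_le_sqrt.2 hs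
  have h1 := lineEntropy_le o hs0
  have h2 : Real.log (2 * (1 + √s)) ≤ Real.log (2 ^ 2 * √s) :=
    Real.log_le_log (by positivity) (by linarith)
  rw [Real.log_mul (x := 2 ^ 2) (by norm_num) (by positivity), Real.log_sqrt hs0.le,
    Real.log_pow] at h2
  -- The constant is `2 log 2 + 1 < 2.4`.
  have h3 := Real.log_two_lt_d9
  push_cast at h2
  linarith

lemma lineEntropy_ge_half_log (o : CayleyKind) {s : ℝ} (hs : 0 < s) :
    Real.log s / 2 ≤ lineEntropy o s := by
  have := lineEntropy_ge o hs
  have := Real.log_nonpos (by norm_num : (0 : ℝ) ≤ 0.64) (by norm_num)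
  linarith

/-- By concavity the slope over `[s, s']` is at least the slope over `[s', e⁷ s']`. On the latter
interval the entropy grows by at least `7 / 2 - 2.4 > 1`; the exponent 7 is chosen to beat the gap
between the upper and lower bounds of the entropy. -/
lemma lineEntropy_sub_ge (o : CayleyKind) {s s' : ℝ} (hs : 1 ≤ s) (h : s ≤ s') :
    (s' - s) / (Real.exp 7 * s') ≤ lineEntropy o s' - lineEntropy o s := by
  rcases h.eq_or_lt with rfl | h
  · simp
  have hs' : 1 < s' := hs.trans_lt h
  have hK : 1 < Real.exp 7 := Real.one_lt_exp_iff.2 (by norm_num)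
  have hlt : s' < Real.exp 7 * s' := by nlinarith
  have hc := (concaveOn_lineEntropy o).slope_anti_adjacent (x := s) (y := s')
    (z := Real.exp 7 * s') (Set.mem_Ici.2 (by linarith)) (Set.mem_Ici.2 (by linarith)) h hlt
  have h1 := lineEntropy_ge_half_log o (s := Real.exp 7 * s') (by positivity)
  rw [Real.log_mul (by positivity) (by linarith), Real.log_exp] at h1
  have h2 := lineEntropy_le_of_one_le o hs'.le
  have h3 : 1 / (Real.exp 7 * s') ≤
      (lineEntropy o (Real.exp 7 * s') - lineEntropy o s') / (Real.exp 7 * s' - s') := by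
    rw [div_le_div_iff₀ (by linarith) (by linarith)]
    nlinarith
  have h4 := h3.trans hc
  rw [le_div_iff₀ (by linarith)] at h4
  exact (by ring : (s' - s) / (Real.exp 7 * s') = 1 / (Real.exp 7 * s') * (s' - s)).trans_le h4

/-- By concavity the slope over `[s, s']` is at most the slope over `[s / 2, s]`, where the entropy
grows by at most `2.4 + ½ log 2 < 3`. -/
lemma lineEntropy_sub_le (o : CayleyKind) {s s' : ℝ} (hs : 1 ≤ s) (h : s ≤ s') :
    lineEntropy o s' - lineEntropy o s ≤ 6 * ((s' - s) / s) := by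
  rcases h.eq_or_lt with rfl | h
  · simp
  have hc := (concaveOn_lineEntropy o).slope_anti_adjacent (x := s / 2) (y := s)
    (z := s') (Set.mem_Ici.2 (by linarith)) (Set.mem_Ici.2 (by linarith)) (by linarith) h
  have h1 := lineEntropy_ge_half_log o (s := s / 2) (by positivity)
  rw [Real.log_div (by positivity) (by norm_num)] at h1
  have h2 := lineEntropy_le_of_one_le o hs
  have h5 := Real.log_two_lt_d9
  have h3 : (lineEntropy o s - lineEntropy o (s / 2)) / (s - s / 2) ≤ 6 / s := by
    rw [div_le_div_iff₀ (by linarith) (by linarith)]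
    nlinarith
  have h4 := hc.trans h3
  rw [div_le_iff₀ (by linarith)] at h4
  exact h4.trans_eq (by ring)

lemma one_le_of_lineEntropy_ge (o : CayleyKind) {s : ℝ} (hs : 0 ≤ s) (h : 3 ≤ lineEntropy o s) :
    1 ≤ s := by
  by_contra hlt
  have h1 := strictMonoOn_lineEntropy o (Set.mem_Ici.2 hs) (Set.mem_Ici.2 zero_le_one)
    (not_le.1 hlt)
  have h2 := lineEntropy_le_of_one_le o le_rfl
  rw [Real.log_one] at h2
  linarith

/-- The time at which a coordinate of rate one has entropy `h`. -/
noncomputable def lineTime (o : CayleyKind) (h : ℝ) : ℝ :=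
  Function.invFunOn (lineEntropy o) (Set.Ici 0) h

lemma lineTime_nonneg (o : CayleyKind) {h : ℝ} (hh : 0 ≤ h) : 0 ≤ lineTime o h :=
  Function.invFunOn_mem ((bijOn_lineEntropy o).surjOn (Set.mem_Ici.2 hh))

lemma lineEntropy_lineTime (o : CayleyKind) {h : ℝ} (hh : 0 ≤ h) :
    lineEntropy o (lineTime o h) = h :=
  Function.invFunOn_eq ((bijOn_lineEntropy o).surjOn (Set.mem_Ici.2 hh))

lemma lineTime_lt (o : CayleyKind) {h h' : ℝ} (hh : 0 ≤ h) (hlt : h < h') :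
    lineTime o h < lineTime o h' := by
  refine ((strictMonoOn_lineEntropy o).lt_iff_lt (lineTime_nonneg o hh)
    (lineTime_nonneg o (hh.trans hlt.le))).1 ?_
  rwa [lineEntropy_lineTime o hh, lineEntropy_lineTime o (hh.trans hlt.le)]

lemma one_le_lineTime (o : CayleyKind) {h : ℝ} (hh : 3 ≤ h) : 1 ≤ lineTime o h :=
  one_le_of_lineEntropy_ge o (lineTime_nonneg o (by linarith))
    (by rwa [lineEntropy_lineTime o (by linarith)])

lemma bijOn_entropy (o : CayleyKind) (k : ℕ) [NeZero k] :
    Set.BijOn (entropy o k) (Set.Ici 0) (Set.Ici 0) := by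
  have hk : (0 : ℝ) < k := Nat.cast_pos.2 (NeZero.pos k)
  have hd : Set.BijOn (fun t : ℝ => t / k) (Set.Ici 0) (Set.Ici 0) := by
    refine ⟨fun t ht => div_nonneg ht hk.le, fun a _ b _ hab => ?_, fun s hs =>
      ⟨s * k, mul_nonneg hs hk.le, mul_div_cancel_right₀ _ hk.ne'⟩⟩
    exact (div_left_inj' hk.ne').1 hab
  exact ((bijOn_lineEntropy o).comp hd).congr fun t ht => (entropy_eq o k ht).symm

/-- The entropy is injective on `[0, ∞)`, so the infimum defining the time is over a single point.
-/
lemma timeOfEntropy_eq (o : CayleyKind) (k : ℕ) [NeZero k] {h : ℝ} (hh : 0 ≤ h) :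
    timeOfEntropy o k h = k * lineTime o h := by
  have hk : (0 : ℝ) < k := Nat.cast_pos.2 (NeZero.pos k)
  have h0 : 0 ≤ k * lineTime o h := mul_nonneg hk.le (lineTime_nonneg o hh)
  have he : entropy o k (k * lineTime o h) = h := by
    rw [entropy_eq o k h0, mul_div_cancel_left₀ _ hk.ne', lineEntropy_lineTime o hh]
  have hset : {t : ℝ | 0 ≤ t ∧ entropy o k t = h} = {k * lineTime o h} := by
    ext t
    refine ⟨fun ht => (bijOn_entropy o k).injOn ht.1 h0 (ht.2.trans he.symm), ?_⟩
    rintro rfl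
    exact ⟨h0, he⟩
  rw [timeOfEntropy, hset, csInf_singleton]

/-- The cutoff time per coordinate. -/
noncomputable def cutoffLine (o : CayleyKind) (k n : ℕ) (α : ℝ) : ℝ :=
  lineTime o (Real.log n / k + α * (√(lineVar o (lineTime o (Real.log n / k))) / √k))

lemma entropicTime_eq (o : CayleyKind) (k n : ℕ) [NeZero k] :
    entropicTime o k n = k * lineTime o (Real.log n / k) :=
  timeOfEntropy_eq o k (div_nonneg (Real.log_natCast_nonneg n) (Nat.cast_nonneg k))

lemma cutoffLine_zero (o : CayleyKind) (k n : ℕ) :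
    cutoffLine o k n 0 = lineTime o (Real.log n / k) := by
  rw [cutoffLine, zero_mul, add_zero]

lemma entropicTime_eq_cutoffLine (o : CayleyKind) (k n : ℕ) [NeZero k] :
    entropicTime o k n = k * cutoffLine o k n 0 := by
  rw [entropicTime_eq, cutoffLine_zero]

lemma entropyTarget_div (o : CayleyKind) (k n : ℕ) [NeZero k] (α : ℝ) :
    entropyTarget o k n α / k =
      Real.log n / k + α * (√(lineVar o (lineTime o (Real.log n / k))) / √k) := by
  have hk : (0 : ℝ) < k := Nat.cast_pos.2 (NeZero.pos k)
  have h0 : 0 ≤ lineTime o (Real.log n / k) :=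
    lineTime_nonneg o (div_nonneg (Real.log_natCast_nonneg n) hk.le)
  have hsk : 0 < √(k : ℝ) := Real.sqrt_pos.2 hk
  rw [entropyTarget, entropicTime_eq, varentropy_eq o k (mul_nonneg hk.le h0),
    mul_div_cancel_left₀ _ hk.ne', Real.sqrt_mul' _ hk.le, add_div]
  congr 1
  field_simp
  rw [Real.sq_sqrt hk.le]
  ring

lemma cutoffTime_eq (o : CayleyKind) (k n : ℕ) [NeZero k] {α : ℝ}
    (h : 0 ≤ Real.log n / k + α * (√(lineVar o (lineTime o (Real.log n / k))) / √k)) :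
    cutoffTime o k n α = k * cutoffLine o k n α := by
  rw [cutoffTime, entropyTarget_div, timeOfEntropy_eq o k h, cutoffLine]

lemma exists_lineVar_le (o : CayleyKind) : ∃ C : ℝ, 0 < C ∧ ∀ s, 1 ≤ s → lineVar o s ≤ C := by
  obtain ⟨C, hC0, hC⟩ := exists_integral_abs_surp_sub_pow_three_le o
  refine ⟨1 + C, by linarith, fun s hs => ?_⟩
  rw [← integral_surp_sub_sq]
  have h : ∫ x, (surp o s x - lineEntropy o s) ^ 2 ∂(lineMeasure o s) ≤
      ∫ x, (1 + |surp o s x - lineEntropy o s| ^ 3) ∂(lineMeasure o s) := by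
    refine integral_mono (((memLp_surp o (by linarith)).sub (memLp_const _)).integrable_sq)
      ((integrable_const 1).add (hC s hs).1) fun x => ?_
    simp only
    rw [← sq_abs]
    have := abs_nonneg (surp o s x - lineEntropy o s)
    rcases le_total |surp o s x - lineEntropy o s| 1 with h | h
    · nlinarith [pow_nonneg this 3]
    · nlinarith [mul_nonneg (sub_nonneg.2 h) (sq_nonneg |surp o s x - lineEntropy o s|)]
  rw [integral_add (integrable_const 1) (hC s hs).1] at h
  have := (hC s hs).2
  simp at h
  linarith

/-- Two time sequences whose entropies merge are asymptotically equivalent. -/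
lemma tendsto_div_of_lineEntropy_sub (o : CayleyKind) {a b : ℕ → ℝ} (ha : ∀ᶠ N in atTop, 1 ≤ a N)
    (hb : ∀ᶠ N in atTop, 1 ≤ b N)
    (h : Tendsto (fun N => lineEntropy o (b N) - lineEntropy o (a N)) atTop (𝓝 0)) :
    Tendsto (fun N => b N / a N) atTop (𝓝 1) := by
  set e : ℕ → ℝ := fun N => Real.exp 7 * |lineEntropy o (b N) - lineEntropy o (a N)| with he
  have he0 : Tendsto e atTop (𝓝 0) := by simpa using h.abs.const_mul (Real.exp 7)
  have h1 : Tendsto (fun N => 1 - e N) atTop (𝓝 1) := by simpa using he0.const_sub 1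
  have h2 : Tendsto (fun N => (1 - e N)⁻¹) atTop (𝓝 1) := by
    simpa using h1.inv₀ one_ne_zero
  -- A rearrangement of `lineEntropy_sub_ge`; applied with the smaller time first it serves both
  -- orders of `a N` and `b N`.
  have key : ∀ {x y : ℝ}, 1 ≤ x → x ≤ y →
      1 - Real.exp 7 * |lineEntropy o y - lineEntropy o x| ≤ x / y := by
    intro x y hx hxy
    have hy : 0 < y := by linarith
    have h := (lineEntropy_sub_ge o hx hxy).trans (le_abs_self _)
    rw [← div_div, div_le_iff₀ hy, div_le_iff₀ (Real.exp_pos 7)] at h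
    rw [le_div_iff₀ hy]
    linarith
  refine tendsto_of_tendsto_of_tendsto_of_le_of_le' h1 h2 ?_ ?_
  · filter_upwards [ha, hb] with N h1 h2
    rcases le_total (a N) (b N) with hab | hab
    · have : 1 ≤ b N / a N := (one_le_div (by linarith)).2 hab
      have : 0 ≤ e N := by positivity
      linarith
    · have := key h2 hab
      rwa [abs_sub_comm] at this
  · filter_upwards [ha, hb, he0.eventually_lt_const one_pos] with N h1 h2 h3
    have he1 : 0 < 1 - e N := by linarith
    rcases le_total (a N) (b N) with hab | hab
    · rw [← inv_div]
      exact inv_anti₀ he1 (key h1 hab)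
    · have : b N / a N ≤ 1 := (div_le_one (by linarith)).2 hab
      refine this.trans ((one_le_inv₀ he1).2 ?_)
      have : 0 ≤ e N := by positivity
      linarith

lemma tendsto_lineEntropy_mul_sub (o : CayleyKind) {c : ℝ} (hc : 0 < c) :
    Tendsto (fun s => lineEntropy o (c * s) - lineEntropy o s) atTop (𝓝 (Real.log c / 2)) := by
  have h := ((tendsto_lineEntropy_sub o).comp (tendsto_id.const_mul_atTop hc)).sub
    (tendsto_lineEntropy_sub o)
  have h' := h.add_const (Real.log c / 2)
  rw [sub_zero, zero_add] at h'
  refine h'.congr' ?_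
  filter_upwards [eventually_gt_atTop 0] with s hs
  simp only [Function.comp_apply, id]
  rw [Real.log_mul hc.ne' hs.ne']
  ring

/-- The entropy has derivative asymptotic to `1 / (2 s)`. -/
lemma tendsto_lineEntropy_slope (o : CayleyKind) {a b : ℕ → ℝ} (ha : Tendsto a atTop atTop)
    (hab : Tendsto (fun N => b N / a N) atTop (𝓝 1)) (hne : ∀ᶠ N in atTop, a N ≠ b N) :
    Tendsto (fun N => a N * ((lineEntropy o (b N) - lineEntropy o (a N)) / (b N - a N))) atTop
      (𝓝 (1 / 2)) := by
  have hb : Tendsto b atTop atTop := by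
    refine (ha.atTop_mul_pos one_pos hab).congr' ?_
    filter_upwards [ha.eventually_gt_atTop 0] with N hN
    field_simp
  have hx : Tendsto (fun N => min (a N) (b N)) atTop atTop := by
    refine tendsto_atTop.2 fun c => ?_
    filter_upwards [ha.eventually_ge_atTop c, hb.eventually_ge_atTop c] with N h1 h2
    exact le_min h1 h2
  have hy : Tendsto (fun N => max (a N) (b N)) atTop atTop :=
    tendsto_atTop_mono (fun N => le_max_left _ _) ha
  have hax : Tendsto (fun N => a N / min (a N) (b N)) atTop (𝓝 1) := by
    have h := ((tendsto_const_nhds (x := (1 : ℝ))).min hab).inv₀ (by simp)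
    rw [min_self, inv_one] at h
    refine h.congr' ?_
    filter_upwards [ha.eventually_gt_atTop 0] with N hN
    rw [← inv_div (min _ _), ← min_div_div_right hN.le, div_self hN.ne']
  have hay : Tendsto (fun N => a N / max (a N) (b N)) atTop (𝓝 1) := by
    have h := ((tendsto_const_nhds (x := (1 : ℝ))).max hab).inv₀ (by simp)
    rw [max_self, inv_one] at h
    refine h.congr' ?_
    filter_upwards [ha.eventually_gt_atTop 0] with N hN
    rw [← inv_div (max _ _), ← max_div_div_right hN.le, div_self hN.ne']
  have hslope : ∀ N, a N ≠ b N → (lineEntropy o (b N) - lineEntropy o (a N)) / (b N - a N) =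
      (lineEntropy o (max (a N) (b N)) - lineEntropy o (min (a N) (b N))) /
        (max (a N) (b N) - min (a N) (b N)) := by
    intro N _
    rcases le_total (a N) (b N) with h | h
    · rw [max_eq_right h, min_eq_left h]
    · rw [max_eq_left h, min_eq_right h, ← neg_sub (lineEntropy o (a N)), ← neg_sub (a N),
        neg_div_neg_eq]
  refine (nhds_basis_abs_sub_lt (1 / 2 : ℝ)).tendsto_right_iff.2 fun ε hε => ?_
  -- With `x ≤ y` the two times in order, concavity squeezes the slope over `[x, y]` between those
  -- over `[y, c y]` and `[x / c, x]`. Multiplied by `a`, these tend to `½ log c / (c - 1)` and `½ c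
  -- log c / (c - 1)`, both within `ε` of `1 / 2`.
  set c : ℝ := 1 + ε with hc
  have hc1 : 1 < c := by linarith
  have hlog1 := Real.log_le_sub_one_of_pos (show 0 < c by linarith)
  have hlog2 := Real.one_sub_inv_le_log_of_pos (show 0 < c by linarith)
  have hinv : 1 - c⁻¹ = (c - 1) / c := by field_simp
  rw [hinv] at hlog2
  have hup : Tendsto (fun N => a N / min (a N) (b N) *
      ((lineEntropy o (c * (min (a N) (b N) / c)) - lineEntropy o (min (a N) (b N) / c)) /
        ((c - 1) / c))) atTop (𝓝 (1 * (Real.log c / 2 / ((c - 1) / c)))) :=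
    hax.mul (((tendsto_lineEntropy_mul_sub o (by linarith)).comp
      (hx.atTop_div_const (show 0 < c by linarith))).div_const _)
  have hlo : Tendsto (fun N => a N / max (a N) (b N) *
      ((lineEntropy o (c * max (a N) (b N)) - lineEntropy o (max (a N) (b N))) /
        (c - 1))) atTop (𝓝 (1 * (Real.log c / 2 / (c - 1)))) :=
    hay.mul (((tendsto_lineEntropy_mul_sub o (by linarith)).comp hy).div_const _)
  have hup' : 1 * (Real.log c / 2 / ((c - 1) / c)) < 1 / 2 + ε := by
    have : Real.log c / 2 / ((c - 1) / c) ≤ c / 2 := by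
      rw [div_div, div_le_iff₀ (by have := sub_pos.2 hc1; positivity)]
      field_simp
      linarith
    linarith
  have hlo' : 1 / 2 - ε < 1 * (Real.log c / 2 / (c - 1)) := by
    have h1 : 1 / (2 * c) ≤ Real.log c / 2 / (c - 1) := by
      rw [le_div_iff₀ (by linarith)]
      have : 1 / (2 * c) * (c - 1) = (c - 1) / c / 2 := by field_simp
      linarith
    have h2 : 1 / 2 - ε < 1 / (2 * c) := by
      rw [lt_div_iff₀ (by linarith)]
      nlinarith
    linarith
  filter_upwards [hne, hup.eventually_lt_const hup', hlo.eventually_const_lt hlo',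
    hx.eventually_gt_atTop 0, ha.eventually_gt_atTop 0] with N hN h1 h2 hx0 ha0
  rw [hslope N hN]
  set x := min (a N) (b N)
  set y := max (a N) (b N)
  have hxy : x < y := by
    rcases lt_or_gt_of_ne hN with h | h
    · exact (min_le_left _ _).trans_lt (h.trans_le (le_max_right _ _))
    · exact (min_le_right _ _).trans_lt (h.trans_le (le_max_left _ _))
  have hc0 : 0 < c := by linarith
  have hxc : x / c < x := div_lt_self hx0 hc1
  have hyc : y < c * y := by nlinarith
  have s1 := (concaveOn_lineEntropy o).slope_anti_adjacent (x := x / c) (y := x) (z := y)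
    (Set.mem_Ici.2 (by positivity)) (Set.mem_Ici.2 (by linarith)) hxc hxy
  have s2 := (concaveOn_lineEntropy o).slope_anti_adjacent (x := x) (y := y) (z := c * y)
    (Set.mem_Ici.2 (by positivity)) (Set.mem_Ici.2 (by linarith)) hxy hyc
  have t1 := mul_le_mul_of_nonneg_left s1 ha0.le
  have t2 := mul_le_mul_of_nonneg_left s2 ha0.le
  have e1 : a N / x * ((lineEntropy o (c * (x / c)) - lineEntropy o (x / c)) / ((c - 1) / c)) =
      a N * ((lineEntropy o x - lineEntropy o (x / c)) / (x - x / c)) := by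
    rw [mul_div_cancel₀ _ hc0.ne']
    have : c - 1 ≠ 0 := by linarith
    field_simp
  have e2 : a N / y * ((lineEntropy o (c * y) - lineEntropy o y) / (c - 1)) =
      a N * ((lineEntropy o (c * y) - lineEntropy o y) / (c * y - y)) := by
    have : c - 1 ≠ 0 := by linarith
    have : y ≠ 0 := by linarith
    rw [show c * y - y = (c - 1) * y by ring]
    field_simp
  rw [e1] at h1
  rw [e2] at h2
  exact abs_lt.2 ⟨by linarith, by linarith⟩

/-! ### Cutoff times per coordinate when `log n > 5 k` -/

section Regime

variable (o : CayleyKind) {k n : ℕ → ℕ} [∀ N, NeZero (k N)] (hk : Tendsto k atTop atTop)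
  (hn : ∀ᶠ N in atTop, 5 * (k N : ℝ) < Real.log (n N))

include hk hn

lemma tendsto_window :
    Tendsto (fun N => √(lineVar o (lineTime o (Real.log (n N) / k N))) / √(k N)) atTop (𝓝 0) := by
  obtain ⟨C, hC0, hC⟩ := exists_lineVar_le o
  have h : Tendsto (fun N => √C / √(k N)) atTop (𝓝 0) :=
    (Real.tendsto_sqrt_atTop.comp (tendsto_natCast_atTop_atTop.comp hk)).const_div_atTop _
  refine squeeze_zero' (Eventually.of_forall fun N => by positivity) ?_ h
  filter_upwards [hn] with N hN
  have hk0 : (0 : ℝ) < k N := Nat.cast_pos.2 (NeZero.pos _)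
  gcongr
  refine hC _ (one_le_lineTime o ?_)
  rw [le_div_iff₀ hk0]
  linarith

lemma tendsto_shift (α : ℝ) :
    Tendsto (fun N => α * (√(lineVar o (lineTime o (Real.log (n N) / k N))) / √(k N)))
      atTop (𝓝 0) := by
  simpa using (tendsto_window o hk hn).const_mul α

/-- The shift tends to zero while `log n / k > 5`. A target above 3 already places the time beyond
1; the value 4.9 is the input of `sqrt_bounds_of_lineEntropy`. -/
lemma eventually_target_ge (α : ℝ) : ∀ᶠ N in atTop, 4.9 ≤ Real.log (n N) / k N +
    α * (√(lineVar o (lineTime o (Real.log (n N) / k N))) / √(k N)) := by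
  filter_upwards [hn, (tendsto_shift o hk hn α).eventually_const_lt
    (show (-0.1 : ℝ) < 0 by norm_num)] with N h1 h2
  have hk0 : (0 : ℝ) < k N := Nat.cast_pos.2 (NeZero.pos _)
  have : 5 ≤ Real.log (n N) / k N := by
    rw [le_div_iff₀ hk0]
    exact h1.le
  linarith

lemma eventually_lineEntropy_cutoffLine (α : ℝ) : ∀ᶠ N in atTop,
    4.9 ≤ lineEntropy o (cutoffLine o (k N) (n N) α) ∧
    lineEntropy o (cutoffLine o (k N) (n N) α) = Real.log (n N) / k N +
    α * (√(lineVar o (lineTime o (Real.log (n N) / k N))) / √(k N)) := by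
  filter_upwards [eventually_target_ge o hk hn α] with N h
  rw [cutoffLine, lineEntropy_lineTime o (by linarith)]
  exact ⟨h, rfl⟩

lemma eventually_one_le_cutoffLine (α : ℝ) :
    ∀ᶠ N in atTop, 1 ≤ cutoffLine o (k N) (n N) α := by
  filter_upwards [eventually_target_ge o hk hn α] with N h
  exact one_le_lineTime o (by linarith)

lemma eventually_cutoffTime_eq (α : ℝ) :
    ∀ᶠ N in atTop, cutoffTime o (k N) (n N) α = k N * cutoffLine o (k N) (n N) α := by
  filter_upwards [eventually_target_ge o hk hn α] with N h
  exact cutoffTime_eq o _ _ (by linarith)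

lemma eventually_entropyTarget_nonneg (α : ℝ) :
    ∀ᶠ N in atTop, 0 ≤ entropyTarget o (k N) (n N) α := by
  filter_upwards [eventually_target_ge o hk hn α] with N h
  have hk0 : (0 : ℝ) < k N := Nat.cast_pos.2 (NeZero.pos _)
  rw [← entropyTarget_div, le_div_iff₀ hk0] at h
  exact le_trans (by positivity) h

lemma tendsto_cutoffLine_div (α β : ℝ) :
    Tendsto (fun N => cutoffLine o (k N) (n N) β / cutoffLine o (k N) (n N) α) atTop (𝓝 1) := by
  refine tendsto_div_of_lineEntropy_sub o (eventually_one_le_cutoffLine o hk hn α)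
    (eventually_one_le_cutoffLine o hk hn β) ?_
  refine (tendsto_shift o hk hn (β - α)).congr' ?_
  filter_upwards [eventually_lineEntropy_cutoffLine o hk hn α,
    eventually_lineEntropy_cutoffLine o hk hn β] with N h1 h2
  rw [h1.2, h2.2]
  ring

/-- The two entropies differ by exactly `(β - α) √v / √k`. The bounds on entropy increments convert
this into time on the scale `s₀ √v / √k`; both times are within a factor two of `s₀`, whence the
constants `2 e⁷` and `12 = 2 * 6`. -/
lemma eventually_cutoffLine_sub {α β : ℝ} (hαβ : α < β) : ∀ᶠ N in atTop,
    cutoffLine o (k N) (n N) α < cutoffLine o (k N) (n N) β ∧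
    cutoffLine o (k N) (n N) β - cutoffLine o (k N) (n N) α ≤
      2 * Real.exp 7 * (β - α) * (lineTime o (Real.log (n N) / k N) *
        (√(lineVar o (lineTime o (Real.log (n N) / k N))) / √(k N))) ∧
    (β - α) * (lineTime o (Real.log (n N) / k N) *
        (√(lineVar o (lineTime o (Real.log (n N) / k N))) / √(k N))) ≤
      12 * (cutoffLine o (k N) (n N) β - cutoffLine o (k N) (n N) α) := by
  filter_upwards [eventually_lineEntropy_cutoffLine o hk hn α,
    eventually_lineEntropy_cutoffLine o hk hn β, eventually_one_le_cutoffLine o hk hn α,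
    eventually_one_le_cutoffLine o hk hn β, eventually_one_le_cutoffLine o hk hn 0,
    (tendsto_cutoffLine_div o hk hn 0 β).eventually_lt_const (show (1 : ℝ) < 2 by norm_num),
    (tendsto_cutoffLine_div o hk hn 0 α).eventually_const_lt (show (1 / 2 : ℝ) < 1 by norm_num),
    eventually_target_ge o hk hn α]
    with N h1 h2 h3 h4 h5 h6 h7 h8
  rw [div_lt_iff₀ (by linarith), cutoffLine_zero] at h6
  rw [lt_div_iff₀ (by linarith), cutoffLine_zero] at h7
  rw [cutoffLine_zero] at h5
  have hk0 : (0 : ℝ) < k N := Nat.cast_pos.2 (NeZero.pos _)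
  set s₀ := lineTime o (Real.log (n N) / k N)
  have hw : 0 < √(lineVar o s₀) / √(k N) :=
    div_pos (Real.sqrt_pos.2 (lineVar_pos o (by linarith))) (Real.sqrt_pos.2 hk0)
  set w := √(lineVar o s₀) / √(k N) with hwdef
  have hlt : cutoffLine o (k N) (n N) α < cutoffLine o (k N) (n N) β := by
    refine lineTime_lt o (by linarith) ?_
    have := mul_lt_mul_of_pos_right hαβ hw
    linarith
  set sα := cutoffLine o (k N) (n N) α
  set sβ := cutoffLine o (k N) (n N) β
  have g1 := lineEntropy_sub_ge o h3 hlt.le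
  have g2 := lineEntropy_sub_le o h3 hlt.le
  rw [h1.2, h2.2] at g1 g2
  have e : Real.log (n N) / k N + β * w - (Real.log (n N) / k N + α * w) = (β - α) * w := by ring
  rw [e] at g1 g2
  have hd : 0 < (β - α) * w := mul_pos (by linarith) hw
  refine ⟨hlt, ?_, ?_⟩
  · rw [div_le_iff₀ (by positivity)] at g1
    calc sβ - sα ≤ (β - α) * w * (Real.exp 7 * sβ) := g1
      _ ≤ (β - α) * w * (Real.exp 7 * (2 * s₀)) := by gcongr
      _ = _ := by ring
  · rw [← mul_div_assoc 6, le_div_iff₀ (by linarith)] at g2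
    calc (β - α) * (s₀ * w) = 2 * ((β - α) * w * (1 / 2 * s₀)) := by ring
      _ ≤ 2 * ((β - α) * w * sα) := by gcongr
      _ ≤ _ := by linarith

lemma tendsto_lineVar_cutoffLine (α : ℝ) :
    Tendsto (fun N => lineVar o (cutoffLine o (k N) (n N) α) /
      lineVar o (lineTime o (Real.log (n N) / k N))) atTop (𝓝 1) := by
  have := tendsto_lineVar_div o (eventually_one_le_cutoffLine o hk hn 0)
    (eventually_one_le_cutoffLine o hk hn α) (tendsto_cutoffLine_div o hk hn 0 α)
  simpa only [cutoffLine_zero] using this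

end Regime

/-! ### Explicit asymptotics when `k = o(log n)` -/

section Sparse

lemma tendsto_log_div_atTop {k n : ℕ → ℕ} [∀ N, NeZero (k N)]
    (hn : ∀ᶠ N in atTop, 5 * (k N : ℝ) < Real.log (n N))
    (hs : Tendsto (fun N => (k N : ℝ) / Real.log (n N)) atTop (𝓝 0)) :
    Tendsto (fun N => Real.log (n N) / k N) atTop atTop := by
  have h : Tendsto (fun N => (k N : ℝ) / Real.log (n N)) atTop (𝓝[>] 0) := by
    refine tendsto_nhdsWithin_iff.2 ⟨hs, ?_⟩
    filter_upwards [hn] with N hN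
    have hk0 : (0 : ℝ) < k N := Nat.cast_pos.2 (NeZero.pos _)
    exact div_pos hk0 (by linarith)
  refine h.inv_tendsto_nhdsGT_zero.congr fun N => ?_
  simp

lemma tendsto_lineTime_atTop (o : CayleyKind) : Tendsto (lineTime o) atTop atTop := by
  refine tendsto_atTop.2 fun b => ?_
  filter_upwards [eventually_gt_atTop (lineEntropy o (max b 0)), eventually_ge_atTop 0]
    with h hN h0
  by_contra hlt
  have h1 := (strictMonoOn_lineEntropy o).monotoneOn (Set.mem_Ici.2 (lineTime_nonneg o h0))
    (Set.mem_Ici.2 (le_max_right b 0)) ((not_le.1 hlt).le.trans (le_max_left b 0))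
  rw [lineEntropy_lineTime o h0] at h1
  linarith

lemma rpow_two_div {n : ℕ} (k : ℕ) (h : 0 < n) :
    (n : ℝ) ^ (2 / (k : ℝ)) = Real.exp (2 * (Real.log n / k)) := by
  rw [Real.rpow_def_of_pos (by exact_mod_cast h)]
  congr 1
  ring

/-- A coordinate has entropy `h` at a time asymptotic to `exp (2 h) / (2 π e)`. -/
lemma tendsto_lineTime_div (o : CayleyKind) :
    Tendsto (fun h => lineTime o h / (Real.exp (2 * h) / (2 * Real.pi * Real.exp 1))) atTop
      (𝓝 1) := by
  have h1 := ((((tendsto_lineEntropy_sub o).comp (tendsto_lineTime_atTop o)).const_mul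
    (-2)).rexp)
  rw [mul_zero, Real.exp_zero] at h1
  refine h1.congr' ?_
  filter_upwards [eventually_ge_atTop 3] with h hh
  have hs := one_le_lineTime o hh
  have hpi := Real.pi_pos
  simp only [Function.comp_apply]
  rw [lineEntropy_lineTime o (by linarith), show -2 * (h - (Real.log (lineTime o h) / 2 +
    Real.log (2 * Real.pi) / 2 + 1 / 2)) = Real.log (lineTime o h) + Real.log (2 * Real.pi) + 1 -
    2 * h by ring, Real.exp_sub, Real.exp_add, Real.exp_add, Real.exp_log (by linarith),
    Real.exp_log (by positivity)]
  field_simp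

variable (o : CayleyKind) {k n : ℕ → ℕ} [∀ N, NeZero (k N)] (hk : Tendsto k atTop atTop)
  (hn : ∀ᶠ N in atTop, 5 * (k N : ℝ) < Real.log (n N))
  (hs : Tendsto (fun N => (k N : ℝ) / Real.log (n N)) atTop (𝓝 0))

include hn hs

lemma tendsto_entropicTime_div :
    Tendsto (fun N => entropicTime o (k N) (n N) /
      ((k N : ℝ) * (n N : ℝ) ^ (2 / (k N : ℝ)) / (2 * Real.pi * Real.exp 1))) atTop (𝓝 1) := by
  refine ((tendsto_lineTime_div o).comp (tendsto_log_div_atTop hn hs)).congr' ?_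
  filter_upwards [hn] with N hN
  have hk0 : (0 : ℝ) < k N := Nat.cast_pos.2 (NeZero.pos _)
  have hn0 : 0 < n N := by
    rcases Nat.eq_zero_or_pos (n N) with h | h
    · rw [h] at hN
      simp at hN
      linarith
    · exact h
  have hpi := Real.pi_pos
  rw [rpow_two_div _ hn0, entropicTime_eq, Function.comp_apply]
  field_simp

include hk

/-- The entropy gap `α √v / √k` is divided by the slope, asymptotically `1 / (2 s₀)`; since `v → 1 /
2`, the relative shift times `√k` tends to `2 α √(1 / 2) = √2 α`. -/
lemma tendsto_sqrt_mul_cutoffLine_sub (α : ℝ) :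
    Tendsto (fun N => √(k N) * (cutoffLine o (k N) (n N) α -
      lineTime o (Real.log (n N) / k N)) / lineTime o (Real.log (n N) / k N)) atTop
      (𝓝 (√2 * α)) := by
  rcases eq_or_ne α 0 with rfl | hα
  · simp [cutoffLine_zero]
  have hT := (tendsto_lineTime_atTop o).comp (tendsto_log_div_atTop hn hs)
  have hne : ∀ᶠ N in atTop, lineTime o (Real.log (n N) / k N) ≠ cutoffLine o (k N) (n N) α := by
    rcases lt_or_gt_of_ne hα with h | h
    · filter_upwards [eventually_cutoffLine_sub o hk hn h] with N hN
      rw [cutoffLine_zero] at hN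
      exact hN.1.ne'
    · filter_upwards [eventually_cutoffLine_sub o hk hn h] with N hN
      rw [cutoffLine_zero] at hN
      exact hN.1.ne
  have hdiv := tendsto_cutoffLine_div o hk hn 0 α
  simp only [cutoffLine_zero] at hdiv
  have hR := tendsto_lineEntropy_slope o hT hdiv hne
  have hv : Tendsto (fun N => α * √(lineVar o (lineTime o (Real.log (n N) / k N)))) atTop
      (𝓝 (α * √(1 / 2))) := (((tendsto_lineVar o).comp hT).sqrt).const_mul α
  have hq := hv.div hR (by norm_num)
  have hval : α * √(1 / 2) / (1 / 2) = √2 * α := by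
    have h2 : √(2 : ℝ) * √2 = 2 := Real.mul_self_sqrt (by norm_num)
    have h2' : 0 < √(2 : ℝ) := Real.sqrt_pos.2 (by norm_num)
    rw [one_div, Real.sqrt_inv]
    field_simp
    linarith
  rw [hval] at hq
  refine hq.congr' ?_
  filter_upwards [hne, eventually_lineEntropy_cutoffLine o hk hn α,
    eventually_lineEntropy_cutoffLine o hk hn 0, eventually_one_le_cutoffLine o hk hn 0]
    with N h1 h2 h3 h4
  rw [cutoffLine_zero] at h3 h4
  have hk0 : (0 : ℝ) < k N := Nat.cast_pos.2 (NeZero.pos _)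
  have hsk := Real.sqrt_pos.2 hk0
  have hv0 := Real.sqrt_pos.2 (lineVar_pos o (show 0 < lineTime o (Real.log (n N) / k N) by linarith))
  simp only [Pi.div_apply, Function.comp_apply]
  rw [h2.2, h3.2]
  have hd : cutoffLine o (k N) (n N) α - lineTime o (Real.log (n N) / k N) ≠ 0 :=
    sub_ne_zero.2 h1.symm
  set s₀ := lineTime o (Real.log (n N) / k N)
  set d := cutoffLine o (k N) (n N) α - s₀
  have hs0 : s₀ ≠ 0 := by linarith
  rw [zero_mul, add_zero, add_sub_cancel_left]
  field_simp

/-- The relative shift `√2 α / √k` times `t₀ ~ k n^{2/k} / (2 π e)`; the constant is `√2 / 2 = 1 /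
√2`. -/
lemma tendsto_cutoffTime_sub_div (α : ℝ) :
    Tendsto (fun N => (cutoffTime o (k N) (n N) α - entropicTime o (k N) (n N)) /
      (√(k N) * (n N : ℝ) ^ (2 / (k N : ℝ)) / (√2 * Real.pi * Real.exp 1))) atTop (𝓝 α) := by
  have h2' : 0 < √(2 : ℝ) := Real.sqrt_pos.2 (by norm_num)
  have h := ((tendsto_sqrt_mul_cutoffLine_sub o hk hn hs α).mul
    (tendsto_entropicTime_div o hn hs)).div_const √2
  rw [mul_one, mul_div_cancel_left₀ _ h2'.ne'] at h
  refine h.congr' ?_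
  filter_upwards [hn, eventually_cutoffTime_eq o hk hn α, eventually_one_le_cutoffLine o hk hn 0]
    with N hN h1 h4
  rw [cutoffLine_zero] at h4
  have hk0 : (0 : ℝ) < k N := Nat.cast_pos.2 (NeZero.pos _)
  have hsk := Real.sqrt_pos.2 hk0
  have hn0 : 0 < n N := by
    rcases Nat.eq_zero_or_pos (n N) with h | h
    · rw [h] at hN
      simp at hN
      linarith
    · exact h
  have hpi := Real.pi_pos
  have h22 : √(2 : ℝ) ^ 2 = 2 := Real.sq_sqrt (by norm_num)
  have hkk : √(k N : ℝ) ^ 2 = k N := Real.sq_sqrt hk0.le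
  rw [h1, rpow_two_div _ hn0, entropicTime_eq]
  set s₀ := lineTime o (Real.log (n N) / k N)
  have hs0 : s₀ ≠ 0 := by linarith
  rw [← mul_sub]
  set d := cutoffLine o (k N) (n N) α - s₀
  field_simp
  rw [h22, hkk]
  ring

end Sparse

/-! ### Total variation distance and its monotonicity in time -/

section TotalVariation

variable {G : Type*} [Fintype G]

lemma abs_sub_le_tvToUniform (p : PMF G) (A : Finset G) :
    |(∑ x ∈ A, (p x).toReal) - (A.card : ℝ) / Fintype.card G| ≤ tvToUniform p :=
  le_ciSup (f := fun A : Finset G => |(∑ x ∈ A, (p x).toReal) - (A.card : ℝ) / Fintype.card G|)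
    (Set.finite_range _).bddAbove A

lemma tvToUniform_nonneg (p : PMF G) : 0 ≤ tvToUniform p :=
  (abs_nonneg _).trans (abs_sub_le_tvToUniform p ∅)

/-- Passing to the complement reverses the sign of the deviation, so a one-sided bound over all sets
suffices. -/
lemma tvToUniform_le {p : PMF G} {c : ℝ}
    (h : ∀ A : Finset G, (A.card : ℝ) / Fintype.card G - ∑ x ∈ A, (p x).toReal ≤ c) :
    tvToUniform p ≤ c := by
  classical
  refine ciSup_le fun A => abs_le.2 ⟨by linarith [h A], ?_⟩
  have h1 := h Aᶜ
  have h2 : ∑ x ∈ A, (p x).toReal + ∑ x ∈ Aᶜ, (p x).toReal = 1 := by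
    rw [Finset.sum_add_sum_compl, ← tsum_fintype (L := .unconditional G), tsum_toReal]
  have hne : Nonempty G := ⟨p.support_nonempty.some⟩
  have hn : (0 : ℝ) < Fintype.card G := Nat.cast_pos.2 Fintype.card_pos
  have h3 : (A.card : ℝ) / Fintype.card G + (Aᶜ.card : ℝ) / Fintype.card G = 1 := by
    rw [← add_div, ← Nat.cast_add, Finset.card_add_card_compl, div_self hn.ne']
  linarith

lemma tvToUniform_le_one (p : PMF G) : tvToUniform p ≤ 1 := by
  refine tvToUniform_le fun A => ?_
  have h1 : (A.card : ℝ) / Fintype.card G ≤ 1 :=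
    div_le_one_of_le₀ (Nat.cast_le.2 A.card_le_univ) (Nat.cast_nonneg _)
  have h2 : 0 ≤ ∑ x ∈ A, (p x).toReal := Finset.sum_nonneg fun _ _ => ENNReal.toReal_nonneg
  linarith

lemma sum_map_toReal {V : Type*} [MeasurableSpace V] [DiscreteMeasurableSpace V] (q : PMF V)
    (f : V → G) (A : Finset G) :
    ∑ x ∈ A, ((q.map f) x).toReal = q.toMeasure.real {v | f v ∈ A} := by
  let _ : MeasurableSpace G := ⊤
  rw [← ENNReal.toReal_sum fun x _ => (q.map f).apply_ne_top x, ← PMF.toMeasure_apply_finset,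
    ← PMF.toMeasure_map f q (Measurable.of_discrete), Measure.map_apply Measurable.of_discrete
      (MeasurableSet.of_discrete)]
  rfl

/-- Given `v`, the probability of `A` is that of a translate of `A` under `P`, and translates have
the same cardinality. Averaging over `v` preserves the bound. -/
lemma tvToUniform_bind_le [AddCommGroup G] {V : Type*} (q : PMF V) (P : PMF G) (f : V → G) :
    tvToUniform (q.bind fun v => P.map fun x => f v + x) ≤ tvToUniform P := by
  classical
  refine tvToUniform_le fun A => ?_
  have htr : ∀ v, ∑ x ∈ A, ((P.map fun x => f v + x) x).toReal =
      ∑ x ∈ A.image fun x => -f v + x, (P x).toReal := by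
    intro v
    let _ : MeasurableSpace G := ⊤
    rw [sum_map_toReal]
    have h := sum_map_toReal P id (A.image fun x => -f v + x)
    rw [PMF.map_id] at h
    rw [h]
    congr 1
    ext x
    simp only [id, Set.mem_ofPred_eq, Finset.mem_image]
    refine ⟨fun hx => ⟨_, hx, by abel⟩, ?_⟩
    rintro ⟨y, hy, rfl⟩
    simpa using hy
  have hsum : HasSum (fun v => (q v).toReal * ∑ x ∈ A, ((P.map fun x => f v + x) x).toReal)
      (∑ x ∈ A, ((q.bind fun v => P.map fun x => f v + x) x).toReal) := by
    simp only [Finset.mul_sum]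
    refine hasSum_sum fun x _ => ?_
    rw [bind_apply_toReal]
    refine (Summable.of_nonneg_of_le (fun v => by positivity) (fun v => ?_)
      (summable_toReal q)).hasSum
    refine mul_le_of_le_one_right ENNReal.toReal_nonneg ?_
    exact ENNReal.toReal_le_of_le_ofReal zero_le_one
      (by rw [ENNReal.ofReal_one]; exact PMF.coe_le_one _ _)
  have hq : HasSum (fun v => (q v).toReal) 1 := by
    have := (summable_toReal q).hasSum
    rwa [tsum_toReal] at this
  have hle : ∀ v, (q v).toReal * ((A.card : ℝ) / Fintype.card G - tvToUniform P) ≤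
      (q v).toReal * ∑ x ∈ A, ((P.map fun x => f v + x) x).toReal := by
    intro v
    refine mul_le_mul_of_nonneg_left ?_ ENNReal.toReal_nonneg
    have h := (abs_le.1 (abs_sub_le_tvToUniform P (A.image fun x => -f v + x))).1
    rw [Finset.card_image_of_injective _ (add_right_injective _)] at h
    rw [htr]
    linarith
  have := hasSum_le hle (hq.mul_right _) hsum
  linarith

end TotalVariation

lemma sum_walkLaw {G : Type*} [AddCommGroup G] [Fintype G] {k : ℕ} [NeZero k] (o : CayleyKind)
    (z : Fin k → G) {t : ℝ} (ht : 0 ≤ t) (A : Finset G) :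
    ∑ x ∈ A, (walkLaw o z t x).toReal =
      (prodMeasure o k (t / k)).real {w | combHom z w ∈ A} := by
  rw [walkLaw_eq_map, sum_map_toReal, auxLaw_toMeasure o k ht]

lemma tvDist_add_le {G : Type*} [AddCommGroup G] [Fintype G] {k : ℕ} [NeZero k] (o : CayleyKind)
    (z : Fin k → G) {t u : ℝ} (ht : 0 ≤ t) (hu : 0 ≤ u) : tvDist o z (t + u) ≤ tvDist o z t := by
  have h : walkLaw o z (t + u) =
      (auxLaw o k u).bind fun w => (walkLaw o z t).map fun x => combHom z w + x := by
    rw [walkLaw_eq_map, walkLaw_eq_map, add_comm t u, auxLaw_add o k hu ht, PMF.map_bind]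
    refine congrArg _ (funext fun w => ?_)
    rw [PMF.map_comp, PMF.map_comp]
    congr 1
    ext x
    simp
  rw [tvDist, h]
  exact tvToUniform_bind_le _ _ _

lemma tvDist_antitoneOn {G : Type*} [AddCommGroup G] [Fintype G] {k : ℕ} [NeZero k]
    (o : CayleyKind) (z : Fin k → G) : AntitoneOn (tvDist o z) (Set.Ici 0) := by
  intro t ht u _ htu
  have := tvDist_add_le o z ht (sub_nonneg.2 htu)
  rwa [add_sub_cancel] at this

/-! ### Lower bound for every choice of generators -/

lemma prodMeasure_real_singleton (o : CayleyKind) (k : ℕ) (s : ℝ) (w : Fin k → ℤ) :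
    (prodMeasure o k s).real {w} = ∏ i, mass o s (w i) := by
  rw [Measure.real, Measure.pi_singleton, ENNReal.toReal_prod]
  exact Finset.prod_congr rfl fun i _ => lineMeasure_real_singleton o s (w i)

lemma ae_mass_pos_prod (o : CayleyKind) (k : ℕ) (s : ℝ) :
    ∀ᵐ w ∂(prodMeasure o k s), ∀ i, 0 < mass o s (w i) := by
  rw [ae_iff_of_countable]
  intro w hw i
  rw [Measure.pi_singleton] at hw
  have h := Finset.prod_ne_zero_iff.1 hw i (Finset.mem_univ i)
  rw [← lineMeasure_real_singleton]
  exact ENNReal.toReal_pos h (measure_ne_top _ _)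

lemma prod_mass_eq_exp (o : CayleyKind) {k : ℕ} {s : ℝ} {w : Fin k → ℤ}
    (h : ∀ i, 0 < mass o s (w i)) :
    ∏ i, mass o s (w i) = Real.exp (-∑ i, surp o s (w i)) := by
  rw [← Finset.sum_neg_distrib, Real.exp_sum]
  refine Finset.prod_congr rfl fun i _ => ?_
  rw [surp, neg_neg, Real.exp_log (h i)]

/-- For every choice of generators the walk is far from uniform while the auxiliary walk puts
mass on points of probability much larger than `1 / n`. -/
lemma prob_sum_surp_le_sub_le_tvDist {G : Type*} [AddCommGroup G] [Fintype G] {k : ℕ} [NeZero k]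
    (o : CayleyKind) (z : Fin k → G) {s : ℝ} (hs : 0 ≤ s) (ω : ℝ) :
    (prodMeasure o k s).real {w | ∑ i, surp o s (w i) ≤ Real.log (Fintype.card G) - ω} -
      Real.exp (-ω) ≤ tvDist o z (k * s) := by
  classical
  have hk : (0 : ℝ) < k := Nat.cast_pos.2 (NeZero.pos k)
  have hn : (0 : ℝ) < Fintype.card G := Nat.cast_pos.2 Fintype.card_pos
  set μ := prodMeasure o k s
  -- At most `1 / c` points have mass at least `c`, which is a proportion `exp (-ω)` of the group.
  set c : ℝ := Real.exp ω / Fintype.card G with hc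
  have hc0 : 0 < c := by positivity
  set B : Set (Fin k → ℤ) := {w | c ≤ ∏ i, mass o s (w i)} with hB
  have hcard : ∀ F : Finset (Fin k → ℤ), (F : Set (Fin k → ℤ)) ⊆ B → (F.card : ℝ) ≤ 1 / c := by
    intro F hF
    rw [le_div_iff₀ hc0]
    calc (F.card : ℝ) * c = ∑ _w ∈ F, c := by rw [Finset.sum_const, nsmul_eq_mul]
      _ ≤ ∑ w ∈ F, μ.real {w} := Finset.sum_le_sum fun w hw => by
          rw [prodMeasure_real_singleton]; exact hF hw
      _ = μ.real F := sum_measureReal_singleton F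
      _ ≤ 1 := measureReal_le_one
  have hfin : B.Finite := by
    by_contra hinf
    obtain ⟨F, hF, hFc⟩ := Set.Infinite.exists_subset_card_eq hinf (⌊1 / c⌋₊ + 1)
    have := hcard F hF
    rw [hFc] at this
    push_cast at this
    linarith [Nat.lt_floor_add_one (1 / c)]
  have hle : μ.real {w | ∑ i, surp o s (w i) ≤ Real.log (Fintype.card G) - ω} ≤ μ.real B := by
    refine ENNReal.toReal_mono (measure_ne_top _ _) (measure_mono_ae ?_)
    filter_upwards [ae_mass_pos_prod o k s] with w hw hle
    change c ≤ ∏ i, mass o s (w i)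
    rw [prod_mass_eq_exp o hw, hc, ← Real.exp_log hn, ← Real.exp_sub, Real.exp_le_exp]
    have : ∑ i, surp o s (w i) ≤ Real.log (Fintype.card G) - ω := hle
    linarith
  set A : Finset G := hfin.toFinset.image (combHom z) with hA
  have hAcard : (A.card : ℝ) / Fintype.card G ≤ Real.exp (-ω) := by
    have h1 : (A.card : ℝ) ≤ 1 / c :=
      (Nat.cast_le.2 Finset.card_image_le).trans (hcard _ (by simp))
    rw [div_le_iff₀ hn, Real.exp_neg]
    refine h1.trans_eq ?_
    rw [hc]
    field_simp
  have hBA : μ.real B ≤ ∑ x ∈ A, (walkLaw o z (k * s) x).toReal := by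
    rw [sum_walkLaw o z (mul_nonneg hk.le hs), mul_div_cancel_left₀ _ hk.ne']
    refine measureReal_mono (fun w hw => ?_)
    exact Finset.mem_image_of_mem _ (hfin.mem_toFinset.2 hw)
  have := (le_abs_self _).trans (abs_sub_le_tvToUniform (walkLaw o z (k * s)) A)
  rw [tvDist]
  linarith

/-! ### Collision probabilities and the second moment -/

lemma exists_content {k : ℕ} (v : Fin k → ℤ) :
    ∃ γ : ℕ, (∀ i, (γ : ℤ) ∣ v i) ∧ ∃ u : Fin k → ℤ, ∑ i, u i * v i = γ := by
  obtain ⟨g, hg⟩ := (IsPrincipalIdealRing.principal (Ideal.span (Set.range v))).principal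
  have hdvd : ∀ i, g ∣ v i := fun i => by
    have h : v i ∈ Ideal.span (Set.range v) := Ideal.subset_span ⟨i, rfl⟩
    rw [hg] at h
    exact Ideal.mem_span_singleton.1 h
  refine ⟨g.natAbs, fun i => Int.natAbs_dvd.2 (hdvd i), ?_⟩
  rw [← Ideal.mem_span_range_iff_exists_fun, hg]
  exact Ideal.mem_span_singleton.2 (Int.dvd_natAbs.2 dvd_rfl)

section Group

variable {G : Type*} [AddCommGroup G] [Fintype G]

/-- Every coset of `γ G` has a representative that combines `d` generators with coefficients in `{0,
…, γ - 1}`, because multiples of `γ` can be dropped from the coefficients. -/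
lemma index_range_nsmul_le {γ : ℕ} (hγ : 0 < γ) :
    (nsmulAddMonoidHom γ : G →+ G).range.index ≤ γ ^ AddGroup.rank G := by
  obtain ⟨S, hS, hcl⟩ := AddGroup.rank_spec G
  rw [← hS, AddSubgroup.index]
  set H := (nsmulAddMonoidHom γ : G →+ G).range with hH
  have hsurj : Function.Surjective
      (fun a : S → Fin γ => ((∑ x : S, (a x : ℕ) • (x : G) : G) : G ⧸ H)) := by
    intro q
    obtain ⟨g, rfl⟩ := QuotientAddGroup.mk_surjective q
    have hg : g ∈ Submodule.span ℤ (S : Set G) := by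
      rw [← Submodule.mem_toAddSubgroup, Submodule.span_int_eq_addSubgroupClosure, hcl]
      trivial
    obtain ⟨c, -, hc⟩ := Submodule.mem_span_finset.1 hg
    have hγ' : (0 : ℤ) < γ := by exact_mod_cast hγ
    have hmod : ∀ x, 0 ≤ c x % γ := fun x => Int.emod_nonneg _ hγ'.ne'
    have hlt : ∀ x, (c x % γ).toNat < γ := fun x => by
      have := Int.emod_lt_of_pos (c x) hγ'
      have := hmod x
      omega
    refine ⟨fun x => ⟨(c x % γ).toNat, hlt x⟩, ?_⟩
    simp only
    rw [QuotientAddGroup.eq, hH]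
    refine ⟨∑ x : S, (c x / γ) • (x : G), ?_⟩
    rw [← hc, ← Finset.sum_coe_sort S, nsmulAddMonoidHom_apply, Finset.smul_sum,
      eq_neg_add_iff_add_eq, ← Finset.sum_add_distrib]
    refine Finset.sum_congr rfl fun x _ => ?_
    rw [← natCast_zsmul, ← natCast_zsmul, smul_smul, ← add_smul, Int.toNat_of_nonneg (hmod x),
      Int.emod_add_mul_ediv]
  have hc : Nat.card (S → Fin γ) = γ ^ S.card := by
    classical
    rw [Nat.card_eq_fintype_card]
    simp
  exact (Nat.card_le_card_of_surjective _ hsurj).trans_eq hc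

/-- The relation is the kernel of the homomorphism `z ↦ ∑ v i • z i`. Bézout's identity `hu` shows
that the image contains `γ G`, hence has index at most `γ ^ d`; the kernel is counted by Lagrange's
theorem. -/
lemma card_mul_card_relation_le [DecidableEq G] {k γ : ℕ} (hγ : 0 < γ) {v u : Fin k → ℤ}
    (hu : ∑ i, u i * v i = γ) :
    Fintype.card G * (Finset.univ.filter fun z : Fin k → G => ∑ i, v i • z i = 0).card ≤
      γ ^ AddGroup.rank G * Fintype.card G ^ k := by
  set ψ : (Fin k → G) →+ G := AddMonoidHom.mk' (fun z => ∑ i, v i • z i) (fun a b => by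
    simp [Finset.sum_add_distrib]) with hψ
  have hker : (Finset.univ.filter fun z : Fin k → G => ∑ i, v i • z i = 0).card =
      Nat.card ψ.ker := by
    rw [Nat.card_eq_fintype_card, Fintype.card_subtype]
    congr 1
    ext z
    simp only [Finset.mem_filter, AddMonoidHom.mem_ker]
    rfl
  have hle : (nsmulAddMonoidHom γ : G →+ G).range ≤ ψ.range := by
    rintro _ ⟨g, rfl⟩
    refine ⟨fun i => u i • g, ?_⟩
    change ∑ i, v i • u i • g = γ • g
    simp only [smul_smul]
    rw [← Finset.sum_smul, ← natCast_zsmul, ← hu]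
    congr 1
    exact Finset.sum_congr rfl fun i _ => mul_comm _ _
  have h1 := ψ.ker.card_mul_index
  have h2 := ψ.range.card_mul_index
  rw [AddSubgroup.index_ker, Nat.card_eq_fintype_card (α := Fin k → G), Fintype.card_fun,
    Fintype.card_fin] at h1
  rw [Nat.card_eq_fintype_card (α := G)] at h2
  have h3 := (AddSubgroup.index_antitone hle).trans (index_range_nsmul_le (G := G) hγ)
  rw [hker]
  calc Fintype.card G * Nat.card ψ.ker = ψ.range.index * Fintype.card G ^ k := by
        rw [← h1, ← h2]; ring
    _ ≤ _ := Nat.mul_le_mul_right _ h3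

/-- The true greatest common divisor depends on the pair. Summing over all `γ` from 2 to `L` with
the indicator that `γ` divides every difference replaces it by terms that factorise over
coordinates. The summand `1` covers coprime differences, and `L` bounds the divisor of any nonzero
difference. -/
lemma card_mul_card_collision_le [DecidableEq G] {k L : ℕ} {w w' : Fin k → ℤ}
    (hL : ∀ i, |w i - w' i| ≤ L) :
    (Fintype.card G : ℝ) * (Finset.univ.filter fun z : Fin k → G =>
        combHom z w = combHom z w').card ≤
      (Fintype.card G : ℝ) ^ k * ((if w = w' then (Fintype.card G : ℝ) else 0) + 1 +
        ∑ γ ∈ Finset.Icc 2 L, (γ : ℝ) ^ AddGroup.rank G *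
          if ∀ i, (γ : ℤ) ∣ w i - w' i then 1 else 0) := by
  have hsum : ∀ γ : ℕ, (0 : ℝ) ≤ (γ : ℝ) ^ AddGroup.rank G *
      if ∀ i, (γ : ℤ) ∣ w i - w' i then 1 else 0 := fun γ => by positivity
  have hn : (0 : ℝ) < Fintype.card G := Nat.cast_pos.2 Fintype.card_pos
  by_cases hww : w = w'
  · have h1 : ((Finset.univ.filter fun z : Fin k → G => combHom z w = combHom z w').card : ℝ) ≤
        (Fintype.card G : ℝ) ^ k := by
      have := Finset.card_le_univ (Finset.univ.filter fun z : Fin k → G =>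
        combHom z w = combHom z w')
      rw [Fintype.card_fun, Fintype.card_fin] at this
      exact_mod_cast this
    have h2 := Finset.sum_nonneg fun γ (_ : γ ∈ Finset.Icc 2 L) => hsum γ
    rw [if_pos hww, mul_comm]
    refine mul_le_mul h1 (by linarith) hn.le (by positivity)
  · obtain ⟨γ, hdvd, u, hu⟩ := exists_content (w - w')
    obtain ⟨i, hi⟩ := Function.ne_iff.1 hww
    have hi' : w i - w' i ≠ 0 := sub_ne_zero.2 hi
    have hγ0 : 0 < γ := by
      rcases Nat.eq_zero_or_pos γ with h | h
      · have := hdvd i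
        rw [h, Nat.cast_zero, zero_dvd_iff] at this
        exact absurd this hi'
      · exact h
    have hγL : γ ≤ L := by
      have h1 := Int.le_of_dvd (abs_pos.2 hi') ((dvd_abs _ _).2 (hdvd i))
      exact_mod_cast h1.trans (hL i)
    have hset : (Finset.univ.filter fun z : Fin k → G => combHom z w = combHom z w') =
        Finset.univ.filter fun z : Fin k → G => ∑ i, (w - w') i • z i = 0 := by
      ext z
      simp only [Finset.mem_filter, Finset.mem_univ, true_and]
      rw [← combHom_apply, map_sub, sub_eq_zero]
    have hcard : (Fintype.card G : ℝ) * (Finset.univ.filter fun z : Fin k → G =>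
        combHom z w = combHom z w').card ≤ (γ : ℝ) ^ AddGroup.rank G * Fintype.card G ^ k := by
      rw [hset]
      exact_mod_cast card_mul_card_relation_le (G := G) hγ0 hu
    have hone : (γ : ℝ) ^ AddGroup.rank G ≤ 1 + ∑ γ ∈ Finset.Icc 2 L, (γ : ℝ) ^ AddGroup.rank G *
          if ∀ i, (γ : ℤ) ∣ w i - w' i then 1 else 0 := by
      rcases Nat.lt_or_ge γ 2 with h | h
      · have : γ = 1 := by omega
        rw [this]
        have h2 := Finset.sum_nonneg fun γ (_ : γ ∈ Finset.Icc 2 L) => hsum γ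
        simp only [Nat.cast_one, one_pow]
        linarith
      · have h2 := Finset.single_le_sum (f := fun γ : ℕ => (γ : ℝ) ^ AddGroup.rank G *
          if ∀ i, (γ : ℤ) ∣ w i - w' i then (1 : ℝ) else 0) (fun γ _ => hsum γ)
          (Finset.mem_Icc.2 ⟨h, hγL⟩)
        have h3 : ∀ i, (γ : ℤ) ∣ w i - w' i := hdvd
        simp only [if_pos h3, mul_one] at h2
        linarith
    rw [if_neg hww, zero_add]
    refine hcard.trans ?_
    rw [mul_comm]
    exact mul_le_mul_of_nonneg_left hone (by positivity)

/-- The part of the law of the walk that comes from a finite set of values of the auxiliary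
walk. -/
noncomputable def partialLaw [DecidableEq G] {k : ℕ} (z : Fin k → G) (T : Finset (Fin k → ℤ))
    (f : (Fin k → ℤ) → ℝ) (x : G) : ℝ := ∑ w ∈ T, if combHom z w = x then f w else 0

lemma sum_partialLaw [DecidableEq G] {k : ℕ} (z : Fin k → G) (T : Finset (Fin k → ℤ))
    (f : (Fin k → ℤ) → ℝ) : ∑ x, partialLaw z T f x = ∑ w ∈ T, f w := by
  simp only [partialLaw]
  rw [Finset.sum_comm]
  simp

lemma sum_partialLaw_sq [DecidableEq G] {k : ℕ} (T : Finset (Fin k → ℤ))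
    (f : (Fin k → ℤ) → ℝ) :
    ∑ z : Fin k → G, ∑ x, partialLaw z T f x ^ 2 = ∑ w ∈ T, ∑ w' ∈ T, f w * f w' *
      (Finset.univ.filter fun z : Fin k → G => combHom z w = combHom z w').card := by
  have h1 : ∀ z : Fin k → G, ∑ x, partialLaw z T f x ^ 2 =
      ∑ w ∈ T, ∑ w' ∈ T, f w * f w' * if combHom z w = combHom z w' then 1 else 0 := by
    intro z
    simp only [partialLaw, sq, Finset.sum_mul_sum]
    rw [Finset.sum_comm]
    refine Finset.sum_congr rfl fun w _ => ?_
    rw [Finset.sum_comm]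
    refine Finset.sum_congr rfl fun w' _ => ?_
    rw [Finset.sum_eq_single (combHom z w)]
    · rw [if_pos rfl]
      simp [eq_comm]
    · intro x _ hx
      rw [if_neg hx.symm, zero_mul]
    · simp
  simp only [h1]
  rw [Finset.sum_comm]
  refine Finset.sum_congr rfl fun w _ => ?_
  rw [Finset.sum_comm]
  refine Finset.sum_congr rfl fun w' _ => ?_
  rw [← Finset.mul_sum, Finset.sum_boole]

/-- Discarding the points outside `T` costs their mass `1 - m`. The rest `ν` has total `m`, and by
Cauchy–Schwarz `∑ |m / n - ν x|` is at most the square root of `n ∑ ν x² - m²`. -/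
lemma tvDist_le_partialLaw [DecidableEq G] {k : ℕ} [NeZero k] (o : CayleyKind) (z : Fin k → G)
    {s : ℝ} (hs : 0 ≤ s) (T : Finset (Fin k → ℤ)) :
    tvDist o z (k * s) ≤ (1 - ∑ w ∈ T, ∏ i, mass o s (w i)) +
      √((Fintype.card G : ℝ) * ∑ x, partialLaw z T (fun w => ∏ i, mass o s (w i)) x ^ 2 -
        (∑ w ∈ T, ∏ i, mass o s (w i)) ^ 2) := by
  have hk : (0 : ℝ) < k := Nat.cast_pos.2 (NeZero.pos k)
  have hn : (0 : ℝ) < Fintype.card G := Nat.cast_pos.2 Fintype.card_pos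
  set n : ℝ := (Fintype.card G : ℝ)
  set μ := prodMeasure o k s
  set f : (Fin k → ℤ) → ℝ := fun w => ∏ i, mass o s (w i) with hf
  have hfμ : ∀ w, f w = μ.real {w} := fun w => (prodMeasure_real_singleton o k s w).symm
  set ν := partialLaw z T f
  set m := ∑ w ∈ T, f w with hm
  have hνm : ∑ x, ν x = m := sum_partialLaw z T f
  have hm1 : m ≤ 1 := by
    rw [hm]
    simp only [hfμ]
    rw [sum_measureReal_singleton]
    exact measureReal_le_one
  refine tvToUniform_le fun A => ?_
  have hA1 : (A.card : ℝ) / n ≤ 1 :=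
    div_le_one_of_le₀ (Nat.cast_le.2 A.card_le_univ) (Nat.cast_nonneg _)
  have hlow : ∑ x ∈ A, ν x ≤ ∑ x ∈ A, (walkLaw o z (k * s) x).toReal := by
    rw [sum_walkLaw o z (mul_nonneg hk.le hs), mul_div_cancel_left₀ _ hk.ne']
    have : ∑ x ∈ A, ν x = μ.real (T.filter fun w => combHom z w ∈ A : Finset (Fin k → ℤ)) := by
      rw [← sum_measureReal_singleton, Finset.sum_filter]
      simp only [ν, partialLaw]
      rw [Finset.sum_comm]
      refine Finset.sum_congr rfl fun w _ => ?_
      rw [Finset.sum_ite_eq, hfμ]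
    rw [this]
    refine measureReal_mono fun w hw => ?_
    exact (Finset.mem_filter.1 (Finset.mem_coe.1 hw)).2
  have hdev : (A.card : ℝ) * (m / n) - ∑ x ∈ A, ν x ≤ √(n * ∑ x, ν x ^ 2 - m ^ 2) := by
    have hcs : (∑ x, |m / n - ν x|) ^ 2 ≤ n * ∑ x, |m / n - ν x| ^ 2 := by
      have := sq_sum_le_card_mul_sum_sq (s := Finset.univ) (f := fun x => |m / n - ν x|)
      simpa using this
    have hvar : n * ∑ x, |m / n - ν x| ^ 2 = n * ∑ x, ν x ^ 2 - m ^ 2 := by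
      have : ∀ x, |m / n - ν x| ^ 2 = (m / n) ^ 2 - 2 * (m / n) * ν x + ν x ^ 2 := fun x => by
        rw [sq_abs]; ring
      simp only [this]
      rw [Finset.sum_add_distrib, Finset.sum_sub_distrib, ← Finset.mul_sum, hνm]
      simp only [Finset.sum_const, Finset.card_univ, nsmul_eq_mul]
      change n * (n * (m / n) ^ 2 - 2 * (m / n) * m + ∑ x, ν x ^ 2) = _
      field_simp
      ring
    rw [hvar] at hcs
    calc (A.card : ℝ) * (m / n) - ∑ x ∈ A, ν x = ∑ x ∈ A, (m / n - ν x) := by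
          rw [Finset.sum_sub_distrib, Finset.sum_const, nsmul_eq_mul]
      _ ≤ ∑ x ∈ A, |m / n - ν x| := Finset.sum_le_sum fun x _ => le_abs_self _
      _ ≤ ∑ x, |m / n - ν x| := Finset.sum_le_sum_of_subset_of_nonneg (Finset.subset_univ _)
          fun _ _ _ => abs_nonneg _
      _ ≤ _ := Real.le_sqrt_of_sq_le hcs
  have hsplit : (A.card : ℝ) / n = A.card * (m / n) + A.card / n * (1 - m) := by
    field_simp
    ring
  have : (A.card : ℝ) / n * (1 - m) ≤ 1 - m := mul_le_of_le_one_left (by linarith) hA1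
  linarith

end Group

/-- After enlarging `T` to the box of side `J`, the double sum is a product over independent
coordinates of one-dimensional divisibility probabilities. -/
lemma sum_sum_dvd_le (o : CayleyKind) {k γ : ℕ} {s : ℝ} (hs : 0 < s) (hγ : 0 < γ) (J : Finset ℤ)
    {T : Finset (Fin k → ℤ)} (hT : T ⊆ Fintype.piFinset fun _ => J) :
    ∑ w ∈ T, ∑ w' ∈ T, (∏ i, mass o s (w i)) * (∏ i, mass o s (w' i)) *
      (if ∀ i, (γ : ℤ) ∣ w i - w' i then 1 else 0) ≤ (1 / γ + 0.45 / √s) ^ k := by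
  set f : ℤ → ℤ → ℝ := fun x y => mass o s x * mass o s y * if (γ : ℤ) ∣ x - y then 1 else 0
    with hf
  have hf0 : ∀ x y, 0 ≤ f x y := fun x y => by
    have := mass_nonneg o s x
    have := mass_nonneg o s y
    simp only [hf]
    positivity
  have hprod : ∀ w w' : Fin k → ℤ, (∏ i, mass o s (w i)) * (∏ i, mass o s (w' i)) *
      (if ∀ i, (γ : ℤ) ∣ w i - w' i then 1 else 0) = ∏ i, f (w i) (w' i) := by
    intro w w'
    simp only [hf]
    rw [Finset.prod_mul_distrib, Finset.prod_mul_distrib, Finset.prod_boole]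
    simp
  have hone : ∑ x ∈ J, ∑ y ∈ J, f x y ≤ 1 / γ + 0.45 / √s := by
    refine le_trans ?_ (prob_dvd_sub_le o hs hγ)
    rw [← Finset.sum_product']
    have : ∑ p ∈ J ×ˢ J, f p.1 p.2 = ((lineMeasure o s).prod (lineMeasure o s)).real
        ((J ×ˢ J).filter fun p => (γ : ℤ) ∣ p.1 - p.2 : Finset (ℤ × ℤ)) := by
      rw [← sum_measureReal_singleton, Finset.sum_filter]
      refine Finset.sum_congr rfl fun p _ => ?_
      rw [← Set.singleton_prod_singleton, measureReal_prod_prod, lineMeasure_real_singleton,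
        lineMeasure_real_singleton]
      simp [hf]
    rw [this]
    refine measureReal_mono fun p hp => ?_
    exact (Finset.mem_filter.1 (Finset.mem_coe.1 hp)).2
  simp only [hprod]
  calc ∑ w ∈ T, ∑ w' ∈ T, ∏ i, f (w i) (w' i)
      ≤ ∑ w ∈ Fintype.piFinset fun _ : Fin k => J, ∑ w' ∈ Fintype.piFinset fun _ : Fin k => J,
          ∏ i, f (w i) (w' i) := by
        have h0 : ∀ w w' : Fin k → ℤ, 0 ≤ ∏ i, f (w i) (w' i) := fun w w' =>
          Finset.prod_nonneg fun i _ => hf0 _ _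
        refine (Finset.sum_le_sum fun w _ => Finset.sum_le_sum_of_subset_of_nonneg hT
          fun w' _ _ => h0 w w').trans ?_
        exact Finset.sum_le_sum_of_subset_of_nonneg hT fun w _ _ =>
          Finset.sum_nonneg fun w' _ => h0 w w'
    _ = ∑ w ∈ Fintype.piFinset fun _ : Fin k => J, ∏ i, ∑ y ∈ J, f (w i) y := by
        refine Finset.sum_congr rfl fun w _ => ?_
        rw [Finset.prod_univ_sum]
    _ = (∑ x ∈ J, ∑ y ∈ J, f x y) ^ k := by
        rw [← Finset.prod_univ_sum (fun _ : Fin k => J) fun _ x => ∑ y ∈ J, f x y]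
        simp
    _ ≤ _ := pow_le_pow_left₀ (Finset.sum_nonneg fun x _ => Finset.sum_nonneg fun y _ => hf0 x y)
        hone k

/-- The error in the second moment bound: `c` bounds `n` times the probability of a typical point
of the auxiliary walk, and the sum is over the possible values of the greatest common divisor. -/
noncomputable def momentError (k d L : ℕ) (s c : ℝ) : ℝ :=
  c + ∑ γ ∈ Finset.Icc 2 L, (γ : ℝ) ^ d * (1 / γ + 0.45 / √s) ^ k

/-- Second moment bound for the number of bad choices of generators. -/
lemma card_bad_generators_le {G : Type*} [AddCommGroup G] [Fintype G] {k : ℕ} [NeZero k]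
    (o : CayleyKind) {s c : ℝ} (hs : 0 < s) (hc : 0 ≤ c) {L : ℕ} (J : Finset ℤ)
    (hJ : ∀ x ∈ J, ∀ y ∈ J, |x - y| ≤ L)
    {T : Finset (Fin k → ℤ)} (hT : T ⊆ Fintype.piFinset fun _ => J)
    (hTc : ∀ w ∈ T, Fintype.card G * ∏ i, mass o s (w i) ≤ c) {δ : ℝ} (hδ : 0 < δ) :
    δ ^ 2 * ({z : Fin k → G | (1 - ∑ w ∈ T, ∏ i, mass o s (w i)) + δ <
      tvDist o z (k * s)} : Set _).ncard ≤
      (Fintype.card G : ℝ) ^ k * momentError k (AddGroup.rank G) L s c := by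
  classical
  set f : (Fin k → ℤ) → ℝ := fun w => ∏ i, mass o s (w i) with hf
  have hf0 : ∀ w, 0 ≤ f w := fun w => Finset.prod_nonneg fun i _ => mass_nonneg o s _
  set n : ℝ := (Fintype.card G : ℝ) with hn
  have hn0 : 0 < n := Nat.cast_pos.2 Fintype.card_pos
  set m := ∑ w ∈ T, f w with hm
  have hm0 : 0 ≤ m := Finset.sum_nonneg fun w _ => hf0 w
  have hm1 : m ≤ 1 := by
    have : m = (prodMeasure o k s).real T := by
      rw [← sum_measureReal_singleton]
      exact Finset.sum_congr rfl fun w _ => (prodMeasure_real_singleton o k s w).symm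
    rw [this]
    exact measureReal_le_one
  set D : (Fin k → G) → ℝ := fun z => n * ∑ x, partialLaw z T f x ^ 2 - m ^ 2 with hD
  have hD0 : ∀ z, 0 ≤ D z := fun z => by
    have := sq_sum_le_card_mul_sum_sq (s := Finset.univ) (f := partialLaw z T f)
    rw [sum_partialLaw, Finset.card_univ] at this
    simp only [hD]
    linarith
  set E := Finset.univ.filter fun z : Fin k → G => (1 - m) + δ < tvDist o z (k * s) with hE
  have hEset : ({z : Fin k → G | (1 - m) + δ < tvDist o z (k * s)} : Set _).ncard = E.card := by
    rw [← Set.ncard_coe_finset, hE]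
    simp
  rw [hEset]
  -- Markov's inequality: on the bad set the deviation `√(D z)` exceeds `δ`.
  have hmarkov : δ ^ 2 * E.card ≤ ∑ z, D z := by
    calc δ ^ 2 * E.card = ∑ _z ∈ E, δ ^ 2 := by rw [Finset.sum_const, nsmul_eq_mul, mul_comm]
      _ ≤ ∑ z ∈ E, D z := Finset.sum_le_sum fun z hz => by
          have h1 := (Finset.mem_filter.1 hz).2
          have h2 := tvDist_le_partialLaw o z hs.le T
          have h3 : δ < √(D z) := by linarith
          exact (Real.lt_sqrt hδ.le).1 h3 |>.le
      _ ≤ ∑ z, D z := Finset.sum_le_sum_of_subset_of_nonneg (Finset.subset_univ _)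
          fun z _ _ => hD0 z
  refine hmarkov.trans ?_
  have hsum : ∑ z, D z = ∑ w ∈ T, ∑ w' ∈ T, f w * f w' * (n * (Finset.univ.filter
      fun z : Fin k → G => combHom z w = combHom z w').card) - n ^ k * m ^ 2 := by
    simp only [hD]
    rw [Finset.sum_sub_distrib, ← Finset.mul_sum, sum_partialLaw_sq, Finset.sum_const,
      Finset.card_univ, Fintype.card_fun, Fintype.card_fin, nsmul_eq_mul, Finset.mul_sum]
    push_cast
    congr 1
    refine Finset.sum_congr rfl fun w _ => ?_
    rw [Finset.mul_sum]
    exact Finset.sum_congr rfl fun w' _ => by ring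
  have hcol : ∑ w ∈ T, ∑ w' ∈ T, f w * f w' * (n * (Finset.univ.filter
      fun z : Fin k → G => combHom z w = combHom z w').card) ≤
      ∑ w ∈ T, ∑ w' ∈ T, f w * f w' * (n ^ k * ((if w = w' then n else 0) + 1 +
        ∑ γ ∈ Finset.Icc 2 L, (γ : ℝ) ^ AddGroup.rank G *
          if ∀ i, (γ : ℤ) ∣ w i - w' i then 1 else 0)) := by
    refine Finset.sum_le_sum fun w hw => Finset.sum_le_sum fun w' hw' => ?_
    refine mul_le_mul_of_nonneg_left ?_ (mul_nonneg (hf0 w) (hf0 w'))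
    refine card_mul_card_collision_le fun i => ?_
    exact hJ _ (Fintype.mem_piFinset.1 (hT hw) i) _ (Fintype.mem_piFinset.1 (hT hw') i)
  have hexp : ∑ w ∈ T, ∑ w' ∈ T, f w * f w' * (n ^ k * ((if w = w' then n else 0) + 1 +
        ∑ γ ∈ Finset.Icc 2 L, (γ : ℝ) ^ AddGroup.rank G *
          if ∀ i, (γ : ℤ) ∣ w i - w' i then 1 else 0)) =
      n ^ k * (∑ w ∈ T, f w * (n * f w) + m ^ 2 + ∑ γ ∈ Finset.Icc 2 L,
        (γ : ℝ) ^ AddGroup.rank G * ∑ w ∈ T, ∑ w' ∈ T, f w * f w' *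
          if ∀ i, (γ : ℤ) ∣ w i - w' i then 1 else 0) := by
    have e1 : ∑ w ∈ T, f w * (n * f w) =
        ∑ w ∈ T, ∑ w' ∈ T, f w * f w' * if w = w' then n else 0 := by
      refine Finset.sum_congr rfl fun w hw => ?_
      simp only [mul_ite, mul_zero]
      rw [Finset.sum_ite_eq, if_pos hw]
      ring
    have e2 : m ^ 2 = ∑ w ∈ T, ∑ w' ∈ T, f w * f w' := by
      rw [sq, hm, Finset.sum_mul_sum]
    have e3 : ∑ γ ∈ Finset.Icc 2 L, (γ : ℝ) ^ AddGroup.rank G * ∑ w ∈ T, ∑ w' ∈ T, f w * f w' *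
          (if ∀ i, (γ : ℤ) ∣ w i - w' i then 1 else 0) =
        ∑ w ∈ T, ∑ w' ∈ T, f w * f w' * ∑ γ ∈ Finset.Icc 2 L, (γ : ℝ) ^ AddGroup.rank G *
          if ∀ i, (γ : ℤ) ∣ w i - w' i then 1 else 0 := by
      simp only [Finset.mul_sum]
      rw [Finset.sum_comm]
      refine Finset.sum_congr rfl fun w _ => ?_
      rw [Finset.sum_comm]
      refine Finset.sum_congr rfl fun w' _ => Finset.sum_congr rfl fun γ _ => ?_
      ring
    rw [e1, e2, e3, ← Finset.sum_add_distrib, ← Finset.sum_add_distrib, Finset.mul_sum]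
    refine Finset.sum_congr rfl fun w _ => ?_
    rw [← Finset.sum_add_distrib, ← Finset.sum_add_distrib, Finset.mul_sum]
    exact Finset.sum_congr rfl fun w' _ => by ring
  rw [hsum]
  have hc1 : ∑ w ∈ T, f w * (n * f w) ≤ c := by
    calc ∑ w ∈ T, f w * (n * f w) ≤ ∑ w ∈ T, f w * c :=
          Finset.sum_le_sum fun w hw => mul_le_mul_of_nonneg_left (hTc w hw) (hf0 w)
      _ = m * c := by rw [← Finset.sum_mul]
      _ ≤ c := mul_le_of_le_one_left hc hm1
  have hc2 : ∑ γ ∈ Finset.Icc 2 L, (γ : ℝ) ^ AddGroup.rank G * ∑ w ∈ T, ∑ w' ∈ T, f w * f w' *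
          (if ∀ i, (γ : ℤ) ∣ w i - w' i then 1 else 0) ≤
      ∑ γ ∈ Finset.Icc 2 L, (γ : ℝ) ^ AddGroup.rank G * (1 / γ + 0.45 / √s) ^ k := by
    refine Finset.sum_le_sum fun γ hγ => mul_le_mul_of_nonneg_left ?_ (by positivity)
    exact sum_sum_dvd_le o hs (by linarith [(Finset.mem_Icc.1 hγ).1]) J hT
  -- The term `n ^ k * m ^ 2`, coming from the summand `1` in the collision bound, cancels the one
  -- subtracted in `hsum`; only the diagonal and the divisors at least two remain.
  have hfin := hcol.trans_eq hexp
  have hnk : 0 ≤ n ^ k := by positivity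
  rw [momentError]
  nlinarith [mul_le_mul_of_nonneg_left (add_le_add hc1 hc2) hnk]

/-! ### Summing over the greatest common divisor -/

lemma pow_mul_add_pow_le {k d m γ : ℕ} {p : ℝ} (hk : k = d + 1 + m) (hm : 5 ≤ m) (hγ : 2 ≤ γ)
    (hp : 0 ≤ p) : (γ : ℝ) ^ d * (1 / γ + p) ^ k =
      ((γ : ℝ) ^ 2)⁻¹ * ((γ : ℝ) ^ (m - 1))⁻¹ * (1 + p * γ) ^ k := by
  have hγ0 : (γ : ℝ) ≠ 0 := by positivity
  have h1 : (1 / (γ : ℝ) + p) = (1 + p * γ) / γ := by field_simp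
  have h2 : (γ : ℝ) ^ k = γ ^ d * (γ ^ 2 * γ ^ (m - 1)) := by
    rw [← pow_add, ← pow_add]
    congr 1
    omega
  rw [h1, div_pow, h2]
  field_simp

/-- A factor `γ⁻²` is split off for summability. For `γ ≤ e^{h/2}` one has `k p γ ≤ (3 / 5) m h
e^{-h/2} ≤ 0.45 m`, since `h e^{-h/2} ≤ 2 / e`; hence `(1 + p γ)^k ≤ (20 / 11)^m`, which `γ^{-(m-1)}
≤ 2 * 2^{-m}` beats. -/
lemma gcd_term_small {k d m γ : ℕ} {p h : ℝ} (hk : k = d + 1 + m) (hm : 5 ≤ m) (hγ : 2 ≤ γ)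
    (hp : 0 ≤ p) (hph : p ≤ 3 * Real.exp (-h)) (hh : 5 ≤ h) (hmk : 5 * (k : ℝ) ≤ h * m)
    (hs : (γ : ℝ) ≤ Real.exp (h / 2)) :
    (γ : ℝ) ^ d * (1 / γ + p) ^ k ≤ ((γ : ℝ) ^ 2)⁻¹ * (2 * (10 / 11) ^ m) := by
  have hγ0 : (2 : ℝ) ≤ γ := by exact_mod_cast hγ
  have hm' : m = m - 1 + 1 := by omega
  rw [pow_mul_add_pow_le hk hm hγ hp, mul_assoc]
  refine mul_le_mul_of_nonneg_left ?_ (by positivity)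
  have h1 : ((γ : ℝ) ^ (m - 1))⁻¹ ≤ 2 * (1 / 2) ^ m := by
    have : (2 : ℝ) * (1 / 2) ^ m = (2 ^ (m - 1))⁻¹ := by
      conv_lhs => rw [hm', pow_succ]
      rw [one_div, inv_pow]
      ring
    rw [this]
    gcongr
  have hx : p * γ ≤ 3 * Real.exp (-(h / 2)) := by
    calc p * γ ≤ 3 * Real.exp (-h) * Real.exp (h / 2) := by gcongr
      _ = _ := by rw [mul_assoc, ← Real.exp_add]; congr 2; ring
  have hhe : h * Real.exp (-(h / 2)) ≤ 2 * Real.exp (-1) := by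
    have := Real.add_one_le_exp (h / 2 - 1)
    rw [Real.exp_sub] at this
    have e1 : Real.exp (-(h / 2)) = (Real.exp (h / 2))⁻¹ := Real.exp_neg _
    have e2 : Real.exp (-1) = (Real.exp 1)⁻¹ := Real.exp_neg _
    have := Real.exp_pos (h / 2)
    rw [e1, e2, ← div_eq_mul_inv, div_le_iff₀ this]
    calc h ≤ 2 * (Real.exp (h / 2) / Real.exp 1) := by linarith
      _ = _ := by ring
  have hexp1 : Real.exp (-1) ≤ 0.375 := by
    rw [Real.exp_neg]
    refine (inv_anti₀ (by norm_num) (show (2.7 : ℝ) ≤ Real.exp 1 by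
      linarith [Real.exp_one_gt_d9])).trans (by norm_num)
  have h2 : (1 + p * γ) ^ k ≤ (20 / 11) ^ m := by
    have hkx : (k : ℝ) * (p * γ) ≤ m * 0.45 := by
      have hk5 : (k : ℝ) ≤ h * m / 5 := by linarith
      calc (k : ℝ) * (p * γ) ≤ h * m / 5 * (3 * Real.exp (-(h / 2))) := by gcongr
        _ = m * (3 / 5 * (h * Real.exp (-(h / 2)))) := by ring
        _ ≤ m * 0.45 := by gcongr; linarith
    have h45 : Real.exp 0.45 ≤ 20 / 11 := by
      have := Real.add_one_le_exp (-0.45)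
      rw [Real.exp_neg] at this
      have h0 := Real.exp_pos 0.45
      rw [← inv_inv (Real.exp 0.45)]
      exact (inv_anti₀ (by norm_num) this).trans (by norm_num)
    calc (1 + p * γ) ^ k ≤ Real.exp (p * γ) ^ k := by
          gcongr
          linarith [Real.add_one_le_exp (p * γ)]
      _ = Real.exp (k * (p * γ)) := (Real.exp_nat_mul _ _).symm
      _ ≤ Real.exp (m * 0.45) := Real.exp_le_exp.2 hkx
      _ = Real.exp 0.45 ^ m := Real.exp_nat_mul _ _
      _ ≤ _ := by gcongr
  calc ((γ : ℝ) ^ (m - 1))⁻¹ * (1 + p * γ) ^ k ≤ 2 * (1 / 2) ^ m * (20 / 11) ^ m := by gcongr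
    _ = 2 * (10 / 11) ^ m := by rw [mul_assoc, ← mul_pow]; norm_num

/-- Here `(1 + p γ)^k ≤ 2^k`, while `γ^{m-1} ≥ e^{(m-1) h / 2} ≥ e^{2k} ≥ 4^k`: the assumption `m ≥
5` gives `m - 1 ≥ 4 m / 5`, and `h m ≥ 5 k`. -/
lemma gcd_term_medium {k d m γ : ℕ} {p h : ℝ} (hk : k = d + 1 + m) (hm : 5 ≤ m) (hγ : 2 ≤ γ)
    (hp : 0 ≤ p) (hh : 5 ≤ h) (hmk : 5 * (k : ℝ) ≤ h * m)
    (hs : Real.exp (h / 2) ≤ (γ : ℝ)) (hpγ : p * γ ≤ 1) :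
    (γ : ℝ) ^ d * (1 / γ + p) ^ k ≤ ((γ : ℝ) ^ 2)⁻¹ * (1 / 2) ^ k := by
  have hγ0 : (2 : ℝ) ≤ γ := by exact_mod_cast hγ
  rw [pow_mul_add_pow_le hk hm hγ hp, mul_assoc]
  refine mul_le_mul_of_nonneg_left ?_ (by positivity)
  have hm5 : (5 : ℝ) ≤ m := by exact_mod_cast hm
  have hm1 : ((m - 1 : ℕ) : ℝ) = m - 1 := by
    rw [Nat.cast_sub (by omega), Nat.cast_one]
  have h1 : Real.exp 2 ^ k ≤ (γ : ℝ) ^ (m - 1) := by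
    calc Real.exp 2 ^ k = Real.exp (k * 2) := (Real.exp_nat_mul _ _).symm
      _ ≤ Real.exp ((m - 1 : ℕ) * (h / 2)) := by
          refine Real.exp_le_exp.2 ?_
          rw [hm1]
          nlinarith
      _ = Real.exp (h / 2) ^ (m - 1) := Real.exp_nat_mul _ _
      _ ≤ _ := by gcongr
  have h4 : (4 : ℝ) ≤ Real.exp 2 := by
    have := Real.exp_one_gt_d9
    have e : Real.exp 2 = Real.exp 1 * Real.exp 1 := by rw [← Real.exp_add]; norm_num
    nlinarith
  calc ((γ : ℝ) ^ (m - 1))⁻¹ * (1 + p * γ) ^ k ≤ (4 ^ k)⁻¹ * 2 ^ k := by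
        refine mul_le_mul ?_ ?_ (by positivity) (by positivity)
        · exact inv_anti₀ (by positivity) ((pow_le_pow_left₀ (by norm_num) h4 k).trans h1)
        · exact pow_le_pow_left₀ (by positivity) (by linarith) k
    _ = (1 / 2) ^ k := by rw [← inv_pow, ← mul_pow]; norm_num

/-- Now `1 / γ + p ≤ 6 e^{-h}`, and `γ` is bounded only by `L`. The powers of `e^h` in `L^{d+1}`
leave `e^{-h m}`, which by hypothesis pays for `e^{-5k}` and `(log k)^{-2d}`; this is where the `log
log k` term of the condition is needed. The base is `18 / e⁵ ≤ 1 / 2`, and the factor `L`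
anticipates the number of terms. -/
lemma gcd_term_large {k d m γ L : ℕ} {p h : ℝ} (hk : k = d + 1 + m) (hγ : 2 ≤ γ) (hγL : γ ≤ L)
    (hp : 0 ≤ p) (hph : p ≤ 3 * Real.exp (-h)) (hlk : 1 ≤ Real.log k)
    (hmk : 5 * (k : ℝ) + 2 * (d * Real.log (Real.log k)) ≤ h * m)
    (hL : (L : ℝ) ≤ 3 * Real.exp h * Real.log k) (hs : 1 < 3 * Real.exp (-h) * γ) :
    L * ((γ : ℝ) ^ d * (1 / γ + p) ^ k) ≤ k * (1 / 2) ^ k := by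
  have hγ0 : (0 : ℝ) < γ := by positivity
  set l := Real.log k with hl
  have hl0 : 0 < l := by linarith
  have h1 : 1 / (γ : ℝ) + p ≤ 6 * Real.exp (-h) := by
    have : 1 / (γ : ℝ) ≤ 3 * Real.exp (-h) := by
      rw [div_le_iff₀ hγ0]
      exact hs.le
    linarith
  have hγL' : (γ : ℝ) ≤ L := Nat.cast_le.2 hγL
  have hlk' : l ≤ k := (Real.log_le_sub_one_of_pos (by
    rcases Nat.eq_zero_or_pos k with h0 | h0
    · omega
    · exact_mod_cast h0)).trans (by linarith)
  have h5 : (36 : ℝ) ≤ Real.exp 5 := by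
    have := Real.exp_one_gt_d9
    have e : Real.exp 5 = Real.exp 1 ^ 5 := by
      rw [← Real.exp_nat_mul]
      norm_num
    rw [e]
    calc (36 : ℝ) ≤ 2.7 ^ 5 := by norm_num
      _ ≤ _ := by gcongr; linarith
  have hexp : Real.exp (-h) ^ m ≤ (Real.exp 5 ^ k)⁻¹ * ((l ^ d) ^ 2)⁻¹ := by
    have e1 : Real.exp 5 ^ k = Real.exp (k * 5) := (Real.exp_nat_mul _ _).symm
    have e2 : (l ^ d) ^ 2 = Real.exp (2 * (d * Real.log l)) := by
      rw [← Real.exp_log (pow_pos hl0 d), Real.log_pow, ← Real.exp_nat_mul]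
      norm_num
    rw [e1, e2, ← Real.exp_neg, ← Real.exp_neg, ← Real.exp_add, ← Real.exp_nat_mul]
    refine Real.exp_le_exp.2 ?_
    linarith
  have hld : 1 ≤ l ^ d := one_le_pow₀ hlk
  have h3 : (3 : ℝ) ^ (d + 1) ≤ 3 ^ k := pow_le_pow_right₀ (by norm_num) (by omega)
  calc L * ((γ : ℝ) ^ d * (1 / γ + p) ^ k) ≤ L * ((L : ℝ) ^ d * (6 * Real.exp (-h)) ^ k) := by
        gcongr
    _ = (L : ℝ) ^ (d + 1) * (6 * Real.exp (-h)) ^ k := by ring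
    _ ≤ (3 * Real.exp h * l) ^ (d + 1) * (6 * Real.exp (-h)) ^ k := by gcongr
    _ = 3 ^ (d + 1) * 6 ^ k * (l * l ^ d) * (Real.exp h * Real.exp (-h)) ^ (d + 1) *
          Real.exp (-h) ^ m := by
        rw [mul_pow, mul_pow, mul_pow, mul_pow, hk, pow_add (Real.exp (-h))]
        ring
    _ = 3 ^ (d + 1) * 6 ^ k * (l * l ^ d) * Real.exp (-h) ^ m := by
        rw [← Real.exp_add, add_neg_cancel, Real.exp_zero, one_pow, mul_one]
    _ ≤ 3 ^ k * 6 ^ k * (l * l ^ d) * ((Real.exp 5 ^ k)⁻¹ * ((l ^ d) ^ 2)⁻¹) := by gcongr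
    _ = l * (18 / Real.exp 5) ^ k * (l ^ d)⁻¹ := by
        rw [← mul_pow, div_pow]
        norm_num
        field_simp
    _ ≤ k * (1 / 2) ^ k * 1 := by
        have : 18 / Real.exp 5 ≤ 1 / 2 := by
          rw [div_le_div_iff₀ (by positivity) (by norm_num)]
          linarith
        gcongr
        exact inv_le_one_of_one_le₀ hld
    _ = _ := mul_one _

/-- The contribution of the possible greatest common divisors is small. -/
lemma gcd_sum_le {k d m L : ℕ} {p h : ℝ} (hk : k = d + 1 + m) (hm : 5 ≤ m)
    (hp : 0 ≤ p) (hph : p ≤ 3 * Real.exp (-h)) (hh : 5 ≤ h) (hlk : 1 ≤ Real.log k)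
    (hmk : 5 * (k : ℝ) + 2 * (d * Real.log (Real.log k)) ≤ h * m)
    (hL : (L : ℝ) ≤ 3 * Real.exp h * Real.log k) :
    ∑ γ ∈ Finset.Icc 2 L, (γ : ℝ) ^ d * (1 / γ + p) ^ k ≤
      2 * (10 / 11) ^ m + (1 / 2) ^ k + k * (1 / 2) ^ k := by
  have hmk' : 5 * (k : ℝ) ≤ h * m := by
    have : 0 ≤ (d : ℝ) * Real.log (Real.log k) := mul_nonneg (Nat.cast_nonneg _)
      (Real.log_nonneg hlk)
    linarith
  have hA : (0 : ℝ) ≤ 2 * (10 / 11) ^ m := by positivity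
  have hB : (0 : ℝ) ≤ (1 / 2) ^ k := by positivity
  -- The first two ranges are summed by means of `γ⁻²`, the third by counting at most `L` terms.
  have hterm : ∀ γ ∈ Finset.Icc 2 L, (γ : ℝ) ^ d * (1 / γ + p) ^ k ≤
      ((γ : ℝ) ^ 2)⁻¹ * (2 * (10 / 11) ^ m + (1 / 2) ^ k) + k * (1 / 2) ^ k / L := by
    intro γ hγ
    obtain ⟨h2, hγL⟩ := Finset.mem_Icc.1 hγ
    have hi : (0 : ℝ) ≤ ((γ : ℝ) ^ 2)⁻¹ := by positivity
    have hC : (0 : ℝ) ≤ k * (1 / 2) ^ k / L := by positivity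
    have iA := mul_nonneg hi hA
    have iB := mul_nonneg hi hB
    rw [mul_add]
    rcases le_or_gt (γ : ℝ) (Real.exp (h / 2)) with h3 | h3
    · have := gcd_term_small hk hm h2 hp hph hh hmk' h3
      linarith
    · rcases le_or_gt (3 * Real.exp (-h) * γ) 1 with h4 | h4
      · have := gcd_term_medium hk hm h2 hp hh hmk' h3.le
          ((mul_le_mul_of_nonneg_right hph (Nat.cast_nonneg γ)).trans h4)
        linarith
      · have := gcd_term_large hk h2 hγL hp hph hlk hmk hL h4
        have hL0 : (0 : ℝ) < L := by
          have : 0 < L := by omega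
          exact_mod_cast this
        have h5 : (γ : ℝ) ^ d * (1 / γ + p) ^ k ≤ k * (1 / 2) ^ k / L := by
          rw [le_div_iff₀ hL0]
          linarith
        linarith
  refine (Finset.sum_le_sum hterm).trans ?_
  rw [Finset.sum_add_distrib, ← Finset.sum_mul]
  have hs1 : ∑ γ ∈ Finset.Icc 2 L, ((γ : ℝ) ^ 2)⁻¹ ≤ 1 := by
    rcases Nat.eq_zero_or_pos L with h0 | h0
    · simp [h0]
    · have := sum_Ioc_inv_sq_le_sub (α := ℝ) one_ne_zero (show 1 ≤ L from h0)
      have e : Finset.Ioc 1 L = Finset.Icc 2 L := by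
        ext x
        simp only [Finset.mem_Ioc, Finset.mem_Icc]
        omega
      rw [e] at this
      have hi : (0 : ℝ) ≤ (L : ℝ)⁻¹ := by positivity
      simp only [Nat.cast_one, inv_one] at this
      linarith
  have hs2 : ∑ _γ ∈ Finset.Icc 2 L, (k : ℝ) * (1 / 2) ^ k / L ≤ k * (1 / 2) ^ k := by
    rw [Finset.sum_const, nsmul_eq_mul, Nat.card_Icc]
    rcases Nat.eq_zero_or_pos L with h0 | h0
    · rw [h0]
      simp
    · have hL0 : (0 : ℝ) < L := by exact_mod_cast h0
      rw [← mul_div_assoc, div_le_iff₀ hL0, mul_comm]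
      refine mul_le_mul_of_nonneg_left ?_ (by positivity)
      exact_mod_cast (show L + 1 - 2 ≤ L by omega)
  have := mul_le_mul_of_nonneg_right hs1 (add_nonneg hA hB)
  linarith

/-! ### Upper bound for most choices of generators -/

lemma generatorLaw_apply {G : Type*} [AddCommGroup G] [Fintype G] (k : ℕ) (E : Set (Fin k → G)) :
    generatorLaw k G E = ENNReal.ofReal (E.ncard / (Fintype.card G : ℝ) ^ k) := by
  classical
  have hn : (0 : ℝ) < Fintype.card G := Nat.cast_pos.2 Fintype.card_pos
  let _ : MeasurableSpace G := ⊤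
  have hE : E = (E.toFinite.toFinset : Set (Fin k → G)) := by simp
  have hsing : ∀ z : Fin k → G, generatorLaw k G {z} = (Fintype.card G : ℝ≥0∞)⁻¹ ^ k := by
    intro z
    change (Measure.pi fun _ : Fin k => (PMF.uniformOfFintype G).toMeasure) {z} = _
    rw [Measure.pi_singleton]
    simp only [PMF.toMeasure_apply_singleton _ _ (measurableSet_singleton _),
      PMF.uniformOfFintype_apply, Finset.prod_const, Finset.card_univ, Fintype.card_fin]
  have hsum : generatorLaw k G E = ∑ z ∈ E.toFinite.toFinset, generatorLaw k G {z} := by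
    rw [sum_measure_singleton, ← hE]
  rw [hsum]
  simp only [hsing]
  rw [Finset.sum_const, nsmul_eq_mul, ← Set.ncard_eq_toFinset_card E,
    ENNReal.ofReal_div_of_pos (by positivity), ENNReal.ofReal_natCast,
    ENNReal.ofReal_pow hn.le, ENNReal.ofReal_natCast, div_eq_mul_inv, ENNReal.inv_pow]

lemma generatorLaw_le_of_card {G : Type*} [AddCommGroup G] [Fintype G] {k : ℕ}
    {E : Set (Fin k → G)} {δ e : ℝ} (hδ : 0 < δ)
    (h : δ ^ 2 * E.ncard ≤ (Fintype.card G : ℝ) ^ k * e) :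
    generatorLaw k G E ≤ ENNReal.ofReal (e / δ ^ 2) := by
  have hn : (0 : ℝ) < Fintype.card G := Nat.cast_pos.2 Fintype.card_pos
  rw [generatorLaw_apply]
  refine ENNReal.ofReal_le_ofReal ?_
  rw [div_le_div_iff₀ (by positivity) (by positivity)]
  linarith

lemma prod_prob_exists_le {k : ℕ} (μ : Measure ℤ) [IsProbabilityMeasure μ] (S : Set ℤ) :
    (Measure.pi fun _ : Fin k => μ).real {w | ∃ i, w i ∈ S} ≤ k * μ.real S := by
  have h : {w : Fin k → ℤ | ∃ i, w i ∈ S} = ⋃ i, Function.eval i ⁻¹' S := by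
    ext w
    simp
  rw [h]
  refine (measureReal_iUnion_fintype_le _).trans ?_
  have : ∀ i : Fin k, (Measure.pi fun _ : Fin k => μ).real (Function.eval i ⁻¹' S) = μ.real S :=
    fun i => by
      rw [Measure.real, (measurePreserving_eval (fun _ : Fin k => μ) i).measure_preimage
        MeasurableSet.of_discrete.nullMeasurableSet, Measure.real]
  simp [this]

/-- The walk is close to uniform for most generators once typical points of the auxiliary walk
have probability much smaller than `1 / n`. -/
lemma generatorLaw_tvDist_le {G : Type*} [AddCommGroup G] [Fintype G] {k : ℕ} [NeZero k]
    (o : CayleyKind) {s r ω δ : ℝ} (hs : 1 ≤ s) (hδ : 0 < δ) {L : ℕ}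
    (hL : 2 * r * √s ≤ L) :
    generatorLaw k G {z | (prodMeasure o k s).real
        {w | ∑ i, surp o s (w i) < Real.log (Fintype.card G) + ω} + k * (6 * Real.exp (-r)) + δ <
      tvDist o z (k * s)} ≤
    ENNReal.ofReal (momentError k (AddGroup.rank G) L s (Real.exp (-ω)) / δ ^ 2) := by
  classical
  have hs0 : 0 < s := by linarith
  have hss : 0 < √s := Real.sqrt_pos.2 hs0
  have hn : (0 : ℝ) < Fintype.card G := Nat.cast_pos.2 Fintype.card_pos
  have hJfin : {x : ℤ | |stdPos o s x| ≤ r}.Finite := by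
    refine (Set.finite_Icc ⌊lineMean o s - r * √s⌋ ⌈lineMean o s + r * √s⌉).subset fun x hx => ?_
    have h1 := abs_le.1 (show |stdPos o s x| ≤ r from hx)
    rw [stdPos, le_div_iff₀ hss, div_le_iff₀ hss] at h1
    refine ⟨Int.floor_le_iff.2 ?_, Int.le_ceil_iff.2 ?_⟩ <;> linarith
  set J := hJfin.toFinset with hJ
  have hmemJ : ∀ x, x ∈ J ↔ |stdPos o s x| ≤ r := fun x => by simp [hJ]
  have hJd : ∀ x ∈ J, ∀ y ∈ J, |x - y| ≤ L := by
    intro x hx y hy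
    have h1 := abs_le.1 ((hmemJ x).1 hx)
    have h2 := abs_le.1 ((hmemJ y).1 hy)
    rw [stdPos, le_div_iff₀ hss, div_le_iff₀ hss] at h1 h2
    have : |(x : ℝ) - y| ≤ L := abs_le.2 ⟨by linarith, by linarith⟩
    exact_mod_cast this
  -- The mass bound controls the diagonal of the second moment; the box `J` makes every difference
  -- of coordinates at most `L`, which limits the divisors to be summed.
  set T := (Fintype.piFinset fun _ : Fin k => J).filter
    fun w => Fintype.card G * ∏ i, mass o s (w i) ≤ Real.exp (-ω) with hT
  refine le_trans (measure_mono ?_) (generatorLaw_le_of_card hδ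
    (card_bad_generators_le (G := G) o hs0 (Real.exp_pos (-ω)).le J hJd (T := T)
      (Finset.filter_subset _ _) (fun w hw => (Finset.mem_filter.1 hw).2) hδ))
  intro z hz
  have hz' : _ + k * (6 * Real.exp (-r)) + δ < tvDist o z (k * s) := hz
  refine lt_of_le_of_lt ?_ hz'
  have hμT : ∑ w ∈ T, ∏ i, mass o s (w i) = (prodMeasure o k s).real T := by
    rw [← sum_measureReal_singleton]
    exact Finset.sum_congr rfl fun w _ => (prodMeasure_real_singleton o k s w).symm
  have hcompl : 1 - ∑ w ∈ T, ∏ i, mass o s (w i) ≤ (prodMeasure o k s).real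
        {w | ∑ i, surp o s (w i) < Real.log (Fintype.card G) + ω} + k * (6 * Real.exp (-r)) := by
    rw [hμT, ← probReal_compl_eq_one_sub MeasurableSet.of_discrete]
    have hsub : (prodMeasure o k s).real (T : Set (Fin k → ℤ))ᶜ ≤ (prodMeasure o k s).real
        ({w | ∑ i, surp o s (w i) < Real.log (Fintype.card G) + ω} ∪
          {w | ∃ i, w i ∈ {x : ℤ | r ≤ |stdPos o s x|}}) := by
      refine ENNReal.toReal_mono (measure_ne_top _ _) (measure_mono_ae ?_)
      filter_upwards [ae_mass_pos_prod o k s] with w hw hwT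
      by_contra hcon
      have hcon' : w ∉ ({w | ∑ i, surp o s (w i) < Real.log (Fintype.card G) + ω} ∪
          {w : Fin k → ℤ | ∃ i, w i ∈ {x : ℤ | r ≤ |stdPos o s x|}}) := hcon
      simp only [Set.mem_union, Set.mem_ofPred_eq, not_or, not_lt, not_exists, not_le] at hcon'
      refine hwT (Finset.mem_coe.2 (Finset.mem_filter.2
        ⟨Fintype.mem_piFinset.2 fun i => (hmemJ _).2 (hcon'.2 i).le, ?_⟩))
      rw [prod_mass_eq_exp o hw]
      nth_rw 1 [← Real.exp_log hn]
      rw [← Real.exp_add, Real.exp_le_exp]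
      linarith [hcon'.1]
    refine (hsub.trans (measureReal_union_le _ _)).trans (add_le_add le_rfl ?_)
    refine (prod_prob_exists_le _ _).trans ?_
    exact mul_le_mul_of_nonneg_left (prob_abs_stdPos_ge_le o hs r) (Nat.cast_nonneg k)
  linarith

lemma tendsto_exp_neg_sqrt_sqrt {k : ℕ → ℕ} (hk : Tendsto k atTop atTop) :
    Tendsto (fun N => Real.exp (-√√(k N))) atTop (𝓝 0) :=
  Real.tendsto_exp_neg_atTop_nhds_zero.comp (Real.tendsto_sqrt_atTop.comp
    (Real.tendsto_sqrt_atTop.comp (tendsto_natCast_atTop_atTop.comp hk)))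

/-! ### Information content at the cutoff times -/

section Threshold

variable (o : CayleyKind) {k n : ℕ → ℕ} [∀ N, NeZero (k N)] (hk : Tendsto k atTop atTop)
  (hn : ∀ᶠ N in atTop, 5 * (k N : ℝ) < Real.log (n N))

include hk hn

/-- The margin `c k^{1/4}` is negligible against `√(k v)`. The main part is `-α` times the square
root of the ratio of the varentropies at `s₀` and at `s_α`, which tends to one. -/
lemma tendsto_threshold (α c : ℝ) :
    Tendsto (fun N => (Real.log (n N) + c * √√(k N) -
      k N * lineEntropy o (cutoffLine o (k N) (n N) α)) /
      √(k N * lineVar o (cutoffLine o (k N) (n N) α))) atTop (𝓝 (-α)) := by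
  obtain ⟨V, hV, hVle⟩ := exists_lineVar_ge o
  have hkr : Tendsto (fun N => (k N : ℝ)) atTop atTop := tendsto_natCast_atTop_atTop.comp hk
  have h1 : Tendsto (fun N => c * √√(k N) / √(k N * lineVar o (cutoffLine o (k N) (n N) α)))
      atTop (𝓝 0) := by
    have hz : Tendsto (fun N => |c| / √V / √√(k N)) atTop (𝓝 0) :=
      (Real.tendsto_sqrt_atTop.comp (Real.tendsto_sqrt_atTop.comp hkr)).const_div_atTop _
    refine squeeze_zero_norm' ?_ hz
    filter_upwards [eventually_one_le_cutoffLine o hk hn α] with N h1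
    have hk0 : (0 : ℝ) < k N := Nat.cast_pos.2 (NeZero.pos _)
    have hs := Real.sqrt_pos.2 hk0
    have hss := Real.sqrt_pos.2 hs
    have hVs := Real.sqrt_pos.2 hV
    have hle : √V ≤ √(lineVar o (cutoffLine o (k N) (n N) α)) := Real.sqrt_le_sqrt (hVle _ h1)
    rw [Real.sqrt_mul hk0.le, norm_div, norm_mul, Real.norm_eq_abs c, Real.norm_of_nonneg hss.le,
      Real.norm_of_nonneg (by positivity)]
    calc |c| * √√(k N) / (√(k N) * √(lineVar o (cutoffLine o (k N) (n N) α)))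
        ≤ |c| * √√(k N) / (√(k N) * √V) := by gcongr
      _ = |c| / √V / √√(k N) := by
        nth_rw 2 [← Real.mul_self_sqrt hs.le]
        field_simp
  have h2 : Tendsto (fun N => -α * √(lineVar o (cutoffLine o (k N) (n N) α) /
      lineVar o (lineTime o (Real.log (n N) / k N)))⁻¹) atTop (𝓝 (-α)) := by
    have := ((tendsto_lineVar_cutoffLine o hk hn α).inv₀ one_ne_zero).sqrt.const_mul (-α)
    simpa using this
  have h3 := h1.add h2
  rw [zero_add] at h3
  refine h3.congr' ?_
  filter_upwards [eventually_one_le_cutoffLine o hk hn α, eventually_one_le_cutoffLine o hk hn 0,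
    eventually_lineEntropy_cutoffLine o hk hn α] with N g1 g2 g3
  rw [cutoffLine_zero] at g2
  have hk0 : (0 : ℝ) < k N := Nat.cast_pos.2 (NeZero.pos _)
  have hs := Real.sqrt_pos.2 hk0
  have v1 := lineVar_pos o (show 0 < cutoffLine o (k N) (n N) α by linarith)
  have v2 := lineVar_pos o (show 0 < lineTime o (Real.log (n N) / k N) by linarith)
  rw [g3.2, inv_div, Real.sqrt_div v2.le, Real.sqrt_mul hk0.le]
  have w1 := Real.sqrt_pos.2 v1
  have w2 := Real.sqrt_pos.2 v2
  have hkk : √(k N : ℝ) ^ 2 = k N := Real.sq_sqrt hk0.le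
  rw [mul_add, mul_div_cancel₀ _ hk0.ne']
  field_simp
  linear_combination
    (-(α * √(lineVar o (lineTime o (Real.log (n N) / k N))))) * hkk

lemma tendsto_prob_le (α : ℝ) :
    Tendsto (fun N => (prodMeasure o (k N) (cutoffLine o (k N) (n N) α)).real
      {w | ∑ i, surp o (cutoffLine o (k N) (n N) α) (w i) ≤ Real.log (n N) - √√(k N)}) atTop
      (𝓝 (Psi α)) := by
  have h := (tendsto_prob_sum_surp o hk (eventually_one_le_cutoffLine o hk hn α)
    (tendsto_threshold o hk hn α (-1))).1.const_sub 1
  rw [Psi_neg, sub_sub_cancel] at h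
  refine h.congr fun N => ?_
  rw [← probReal_compl_eq_one_sub MeasurableSet.of_discrete]
  congr 1
  ext w
  simp only [Set.mem_compl_iff, Set.mem_ofPred_eq, not_lt]
  constructor <;> intro h <;> linarith

lemma tendsto_prob_lt (α : ℝ) :
    Tendsto (fun N => (prodMeasure o (k N) (cutoffLine o (k N) (n N) α)).real
      {w | ∑ i, surp o (cutoffLine o (k N) (n N) α) (w i) < Real.log (n N) + √√(k N)}) atTop
      (𝓝 (Psi α)) := by
  have h := (tendsto_prob_sum_surp o hk (eventually_one_le_cutoffLine o hk hn α)
    (tendsto_threshold o hk hn α 1)).2.const_sub 1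
  rw [Psi_neg, sub_sub_cancel] at h
  refine h.congr fun N => ?_
  rw [← probReal_compl_eq_one_sub MeasurableSet.of_discrete]
  congr 1
  ext w
  simp only [Set.mem_compl_iff, Set.mem_ofPred_eq, not_le]
  constructor <;> intro h <;> linarith

end Threshold

/-- Bounds for the square root of a time in terms of its entropy. -/
lemma sqrt_bounds_of_lineEntropy (o : CayleyKind) {s h : ℝ} (hs : 1 ≤ s)
    (hH : 4.9 ≤ lineEntropy o s) (hd : |lineEntropy o s - h| ≤ 0.1) :
    0.45 / √s ≤ 3 * Real.exp (-h) ∧ √s ≤ 0.712 * Real.exp h := by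
  have hs0 : 0 < s := by linarith
  have hss : 0 < √s := Real.sqrt_pos.2 hs0
  obtain ⟨hd1, hd2⟩ := abs_le.1 hd
  have hup := lineEntropy_le o hs0
  have hlo := lineEntropy_ge o hs0
  have hexp01 : Real.exp 0.1 ≤ 1.112 := by
    have := Real.add_one_le_exp (-0.1)
    rw [Real.exp_neg] at this
    rw [← inv_inv (Real.exp 0.1)]
    exact (inv_anti₀ (by norm_num) this).trans (by norm_num)
  have he1 := Real.exp_one_lt_d9
  have he2 := Real.exp_one_gt_d9
  -- Large enough for `1 + √s` to be absorbed in the first estimate: `0.9 * 2.719 * 1.112 * (1 + √s)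
  -- ≤ 3 √s`.
  have h23 : 23 ≤ √s := by
    have h1 : Real.exp 3.9 ≤ 2 * (1 + √s) := by
      rw [← Real.log_le_log_iff (Real.exp_pos _) (by positivity), Real.log_exp]
      linarith
    have h2 : (48 : ℝ) ≤ Real.exp 3.9 := by
      have e : Real.exp 3.9 = Real.exp 1 ^ 4 * Real.exp (-0.1) := by
        rw [← Real.exp_nat_mul, ← Real.exp_add]
        norm_num
      have e3 := Real.add_one_le_exp (-0.1)
      rw [e]
      calc (48 : ℝ) ≤ 2.718 ^ 4 * 0.9 := by norm_num
        _ ≤ _ := by gcongr <;> linarith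
    linarith
  constructor
  · have h1 : Real.exp h ≤ 2 * (1 + √s) * Real.exp 1 * Real.exp 0.1 := by
      rw [← Real.exp_log (show 0 < 2 * (1 + √s) by positivity), ← Real.exp_add, ← Real.exp_add]
      exact Real.exp_le_exp.2 (by linarith)
    have h2 : 2 * (1 + √s) * Real.exp 1 * Real.exp 0.1 ≤ 2 * (1 + √s) * 2.719 * 1.112 := by
      gcongr
      linarith
    rw [Real.exp_neg, div_le_iff₀ hss, ← div_eq_mul_inv, div_mul_eq_mul_div,
      le_div_iff₀ (Real.exp_pos h)]
    linarith
  · have h1 : √s ≤ 0.64 * Real.exp 0.1 * Real.exp h := by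
      rw [← Real.log_le_log_iff hss (by positivity), Real.log_sqrt hs0.le, Real.log_mul
        (by positivity) (by positivity), Real.log_mul (by norm_num) (by positivity),
        Real.log_exp, Real.log_exp]
      linarith
    have h2 : 0.64 * Real.exp 0.1 * Real.exp h ≤ 0.64 * 1.112 * Real.exp h := by gcongr
    have := Real.exp_pos h
    linarith

/-! ### Consequences of the standing condition -/

lemma Condition.tendsto_k {k : ℕ → ℕ} {G : ℕ → Type*} [∀ N, AddCommGroup (G N)]
    [∀ N, Fintype (G N)] (hyp : Condition k G) : Tendsto k atTop atTop := by
  refine tendsto_natCast_atTop_iff.1 (tendsto_atTop_mono (fun N => ?_) hyp.sub_rank_tendsto)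
  have : (0 : ℝ) ≤ AddGroup.rank (G N) := Nat.cast_nonneg _
  linarith

/-- Subadditivity of the measure suffices, so neither `E` nor `B` has to be measurable. -/
lemma Whp.of_compl_subset {k : ℕ → ℕ} {G : ℕ → Type*} [∀ N, AddCommGroup (G N)]
    [∀ N, Fintype (G N)] {E B : ∀ N, Set (Fin (k N) → G N)}
    (hB : Tendsto (fun N => generatorLaw (k N) (G N) (B N)) atTop (𝓝 0))
    (h : ∀ᶠ N in atTop, ∀ z, z ∉ B N → z ∈ E N) : Whp k G E := by
  have hone : ∀ N, generatorLaw (k N) (G N) Set.univ = 1 := fun N => by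
    let _ : MeasurableSpace (G N) := ⊤
    change (Measure.pi fun _ : Fin (k N) => (PMF.uniformOfFintype (G N)).toMeasure) _ = 1
    exact measure_univ
  have hl : Tendsto (fun N => 1 - generatorLaw (k N) (G N) (B N)) atTop (𝓝 1) := by
    simpa using ENNReal.Tendsto.sub tendsto_const_nhds hB (Or.inl ENNReal.one_ne_top)
  refine tendsto_of_tendsto_of_tendsto_of_le_of_le' hl tendsto_const_nhds ?_
    (Eventually.of_forall fun N => (measure_mono (Set.subset_univ _)).trans (hone N).le)
  filter_upwards [h] with N hN
  rw [tsub_le_iff_right, ← hone N]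
  refine (measure_mono fun z _ => ?_).trans (measure_union_le (E N) (B N))
  by_cases hz : z ∈ B N
  · exact Or.inr hz
  · exact Or.inl (hN z hz)

lemma Condition.tendsto_log_k {k : ℕ → ℕ} {G : ℕ → Type*}
    [∀ N, AddCommGroup (G N)] [∀ N, Fintype (G N)] (hyp : Condition k G) :
    Tendsto (fun N => Real.log (k N)) atTop atTop :=
  Real.tendsto_log_atTop.comp (tendsto_natCast_atTop_atTop.comp hyp.tendsto_k)

section Main

variable {k : ℕ → ℕ} [∀ N, NeZero (k N)] {G : ℕ → Type*} [∀ N, AddCommGroup (G N)]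
  [∀ N, Fintype (G N)]

lemma Condition.eventually_mul_le (hyp : Condition k G) : ∀ᶠ N in atTop,
    5 * (k N : ℝ) + 2 * (AddGroup.rank (G N) * Real.log (Real.log (k N))) ≤
      Real.log (Fintype.card (G N)) / k N * ((k N : ℝ) - AddGroup.rank (G N) - 1) := by
  filter_upwards [hyp.ineq, hyp.card_tendsto.eventually_gt_atTop 1] with N h1 h2
  have hl := Real.log_pos h2
  have hk0 : (0 : ℝ) < k N := Nat.cast_pos.2 (NeZero.pos _)
  have h3 := mul_le_mul_of_nonneg_left h1 hl.le
  have e1 : Real.log (Fintype.card (G N)) * (5 * ((k N : ℝ) / Real.log (Fintype.card (G N))) +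
      2 * ((AddGroup.rank (G N) : ℝ) * Real.log (Real.log (k N)) /
        Real.log (Fintype.card (G N)))) =
      5 * (k N : ℝ) + 2 * (AddGroup.rank (G N) * Real.log (Real.log (k N))) := by
    field_simp
  rw [e1] at h3
  exact h3.trans_eq (by ring)

/-- The left side of the condition is less than one, so its first term forces `5 k < log n`, the
`log log k` term being eventually nonnegative. -/
lemma Condition.eventually_lt_log (hyp : Condition k G) :
    ∀ᶠ N in atTop, 5 * (k N : ℝ) < Real.log (Fintype.card (G N)) := by
  filter_upwards [hyp.eventually_mul_le, hyp.tendsto_log_k.eventually_ge_atTop 1,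
    hyp.card_tendsto.eventually_gt_atTop 1] with N h1 h2 h3
  have hl := Real.log_pos h3
  have hk0 : (0 : ℝ) < k N := Nat.cast_pos.2 (NeZero.pos _)
  have hd : (0 : ℝ) ≤ AddGroup.rank (G N) := Nat.cast_nonneg _
  have h4 := mul_nonneg hd (Real.log_nonneg h2)
  have h5 : Real.log (Fintype.card (G N)) / k N * ((k N : ℝ) - AddGroup.rank (G N) - 1) <
      Real.log (Fintype.card (G N)) / k N * k N := by
    have : 0 < Real.log (Fintype.card (G N)) / k N := by positivity
    exact mul_lt_mul_of_pos_left (by linarith) this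
  rw [div_mul_cancel₀ _ hk0.ne'] at h5
  linarith

/-- The box has radius `r = 2 log k`, so `L = ⌈4 log k √s⌉`. Since `√s ≤ 0.712 e^h`, `4 * 0.712 < 3`
and the rounding is absorbed by the slack, `L ≤ 3 e^h log k` as `gcd_sum_le` requires. -/
lemma tendsto_momentError (o : CayleyKind) (hyp : Condition k G) (α : ℝ) :
    Tendsto (fun N => momentError (k N) (AddGroup.rank (G N))
      ⌈2 * (2 * Real.log (k N)) * √(cutoffLine o (k N) (Fintype.card (G N)) α)⌉₊
      (cutoffLine o (k N) (Fintype.card (G N)) α) (Real.exp (-√√(k N)))) atTop (𝓝 0) := by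
  have hk := hyp.tendsto_k
  have hn := hyp.eventually_lt_log
  -- Truncated subtraction can only exceed the real difference, which tends to infinity.
  have hm : Tendsto (fun N => k N - AddGroup.rank (G N) - 1) atTop atTop := by
    refine tendsto_natCast_atTop_iff (R := ℝ).1 (tendsto_atTop_mono (fun N => ?_)
      (tendsto_atTop_add_const_right _ (-1) hyp.sub_rank_tendsto))
    have : k N ≤ k N - AddGroup.rank (G N) - 1 + 1 + AddGroup.rank (G N) := by omega
    have : (k N : ℝ) ≤ ((k N - AddGroup.rank (G N) - 1 : ℕ) : ℝ) + 1 + AddGroup.rank (G N) := by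
      exact_mod_cast this
    linarith
  have hlim : Tendsto (fun N => Real.exp (-√√(k N)) +
      (2 * (10 / 11 : ℝ) ^ (k N - AddGroup.rank (G N) - 1) + (1 / 2) ^ k N +
        k N * (1 / 2) ^ k N)) atTop (𝓝 0) := by
    have t1 := ((tendsto_pow_atTop_nhds_zero_of_lt_one (r := (10 / 11 : ℝ)) (by norm_num)
      (by norm_num)).comp hm).const_mul 2
    have t2 := (tendsto_pow_atTop_nhds_zero_of_lt_one (r := (1 / 2 : ℝ)) (by norm_num)
      (by norm_num)).comp hk
    have t3 := (tendsto_self_mul_const_pow_of_lt_one (r := (1 / 2 : ℝ)) (by norm_num)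
      (by norm_num)).comp hk
    simpa using (tendsto_exp_neg_sqrt_sqrt hk).add ((t1.add t2).add t3)
  refine squeeze_zero' (Eventually.of_forall fun N => ?_) ?_ hlim
  · unfold momentError
    positivity
  · filter_upwards [hyp.eventually_mul_le, hn, hyp.tendsto_log_k.eventually_ge_atTop 1,
      hm.eventually_ge_atTop 5, eventually_one_le_cutoffLine o hk hn α,
      eventually_lineEntropy_cutoffLine o hk hn α,
      (tendsto_shift o hk hn α).eventually_lt_const (show (0 : ℝ) < 0.1 by norm_num),
      (tendsto_shift o hk hn α).eventually_const_lt (show (-0.1 : ℝ) < 0 by norm_num)]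
      with N h1 h2 h3 h4 h5 h6 h7 h8
    have hk0 : (0 : ℝ) < k N := Nat.cast_pos.2 (NeZero.pos _)
    set h := Real.log (Fintype.card (G N)) / k N with hh
    have hh5 : 5 ≤ h := by
      rw [hh, le_div_iff₀ hk0]
      exact h2.le
    set s := cutoffLine o (k N) (Fintype.card (G N)) α
    obtain ⟨b1, b2⟩ := sqrt_bounds_of_lineEntropy o h5 h6.1 (h := h) (by
      rw [h6.2, add_sub_cancel_left]
      exact abs_le.2 ⟨h8.le, h7.le⟩)
    have hkm : k N = AddGroup.rank (G N) + 1 + (k N - AddGroup.rank (G N) - 1) := by omega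
    have hm1 : ((k N - AddGroup.rank (G N) - 1 : ℕ) : ℝ) = k N - AddGroup.rank (G N) - 1 := by
      rw [Nat.cast_sub (by omega), Nat.cast_sub (by omega), Nat.cast_one]
    refine add_le_add le_rfl (gcd_sum_le hkm h4 (by positivity) b1 hh5 h3 (by rwa [hm1]) ?_)
    have hexp : (32 : ℝ) ≤ Real.exp h := by
      have e : Real.exp 5 = Real.exp 1 ^ 5 := by
        rw [← Real.exp_nat_mul]
        norm_num
      calc (32 : ℝ) = 2 ^ 5 := by norm_num
        _ ≤ Real.exp 1 ^ 5 := by gcongr; linarith [Real.exp_one_gt_d9]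
        _ = Real.exp 5 := e.symm
        _ ≤ _ := Real.exp_le_exp.2 hh5
    have hc := (Nat.ceil_lt_add_one (a := 2 * (2 * Real.log (k N)) * √s) (by positivity)).le
    have h9 : 2 * (2 * Real.log (k N)) * √s ≤
        2 * (2 * Real.log (k N)) * (0.712 * Real.exp h) := by gcongr
    have h10 : (32 : ℝ) * 1 ≤ Real.exp h * Real.log (k N) := by gcongr
    linarith

/-! ### Limit profile, cutoff and mixing times -/

lemma eventually_Psi_sub_le_tvDist (o : CayleyKind) (hyp : Condition k G) (α : ℝ) {δ : ℝ}
    (hδ : 0 < δ) : ∀ᶠ N in atTop, ∀ z : Fin (k N) → G N,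
      Psi α - δ ≤ tvDist o z (cutoffTime o (k N) (Fintype.card (G N)) α) := by
  have hk := hyp.tendsto_k
  have hn := hyp.eventually_lt_log
  have h := (tendsto_prob_le o hk hn α).sub (tendsto_exp_neg_sqrt_sqrt hk)
  rw [sub_zero] at h
  filter_upwards [h.eventually_const_lt (show Psi α - δ < Psi α by linarith),
    eventually_cutoffTime_eq o hk hn α, eventually_one_le_cutoffLine o hk hn α]
    with N h1 h2 h3 z
  rw [h2]
  exact h1.le.trans (prob_sum_surp_le_sub_le_tvDist o z (by linarith) _)

lemma tendsto_generatorLaw_tvDist_gt (o : CayleyKind) (hyp : Condition k G) (α : ℝ) {δ : ℝ}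
    (hδ : 0 < δ) : Tendsto (fun N => generatorLaw (k N) (G N)
      {z | Psi α + δ < tvDist o z (cutoffTime o (k N) (Fintype.card (G N)) α)}) atTop (𝓝 0) := by
  have hk := hyp.tendsto_k
  have hn := hyp.eventually_lt_log
  have hkr : Tendsto (fun N => (k N : ℝ)) atTop atTop := tendsto_natCast_atTop_atTop.comp hk
  -- With `r = 2 log k` the probability that some coordinate leaves the box is at most `6 / k`.
  have h6 : Tendsto (fun N => (k N : ℝ) * (6 * Real.exp (-(2 * Real.log (k N))))) atTop
      (𝓝 0) := by
    refine (hkr.const_div_atTop 6).congr fun N => ?_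
    have hk0 : (0 : ℝ) < k N := Nat.cast_pos.2 (NeZero.pos _)
    rw [Real.exp_neg, two_mul, Real.exp_add, Real.exp_log hk0]
    field_simp
  have hp := (tendsto_prob_lt o hk hn α).add h6
  rw [add_zero] at hp
  have hE := ENNReal.tendsto_ofReal ((tendsto_momentError o hyp α).div_const ((δ / 2) ^ 2))
  rw [zero_div, ENNReal.ofReal_zero] at hE
  refine tendsto_of_tendsto_of_tendsto_of_le_of_le' tendsto_const_nhds hE
    (Eventually.of_forall fun _ => zero_le) ?_
  filter_upwards [hp.eventually_lt_const (show Psi α < Psi α + δ / 2 by linarith),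
    eventually_cutoffTime_eq o hk hn α, eventually_one_le_cutoffLine o hk hn α]
    with N h1 h2 h3
  refine le_trans (measure_mono ?_) (generatorLaw_tvDist_le (G := G N) o h3 (half_pos hδ)
    (ω := √√(k N)) (Nat.le_ceil _))
  intro z hz
  have hz' : Psi α + δ < tvDist o z (cutoffTime o (k N) (Fintype.card (G N)) α) := hz
  rw [h2] at hz'
  refine lt_of_le_of_lt ?_ hz'
  linarith

lemma tendstoInProb_tvDist (o : CayleyKind) (hyp : Condition k G) (α : ℝ) : TendstoInProb k G
    (fun N z => tvDist o z (cutoffTime o (k N) (Fintype.card (G N)) α)) (Psi α) := by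
  intro δ hδ
  refine tendsto_of_tendsto_of_tendsto_of_le_of_le' tendsto_const_nhds
    (tendsto_generatorLaw_tvDist_gt o hyp α hδ) (Eventually.of_forall fun _ => zero_le) ?_
  filter_upwards [eventually_Psi_sub_le_tvDist o hyp α hδ] with N h
  refine measure_mono fun z hz => ?_
  have hz' : δ < |tvDist o z (cutoffTime o (k N) (Fintype.card (G N)) α) - Psi α| := hz
  rcases lt_abs.1 hz' with h1 | h1
  · change Psi α + δ < _
    linarith
  · linarith [h z]

lemma eventually_entropicTime_pos (o : CayleyKind) (hyp : Condition k G) :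
    ∀ᶠ N in atTop, 0 < entropicTime o (k N) (Fintype.card (G N)) := by
  filter_upwards [eventually_one_le_cutoffLine o hyp.tendsto_k hyp.eventually_lt_log 0] with N h
  have hk0 : (0 : ℝ) < k N := Nat.cast_pos.2 (NeZero.pos _)
  rw [entropicTime_eq_cutoffLine]
  exact mul_pos hk0 (by linarith)

lemma tendsto_cutoffTime_div (o : CayleyKind) (hyp : Condition k G) (α : ℝ) : Tendsto
    (fun N => cutoffTime o (k N) (Fintype.card (G N)) α /
      entropicTime o (k N) (Fintype.card (G N))) atTop (𝓝 1) := by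
  have hk := hyp.tendsto_k
  have hn := hyp.eventually_lt_log
  refine (tendsto_cutoffLine_div o hk hn 0 α).congr' ?_
  filter_upwards [eventually_cutoffTime_eq o hk hn α] with N h
  have hk0 : (0 : ℝ) < k N := Nat.cast_pos.2 (NeZero.pos _)
  rw [h, entropicTime_eq_cutoffLine, mul_div_mul_left _ _ hk0.ne']

lemma tvDist_le_one {G : Type*} [AddCommGroup G] [Fintype G] {k : ℕ} [NeZero k]
    (o : CayleyKind) (z : Fin k → G) (t : ℝ) : tvDist o z t ≤ 1 := tvToUniform_le_one _

lemma tvDist_nonneg {G : Type*} [AddCommGroup G] [Fintype G] {k : ℕ} [NeZero k]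
    (o : CayleyKind) (z : Fin k → G) (t : ℝ) : 0 ≤ tvDist o z t := tvToUniform_nonneg _

lemma tendstoInProb_tvDist_before (o : CayleyKind) (hyp : Condition k G) {ε : ℝ} (hε : 0 < ε)
    (hε1 : ε < 1) : TendstoInProb k G (fun N z => tvDist o z
        ((1 - ε) * entropicTime o (k N) (Fintype.card (G N)))) 1 := by
  intro δ hδ
  obtain ⟨α, hα⟩ := (tendsto_Psi_atBot.eventually_const_lt
    (show 1 - δ / 2 < 1 by linarith)).exists
  refine tendsto_const_nhds.congr' ?_
  filter_upwards [eventually_Psi_sub_le_tvDist o hyp α (half_pos hδ),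
    (tendsto_cutoffTime_div o hyp α).eventually_const_lt (show 1 - ε < 1 by linarith),
    eventually_entropicTime_pos o hyp] with N h1 h2 h3
  rw [lt_div_iff₀ h3] at h2
  -- The lower bound holds for every `z`, so for large `N` there are no exceptional generators at
  -- all.
  have hempty : {z : Fin (k N) → G N | δ < |tvDist o z
      ((1 - ε) * entropicTime o (k N) (Fintype.card (G N))) - 1|} = ∅ := by
    refine Set.eq_empty_of_forall_notMem fun z hz => ?_
    have hz' : δ < |tvDist o z ((1 - ε) * entropicTime o (k N) (Fintype.card (G N))) - 1| := hz
    have h0 : 0 ≤ (1 - ε) * entropicTime o (k N) (Fintype.card (G N)) :=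
      mul_nonneg (by linarith) h3.le
    have h4 := tvDist_antitoneOn o z h0 (h0.trans h2.le) h2.le
    have h5 := tvDist_le_one o z ((1 - ε) * entropicTime o (k N) (Fintype.card (G N)))
    have h6 := h1 z
    rw [abs_of_nonpos (by linarith)] at hz'
    linarith
  rw [hempty, measure_empty]

lemma tendstoInProb_tvDist_after (o : CayleyKind) (hyp : Condition k G) {ε : ℝ} (hε : 0 < ε) :
    TendstoInProb k G (fun N z => tvDist o z
        ((1 + ε) * entropicTime o (k N) (Fintype.card (G N)))) 0 := by
  intro δ hδ
  obtain ⟨α, hα⟩ := (tendsto_Psi_atTop.eventually_lt_const (half_pos hδ)).exists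
  refine tendsto_of_tendsto_of_tendsto_of_le_of_le' tendsto_const_nhds
    (tendsto_generatorLaw_tvDist_gt o hyp α (half_pos hδ))
    (Eventually.of_forall fun _ => zero_le) ?_
  filter_upwards [(tendsto_cutoffTime_div o hyp α).eventually_lt_const
    (show 1 < 1 + ε by linarith), (tendsto_cutoffTime_div o hyp α).eventually_const_lt
    (show (0 : ℝ) < 1 by norm_num), eventually_entropicTime_pos o hyp] with N h1 h2 h3
  rw [div_lt_iff₀ h3] at h1
  rw [lt_div_iff₀ h3, zero_mul] at h2
  refine measure_mono fun z hz => ?_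
  have hz' : δ < |tvDist o z ((1 + ε) * entropicTime o (k N) (Fintype.card (G N))) - 0| := hz
  have h4 := tvDist_antitoneOn o z h2.le (h2.le.trans h1.le) h1.le
  rw [sub_zero, abs_of_nonneg (tvDist_nonneg o z _)] at hz'
  change Psi α + δ / 2 < _
  linarith

lemma eventually_cutoffTime_nonneg (o : CayleyKind) (hyp : Condition k G) (α : ℝ) :
    ∀ᶠ N in atTop, 0 ≤ cutoffTime o (k N) (Fintype.card (G N)) α := by
  filter_upwards [eventually_cutoffTime_eq o hyp.tendsto_k hyp.eventually_lt_log α,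
    eventually_one_le_cutoffLine o hyp.tendsto_k hyp.eventually_lt_log α] with N h1 h2
  rw [h1]
  exact mul_nonneg (Nat.cast_nonneg _) (by linarith)

/-- The mixing time lies between cutoff times once the walk is well mixed at the later one. -/
lemma eventually_exists_mixingTime (o : CayleyKind) (hyp : Condition k G) {a η : ℝ}
    (hη : 0 < η) : ∀ᶠ N in atTop, ∀ z : Fin (k N) → G N,
      tvDist o z (cutoffTime o (k N) (Fintype.card (G N)) (a + η)) ≤ Psi a →
      ∃ τ, IsMixingTime o z (Psi a) τ ∧
        cutoffTime o (k N) (Fintype.card (G N)) (a - η) ≤ τ ∧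
        τ ≤ cutoffTime o (k N) (Fintype.card (G N)) (a + η) := by
  -- Half of this gap is the tolerance in the lower bound, so at `t_{a-η}` the distance exceeds `Psi
  -- a` for every `z`.
  have hlt := Psi_strictAnti (show a - η < a by linarith)
  filter_upwards [eventually_Psi_sub_le_tvDist o hyp (a - η)
      (show 0 < (Psi (a - η) - Psi a) / 2 by linarith),
    eventually_cutoffTime_nonneg o hyp (a + η), eventually_cutoffTime_nonneg o hyp (a - η)]
    with N h1 h2 h3 z hz
  set S := {t : ℝ | 0 ≤ t ∧ tvDist o z t ≤ Psi a} with hS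
  have hne : S.Nonempty := ⟨_, h2, hz⟩
  have hbdd : BddBelow S := ⟨0, fun t ht => ht.1⟩
  have hglb : IsGLB S (sInf S) := isGLB_csInf hne hbdd
  refine ⟨sInf S, hglb, ?_, hglb.1 ⟨h2, hz⟩⟩
  refine le_csInf hne fun t ht => ?_
  by_contra hcon
  have h4 := tvDist_antitoneOn o z ht.1 h3 (not_le.1 hcon).le
  linarith [h1 z, ht.2]

lemma tendsto_generatorLaw_not_mixed (o : CayleyKind) (hyp : Condition k G) {a η : ℝ}
    (hη : 0 < η) : Tendsto (fun N => generatorLaw (k N) (G N)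
      {z | Psi a < tvDist o z (cutoffTime o (k N) (Fintype.card (G N)) (a + η))}) atTop
      (𝓝 0) := by
  have hlt := Psi_strictAnti (show a < a + η by linarith)
  have := tendsto_generatorLaw_tvDist_gt o hyp (a + η) (sub_pos.2 hlt)
  simpa only [add_sub_cancel] using this

lemma whp_mixingTime_sub (o : CayleyKind) (hyp : Condition k G) (a : ℝ) {δ : ℝ} (hδ : 0 < δ) :
    Whp k G fun N => {z | ∃ τ τ' : ℝ, IsMixingTime o z (Psi a) τ ∧ IsMixingTime o z (1 / 2) τ' ∧
        |(τ - τ') - (cutoffTime o (k N) (Fintype.card (G N)) a -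
            entropicTime o (k N) (Fintype.card (G N)))| ≤
          δ * |cutoffTime o (k N) (Fintype.card (G N)) a -
            entropicTime o (k N) (Fintype.card (G N))|} := by
  have hk := hyp.tendsto_k
  have hn := hyp.eventually_lt_log
  -- At `a = 0` the right-hand side vanishes, so exact equality is needed; it holds since the two
  -- mixing times coincide.
  rcases eq_or_ne a 0 with rfl | ha
  · refine Whp.of_compl_subset (tendsto_generatorLaw_not_mixed o hyp (a := 0) one_pos) ?_
    filter_upwards [eventually_exists_mixingTime o hyp (a := 0) one_pos] with N h1 z hz
    obtain ⟨τ, hτ, -⟩ := h1 z (not_lt.1 hz)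
    refine ⟨τ, τ, hτ, by rwa [Psi_zero] at hτ, ?_⟩
    have : cutoffTime o (k N) (Fintype.card (G N)) 0 =
        entropicTime o (k N) (Fintype.card (G N)) := by
      simp [cutoffTime, entropyTarget, entropicTime]
    simp [this]
  -- Write `W = s₀ √v / √k`. The two mixing times lie in windows of total length at most `8 e⁷ η k
  -- W`, while `k |a| W ≤ 12 |t_a - t_0|`; this `η` makes the total at most `δ |t_a - t_0|`.
  · set η : ℝ := δ * |a| / (96 * Real.exp 7) with hη
    have ha' := abs_pos.2 ha
    have hη0 : 0 < η := by positivity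
    have hB := (tendsto_generatorLaw_not_mixed o hyp (a := a) hη0).add
      (tendsto_generatorLaw_not_mixed o hyp (a := 0) hη0)
    rw [add_zero] at hB
    refine Whp.of_compl_subset (B := fun N =>
      {z | Psi a < tvDist o z (cutoffTime o (k N) (Fintype.card (G N)) (a + η))} ∪
      {z | Psi 0 < tvDist o z (cutoffTime o (k N) (Fintype.card (G N)) (0 + η))})
      (tendsto_of_tendsto_of_tendsto_of_le_of_le tendsto_const_nhds hB (fun _ => zero_le)
        fun N => measure_union_le _ _) ?_
    have hwin : ∀ᶠ N in atTop, |a| * (lineTime o (Real.log (Fintype.card (G N)) / k N) *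
        (√(lineVar o (lineTime o (Real.log (Fintype.card (G N)) / k N))) / √(k N))) ≤
        12 * |cutoffLine o (k N) (Fintype.card (G N)) a -
          cutoffLine o (k N) (Fintype.card (G N)) 0| := by
      rcases lt_or_gt_of_ne ha with h | h
      · filter_upwards [eventually_cutoffLine_sub o hk hn h] with N hN
        rw [abs_sub_comm, abs_of_pos (sub_pos.2 hN.1), abs_of_neg h]
        simpa using hN.2.2
      · filter_upwards [eventually_cutoffLine_sub o hk hn h] with N hN
        rw [abs_of_pos (sub_pos.2 hN.1), abs_of_pos h]
        simpa using hN.2.2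
    filter_upwards [eventually_exists_mixingTime o hyp (a := a) hη0,
      eventually_exists_mixingTime o hyp (a := 0) hη0, hwin,
      eventually_cutoffLine_sub o hk hn (show a - η < a + η by linarith),
      eventually_cutoffLine_sub o hk hn (show 0 - η < 0 + η by linarith),
      eventually_cutoffLine_sub o hk hn (show a - η < a by linarith),
      eventually_cutoffLine_sub o hk hn (show a < a + η by linarith),
      eventually_cutoffLine_sub o hk hn (show 0 - η < 0 by linarith),
      eventually_cutoffLine_sub o hk hn (show 0 < 0 + η by linarith),
      eventually_cutoffTime_eq o hk hn a, eventually_cutoffTime_eq o hk hn (a - η),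
      eventually_cutoffTime_eq o hk hn (a + η), eventually_cutoffTime_eq o hk hn (0 - η),
      eventually_cutoffTime_eq o hk hn (0 + η)]
      with N m1 m2 w0 w1 w2 o1 o2 o3 o4 e1 e2 e3 e4 e5 z hz
    obtain ⟨hz1, hz2⟩ := not_or.1 hz
    obtain ⟨τ, hτ, l1, u1⟩ := m1 z (not_lt.1 hz1)
    obtain ⟨τ', hτ', l2, u2⟩ := m2 z (not_lt.1 hz2)
    refine ⟨τ, τ', hτ, by rwa [Psi_zero] at hτ', ?_⟩
    have hk0 : (0 : ℝ) < k N := Nat.cast_pos.2 (NeZero.pos _)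
    rw [e2] at l1
    rw [e3] at u1
    rw [e4] at l2
    rw [e5] at u2
    rw [e1, entropicTime_eq_cutoffLine, ← mul_sub, abs_mul, abs_of_pos hk0]
    set K : ℝ := (k N : ℝ)
    set W := lineTime o (Real.log (Fintype.card (G N)) / K) *
        (√(lineVar o (lineTime o (Real.log (Fintype.card (G N)) / K))) / √K)
    set sa := cutoffLine o (k N) (Fintype.card (G N)) a
    set s0 := cutoffLine o (k N) (Fintype.card (G N)) 0
    have p1 := mul_le_mul_of_nonneg_left w1.2.1 hk0.le
    have p2 := mul_le_mul_of_nonneg_left w2.2.1 hk0.le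
    have q1 := mul_le_mul_of_nonneg_left o1.1.le hk0.le
    have q2 := mul_le_mul_of_nonneg_left o2.1.le hk0.le
    have q3 := mul_le_mul_of_nonneg_left o3.1.le hk0.le
    have q4 := mul_le_mul_of_nonneg_left o4.1.le hk0.le
    have hfin : δ / 12 * (K * (|a| * W)) ≤ δ / 12 * (K * (12 * |sa - s0|)) := by gcongr
    have hW : δ / 12 * (K * (|a| * W)) = 8 * Real.exp 7 * η * (K * W) := by
      rw [hη]
      field_simp
      ring
    have hr1 : K * (2 * Real.exp 7 * (a + η - (a - η)) * W) = 4 * Real.exp 7 * η * (K * W) := by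
      ring
    have hr2 : K * (2 * Real.exp 7 * (0 + η - (0 - η)) * W) = 4 * Real.exp 7 * η * (K * W) := by
      ring
    rw [hr1, mul_sub] at p1
    rw [hr2, mul_sub] at p2
    rw [hW] at hfin
    have hgoal : δ * (K * |sa - s0|) = δ / 12 * (K * (12 * |sa - s0|)) := by ring
    rw [hgoal, mul_sub]
    refine le_trans (abs_le.2 ⟨?_, ?_⟩) hfin <;> linarith

lemma whp_mixingTime_window (o : CayleyKind) (hyp : Condition k G)
    (hs : Tendsto (fun N => (k N : ℝ) / Real.log (Fintype.card (G N))) atTop (𝓝 0))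
    (a : ℝ) {δ : ℝ} (hδ : 0 < δ) :
    Whp k G fun N => {z | ∃ τ : ℝ, IsMixingTime o z (Psi a) τ ∧
          |(τ - entropicTime o (k N) (Fintype.card (G N))) /
            (Real.sqrt (k N) * (Fintype.card (G N) : ℝ) ^ (2 / (k N : ℝ)) /
              (Real.sqrt 2 * Real.pi * Real.exp 1)) - a| ≤ δ} := by
  have hk := hyp.tendsto_k
  have hn := hyp.eventually_lt_log
  have hη : 0 < δ / 2 := half_pos hδ
  refine Whp.of_compl_subset (tendsto_generatorLaw_not_mixed o hyp (a := a) hη) ?_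
  filter_upwards [eventually_exists_mixingTime o hyp (a := a) hη,
    (tendsto_cutoffTime_sub_div o hk hn hs (a + δ / 2)).eventually_lt_const
      (show a + δ / 2 < a + δ by linarith),
    (tendsto_cutoffTime_sub_div o hk hn hs (a - δ / 2)).eventually_const_lt
      (show a - δ < a - δ / 2 by linarith)] with N h1 h2 h3 z hz
  obtain ⟨τ, hτ, hl, hu⟩ := h1 z (not_lt.1 hz)
  refine ⟨τ, hτ, ?_⟩
  have hk0 : (0 : ℝ) < k N := Nat.cast_pos.2 (NeZero.pos _)
  have hn0 : (0 : ℝ) < Fintype.card (G N) := Nat.cast_pos.2 Fintype.card_pos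
  have hpi := Real.pi_pos
  have hw : 0 < √(k N : ℝ) * (Fintype.card (G N) : ℝ) ^ (2 / (k N : ℝ)) /
      (√2 * Real.pi * Real.exp 1) := by positivity
  set w := √(k N : ℝ) * (Fintype.card (G N) : ℝ) ^ (2 / (k N : ℝ)) /
      (√2 * Real.pi * Real.exp 1)
  have h4 := div_le_div_of_nonneg_right
    (sub_le_sub_right hu (entropicTime o (k N) (Fintype.card (G N)))) hw.le
  have h5 := div_le_div_of_nonneg_right
    (sub_le_sub_right hl (entropicTime o (k N) (Fintype.card (G N)))) hw.le
  exact abs_le.2 ⟨by linarith, by linarith⟩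

end Main

end RandomCayley

theorem mainTheorem2
    (o : CayleyKind) (k : ℕ → ℕ) [∀ N, NeZero (k N)]
    (G : ℕ → Type*) [∀ N, AddCommGroup (G N)] [∀ N, Fintype (G N)]
    (hyp : Condition k G) :
    -- the entropic and cutoff times are well defined
    ((∀ N, Set.BijOn (entropy o (k N)) (Set.Ici 0) (Set.Ici 0)) ∧
      ∀ α : ℝ, ∀ᶠ N in atTop, 0 ≤ entropyTarget o (k N) (Fintype.card (G N)) α) ∧
    -- the cutoff times are asymptotically equivalent
    (∀ α : ℝ, Tendsto
      (fun N => cutoffTime o (k N) (Fintype.card (G N)) α /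
        entropicTime o (k N) (Fintype.card (G N))) atTop (𝓝 1)) ∧
    -- limit profile
    (∀ α : ℝ, TendstoInProb k G
      (fun N z => tvDist o z (cutoffTime o (k N) (Fintype.card (G N)) α)) (Psi α)) ∧
    -- the lower bound holds for every choice of generators
    (∀ α δ : ℝ, 0 < δ → ∀ᶠ N in atTop, ∀ z : Fin (k N) → G N,
      Psi α - δ ≤ tvDist o z (cutoffTime o (k N) (Fintype.card (G N)) α)) ∧
    -- cutoff at the entropic time
    (∀ ε : ℝ, 0 < ε → ε < 1 →
      TendstoInProb k G (fun N z => tvDist o z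
        ((1 - ε) * entropicTime o (k N) (Fintype.card (G N)))) 1 ∧
      TendstoInProb k G (fun N z => tvDist o z
        ((1 + ε) * entropicTime o (k N) (Fintype.card (G N)))) 0) ∧
    -- differences of mixing times
    (∀ ε : ℝ, 0 < ε → ε < 1 → ∃ a : ℝ, Psi a = ε ∧ ∀ δ : ℝ, 0 < δ →
      Whp k G fun N => {z | ∃ τ τ' : ℝ, IsMixingTime o z ε τ ∧ IsMixingTime o z (1 / 2) τ' ∧
        |(τ - τ') - (cutoffTime o (k N) (Fintype.card (G N)) a -
            entropicTime o (k N) (Fintype.card (G N)))| ≤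
          δ * |cutoffTime o (k N) (Fintype.card (G N)) a -
            entropicTime o (k N) (Fintype.card (G N))|}) ∧
    -- explicit cutoff time and window when `k` is of smaller order than `log |G|`
    (Tendsto (fun N => (k N : ℝ) / Real.log (Fintype.card (G N))) atTop (𝓝 0) →
      Tendsto (fun N => entropicTime o (k N) (Fintype.card (G N)) /
        ((k N : ℝ) * (Fintype.card (G N) : ℝ) ^ (2 / (k N : ℝ)) /
          (2 * Real.pi * Real.exp 1))) atTop (𝓝 1) ∧
      (∀ α : ℝ, Tendsto (fun N => (cutoffTime o (k N) (Fintype.card (G N)) α -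
          entropicTime o (k N) (Fintype.card (G N))) /
        (Real.sqrt (k N) * (Fintype.card (G N) : ℝ) ^ (2 / (k N : ℝ)) /
          (Real.sqrt 2 * Real.pi * Real.exp 1))) atTop (𝓝 α)) ∧
      ∀ ε : ℝ, 0 < ε → ε < 1 → ∃ a : ℝ, Psi a = ε ∧ ∀ δ : ℝ, 0 < δ →
        Whp k G fun N => {z | ∃ τ : ℝ, IsMixingTime o z ε τ ∧
          |(τ - entropicTime o (k N) (Fintype.card (G N))) /
            (Real.sqrt (k N) * (Fintype.card (G N) : ℝ) ^ (2 / (k N : ℝ)) /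
              (Real.sqrt 2 * Real.pi * Real.exp 1)) - a| ≤ δ}) := by
  have hk := hyp.tendsto_k
  have hn := hyp.eventually_lt_log
  refine ⟨⟨fun N => bijOn_entropy o (k N), eventually_entropyTarget_nonneg o hk hn⟩,
    tendsto_cutoffTime_div o hyp, tendstoInProb_tvDist o hyp,
    fun α δ hδ => eventually_Psi_sub_le_tvDist o hyp α hδ,
    fun ε h0 h1 => ⟨tendstoInProb_tvDist_before o hyp h0 h1, tendstoInProb_tvDist_after o hyp h0⟩,
    fun ε h0 h1 => ?_, fun hs => ⟨tendsto_entropicTime_div o hn hs,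
      tendsto_cutoffTime_sub_div o hk hn hs, fun ε h0 h1 => ?_⟩⟩
  · obtain ⟨a, rfl⟩ := exists_Psi_eq h0 h1
    exact ⟨a, rfl, fun δ hδ => whp_mixingTime_sub o hyp a hδ⟩
  · obtain ⟨a, rfl⟩ := exists_Psi_eq h0 h1
    exact ⟨a, rfl, fun δ hδ => whp_mixingTime_window o hyp hs a hδ⟩
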